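/- Let $q\in\tfrac12\mathbb N$, $N_\theta=q+1$ if $q$ is an integer and $N_\theta=q+\tfrac12$ otherwise, $N_\phi=N_\psi=4q+1$. Let $x_s=\cos\theta_s$ ($1\le s\le N_\theta$, $0<\theta_s<\pi$) be the roots of the Legendre polynomial $P_{N_\theta}$ and $w_s$ the Gaussian weights, i.e. the solution of $\sum_s P_k(x_s)w_s=2\delta_{k0}$ for $0\le k<N_\theta$. The partitioning of $S_3$ consists of the points $\alpha=(\theta_s,\tfrac{4\pi}{N_\phi}b,\tfrac{4\pi}{N_\psi}c)$ with $1\le b\le N_\phi$, $1\le c\le N_\psi$. For $2j\in\mathbb N$, $m_L,m_R\in\{-j,\dots,j\}$ let $D^j_{m_Lm_R}(\theta,\phi,\psi)=e^{im_L\phi}\,d^j_{m_Lm_R}(\theta)\,e^{im_R\psi}$ be the Wigner functions, where with $x=\cos\theta$ $$d^j_{m_Lm_R}(\theta)=\left(\tfrac{(j+m_R)!(j-m_R)!}{(j+m_L)!(j-m_L)!}\right)^{1/2}\left(\tfrac{1-x}2\right)^{\frac{m_R-m_L}2}\left(\tfrac{1+x}2\right)^{\frac{m_R+m_L}2}P^{(m_R-m_L,\,m_R+m_L)}_{j-m_R}(x)$$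 and $P^{(\alpha,\beta)}_n$ are the Jacobi polynomials. Let $V$ be the matrix with rows indexed by the points $\alpha$, columns indexed by the $N_q=\sum_{j\le q}(2j+1)^2$ triples $(j,m_L,m_R)$ with $j\le q$ ($j=0,\tfrac12,1,\dots,q$), and entries $$V_{\alpha,(j,m_L,m_R)}=\sqrt{j+\tfrac12}\,\sqrt{\tfrac{w_s}{N_\phi N_\psi}}\;D^j_{m_Lm_R}(\alpha).$$ Let $L_a=V\hat L_aV^\dagger$ and $R_3=V\hat R_3V^\dagger$, where $\hat L_3|j,m_L,m_R\rangle=m_L|j,m_L,m_R\rangle$, $(\hat L_1\pm i\hat L_2)|j,m_L,m_R\rangle=\sqrt{j(j+1)-m_L(m_L\pm1)}\,|j,m_L\pm1,m_R\rangle$ and $\hat R_3|j,m_L,m_R\rangle=-m_R|j,m_L,m_R\rangle$. 1. For every $q$, the $N_q$ columns of $V$ are linearly independent joint eigenvectors of $\sum_aL_aL_a$, $L_3$, $R_3$ with eigenvalues $j(j+1)$, $m_L$, $-m_R$; for $j>0$ every joint eigenvector with these eigenvalues is a multiple of the corresponding column. 2. The functions $D^j_{m_Lm_R}$ satisfy,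 for $0<\theta<\pi$, the eigenvalue equations with the same eigenvalues for the continuum operators $\sum_aL_aL_a=-\cot\theta\,\partial_\theta-\partial_\theta^2-\frac1{\sin^2\theta}\partial_\phi^2+2\frac{\cos\theta}{\sin^2\theta}\partial_\psi\partial_\phi-\frac1{\sin^2\theta}\partial_\psi^2$, $L_3=-i\partial_\phi$, $R_3=i\partial_\psi$. 3. As $q\to\infty$, the columns of $V$ approach the sampled continuum eigenfunctions. Precisely, let $$\widetilde D^j_{m_Lm_R}(\alpha)=\sqrt{\sin\theta_s\,\tfrac{\pi}{N_\theta}\,\tfrac{4\pi}{N_\phi}\,\tfrac{4\pi}{N_\psi}}\;\frac{\sqrt{j+1/2}}{4\pi}\,D^j_{m_Lm_R}(\alpha)$$ be the value at $\alpha$ of the eigenfunction normalized in $L^2(\sin\theta\,d\theta\,d\phi\,d\psi)$ on $[0,\pi]\times[0,4\pi]^2$, times the square root of the Haar volume of a grid cell. Then $$\max_{j\le q,\;m_L,\,m_R}\Big(\sum_\alpha\big|V_{\alpha,(j,m_L,m_R)}-\widetilde D^j_{m_Lm_R}(\alpha)\big|^2\Big)^{1/2}\to0\qquad(q\to\infty),$$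 and for all $\delta,\varepsilon>0$ there is $q_0$ such that for all $q\ge q_0$, all $(j,m_L,m_R)$ with $j\le q$ and all points $\alpha$ with $\delta\le\theta_s\le\pi-\delta$, $$\big|V_{\alpha,(j,m_L,m_R)}-\widetilde D^j_{m_Lm_R}(\alpha)\big|\le\varepsilon\,\big|\widetilde D^j_{m_Lm_R}(\alpha)\big|.$$ -/

import Mathlib

open Matrix

noncomputable section

namespace DJT

/-! ### Gauss-Legendre nodes and weights -/

/-- The `n`-th Legendre polynomial (Rodrigues' formula). -/
def legendre (n : ℕ) : Polynomial ℝ :=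
  Polynomial.C (1 / (2 ^ n * (n.factorial : ℝ))) *
    Polynomial.derivative^[n] ((Polynomial.X ^ 2 - 1) ^ n)

/-- The roots `x_s = cos θ_s` of the `n`-th Legendre polynomial, in decreasing order. -/
def legendreNode (n : ℕ) (s : Fin n) : ℝ :=
  ((legendre n).roots.sort (· ≥ ·)).getD s 0

/-- The angles `θ_s` of the Legendre partitioning, in increasing order. -/
def legendreAngle (n : ℕ) (s : Fin n) : ℝ :=
  Real.arccos (legendreNode n s)

/-- The Gaussian weights: the solution `w` of the (non-singular) linear system
`∑ s, P_k(x_s) w_s = ⟨P_0, P_0⟩` for `k = 0` and `= 0` for `k = 1, …, n - 1`,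
with weight function `1` on `[-1, 1]`. -/
def gaussWeight (n : ℕ) : Fin n → ℝ :=
  (Matrix.of fun k s : Fin n => (legendre k).eval (legendreNode n s))⁻¹ *ᵥ
    fun k => if (k : ℕ) = 0 then
      ∫ x in (-1 : ℝ)..1, (legendre 0).eval x * (legendre 0).eval x else 0

/-! ### Wigner functions

A half-integer `j` is encoded by `J = 2 j`, and the magnetic numbers `mL, mR ∈ {-j, …, j}` by
the natural numbers `a = j + mL`, `b = j + mR` in `{0, …, J}`. -/

/-- The Jacobi polynomial `P_n^{(α, β)}(x)`. -/
def jacobi (n : ℕ) (α β x : ℝ) : ℝ :=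
  ∑ s ∈ Finset.range (n + 1),
    Ring.choose ((n : ℝ) + α) (n - s) * Ring.choose ((n : ℝ) + β) s *
      ((x - 1) / 2) ^ s * ((x + 1) / 2) ^ (n - s)

/-- The Wigner function `d^j_{mL mR}(θ)` for `0 < θ < π`, i.e.
`√((j+mR)! (j-mR)! / ((j+mL)! (j-mL)!)) ((1-x)/2)^((mR-mL)/2) ((1+x)/2)^((mR+mL)/2)
  P_{j-mR}^{(mR-mL, mR+mL)}(x)` with `x = cos θ`, `J = 2j`, `a = j + mL`, `b = j + mR`. -/
def wignerSmallD (J a b : ℕ) (θ : ℝ) : ℝ :=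
  √((b.factorial * (J - b).factorial : ℝ) / (a.factorial * (J - a).factorial : ℝ)) *
    ((1 - Real.cos θ) / 2) ^ (((b : ℝ) - a) / 2) *
    ((1 + Real.cos θ) / 2) ^ (((a : ℝ) + b - J) / 2) *
    jacobi (J - b) ((b : ℝ) - a) ((a : ℝ) + b - J) (Real.cos θ)

/-- The labels `(j, mL, mR)` with `j ≤ q`, where `Q = 2 q`; there are `N_q` of them. -/
abbrev Label (Q : ℕ) : Type :=
  Σ J : Fin (Q + 1), Fin ((J : ℕ) + 1) × Fin ((J : ℕ) + 1)

namespace Label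

variable {Q : ℕ}

/-- `2 j` -/
def twoJ (l : Label Q) : ℕ := l.1

/-- `j + mL` -/
def a (l : Label Q) : ℕ := l.2.1

/-- `j + mR` -/
def b (l : Label Q) : ℕ := l.2.2

/-- the main quantum number `j` -/
def j (l : Label Q) : ℝ := (l.twoJ : ℝ) / 2

/-- the left magnetic quantum number -/
def mL (l : Label Q) : ℝ := (l.a : ℝ) - l.j

/-- the right magnetic quantum number -/
def mR (l : Label Q) : ℝ := (l.b : ℝ) - l.j

end Label

/-- The Wigner function `D^j_{mL mR}(θ, φ, ψ) = e^{i mL φ} d^j_{mL mR}(θ) e^{i mR ψ}`. -/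
def wignerD {Q : ℕ} (l : Label Q) (θ φ ψ : ℝ) : ℂ :=
  Complex.exp (Complex.I * l.mL * φ) * (wignerSmallD l.twoJ l.a l.b θ : ℂ) *
    Complex.exp (Complex.I * l.mR * ψ)

/-! ### The continuum operators on functions of the Euler angles `(θ, φ, ψ)` -/

/-- `L_3 = -i ∂_φ` -/
def contL3 (f : ℝ → ℝ → ℝ → ℂ) (θ φ ψ : ℝ) : ℂ :=
  -Complex.I * deriv (fun t => f θ t ψ) φ

/-- `R_3 = i ∂_ψ` -/
def contR3 (f : ℝ → ℝ → ℝ → ℂ) (θ φ ψ : ℝ) : ℂ :=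
  Complex.I * deriv (fun t => f θ φ t) ψ

/-- `∑ L_a L_a = -cot θ ∂_θ - ∂_θ² - (1/sin² θ) ∂_φ² + 2 (cos θ/sin² θ) ∂_ψ ∂_φ
- (1/sin² θ) ∂_ψ²` -/
def contLsq (f : ℝ → ℝ → ℝ → ℂ) (θ φ ψ : ℝ) : ℂ :=
  -((Real.cos θ / Real.sin θ : ℝ) : ℂ) * deriv (fun t => f t φ ψ) θ
    - deriv (deriv fun t => f t φ ψ) θ
    - ((1 / Real.sin θ ^ 2 : ℝ) : ℂ) * deriv (deriv fun t => f θ t ψ) φ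
    + 2 * ((Real.cos θ / Real.sin θ ^ 2 : ℝ) : ℂ) *
        deriv (fun u => deriv (fun t => f θ t u) φ) ψ
    - ((1 / Real.sin θ ^ 2 : ℝ) : ℂ) * deriv (deriv fun t => f θ φ t) ψ

/-! ### The partitioning of the 3-sphere -/

/-- `N_θ`: equal to `q + 1` for integer `q` and to `q + 1/2` otherwise, where `Q = 2 q`. -/
def nTheta (Q : ℕ) : ℕ := Q / 2 + 1

/-- `N_φ = N_ψ = 4 q + 1`, where `Q = 2 q`. -/
def nPhi (Q : ℕ) : ℕ := 2 * Q + 1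

/-- Indices of the `N_α = N_θ N_φ N_ψ` points of the partitioning. -/
abbrev Grid (Q : ℕ) : Type := Fin (nTheta Q) × Fin (nPhi Q) × Fin (nPhi Q)

variable {Q : ℕ}

/-- The `θ` coordinate of a grid point. -/
def gridTheta (k : Grid Q) : ℝ := legendreAngle (nTheta Q) k.1

/-- The `φ` coordinate `4 π b / N_φ`, `b = 1, …, N_φ`, of a grid point. -/
def gridPhi (k : Grid Q) : ℝ := 4 * Real.pi / nPhi Q * ((k.2.1 : ℕ) + 1)

/-- The `ψ` coordinate `4 π c / N_ψ`, `c = 1, …, N_ψ`, of a grid point. -/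
def gridPsi (k : Grid Q) : ℝ := 4 * Real.pi / nPhi Q * ((k.2.2 : ℕ) + 1)

/-- The matrix `V` of the discrete Jacobi transform. -/
def V (Q : ℕ) : Matrix (Grid Q) (Label Q) ℂ := Matrix.of fun k l =>
  ((√(l.j + 1 / 2) * √(gaussWeight (nTheta Q) k.1 / (nPhi Q * nPhi Q)) : ℝ) : ℂ) *
    wignerD l (gridTheta k) (gridPhi k) (gridPsi k)

/-! ### Truncated momenta in the electric basis `|j, mL, mR⟩` -/

/-- `L_1 + i L_2` -/
def hatLplus (Q : ℕ) : Matrix (Label Q) (Label Q) ℂ := Matrix.of fun l' l =>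
  if l'.twoJ = l.twoJ ∧ l'.a = l.a + 1 ∧ l'.b = l.b then
    ((√(l.j * (l.j + 1) - l.mL * (l.mL + 1)) : ℝ) : ℂ) else 0

/-- `L_1 - i L_2` -/
def hatLminus (Q : ℕ) : Matrix (Label Q) (Label Q) ℂ := Matrix.of fun l' l =>
  if l'.twoJ = l.twoJ ∧ l'.a + 1 = l.a ∧ l'.b = l.b then
    ((√(l.j * (l.j + 1) - l.mL * (l.mL - 1)) : ℝ) : ℂ) else 0

/-- `L_1, L_2, L_3` in the electric basis (indexed by `0, 1, 2`). -/
def hatL (Q : ℕ) : Fin 3 → Matrix (Label Q) (Label Q) ℂ :=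
  ![(1 / 2 : ℂ) • (hatLplus Q + hatLminus Q),
    (1 / (2 * Complex.I) : ℂ) • (hatLplus Q - hatLminus Q),
    Matrix.diagonal fun l => (l.mL : ℂ)]

/-- `R_3` in the electric basis. -/
def hatR3 (Q : ℕ) : Matrix (Label Q) (Label Q) ℂ :=
  Matrix.diagonal fun l => (-l.mR : ℂ)

/-! ### Truncated momenta in the magnetic basis (`V` has orthonormal columns and `V⁻¹ = V†`) -/

/-- `L_a = V L̂_a V†` -/
def L (Q : ℕ) (c : Fin 3) : Matrix (Grid Q) (Grid Q) ℂ := V Q * hatL Q c * (V Q)ᴴ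

/-- `∑ L_a L_a` -/
def Lsq (Q : ℕ) : Matrix (Grid Q) (Grid Q) ℂ := ∑ c, L Q c * L Q c

/-- `R_3 = V R̂_3 V†` -/
def R3 (Q : ℕ) : Matrix (Grid Q) (Grid Q) ℂ := V Q * hatR3 Q * (V Q)ᴴ

/-- `v` satisfies the joint eigenvalue equations of `∑ L_a L_a`, `L_3`, `R_3` with the quantum
numbers `(j, mL, mR)`. -/
def IsJointEigen (l : Label Q) (v : Grid Q → ℂ) : Prop :=
  Lsq Q *ᵥ v = ((l.j * (l.j + 1) : ℝ) : ℂ) • v ∧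
    L Q 2 *ᵥ v = (l.mL : ℂ) • v ∧ R3 Q *ᵥ v = (-l.mR : ℂ) • v

/-! ### The naive discretization of the continuum eigenfunctions -/

/-- The eigenfunction `D^j_{mL mR}` normalized in `L²` with respect to the Haar measure
`sin θ dθ dφ dψ` on `[0, π] × [0, 4π] × [0, 4π]`. -/
def normalizedD (l : Label Q) (θ φ ψ : ℝ) : ℂ :=
  ((√(l.j + 1 / 2) / (4 * Real.pi) : ℝ) : ℂ) * wignerD l θ φ ψ

/-- The Haar volume `sin θ Δθ Δφ Δψ` attached to a grid point, with the spacings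
`Δθ = π / N_θ`, `Δφ = 4 π / N_φ`, `Δψ = 4 π / N_ψ`. -/
def cellVolume (k : Grid Q) : ℝ :=
  Real.sin (gridTheta k) * (Real.pi / nTheta Q) * (4 * Real.pi / nPhi Q) *
    (4 * Real.pi / nPhi Q)

/-- The normalized eigenfunction sampled on the grid; the square root of the cell volume turns
the `L²` norm into the Euclidean norm. -/
def sampledD (l : Label Q) (k : Grid Q) : ℂ :=
  ((√(cellVolume k) : ℝ) : ℂ) * normalizedD l (gridTheta k) (gridPhi k) (gridPsi k)

end DJT

end

/-!
Everything rests on Gauss quadrature for the Legendre polynomial `P_n`, `n = N_θ`, which is exact in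
degree less than `2 n` (`sum_gaussWeight_eval`) and has positive weights (`gaussWeight_pos`).

*Discrete eigenvectors.* By Rodrigues' formula (`rodrigues`) the product of two Wigner functions
`d^j`, `d^j'` with the same magnetic numbers is a polynomial of degree `j + j' ≤ 2 q < 2 n` in
`cos θ`, whose integral is computed by repeated integration by parts. Together with the
orthogonality of the exponentials on the equidistant grids this gives `V† V = 1`
(`conjTranspose_V_mul_V`). Hence `L_a L_a` and the other operators are the conjugates by `V` of
diagonal matrices with distinct joint eigenvalues; the kernel of `V†` only contributes the
eigenvalue zero of the Casimir operator, which is excluded by `j > 0`.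

*Continuum eigenfunctions.* The derivatives in Rodrigues' formula satisfy a second order equation
(`jacobi_ode`), obtained by differentiating the first order equation of the weight
`(1 - x)^A (1 + x)^B`. The substitution `x = cos θ` turns it into Wigner's equation
(`exists_hasDerivAt_wignerSmallD`).

*Convergence.* A column of `V` and the sampled eigenfunction differ by the factor `√w_s / √u_s`,
where `u_s = π sin θ_s / n` (`asympWeight`). The function `u = √(sin θ) P_n(cos θ)` satisfies
`u'' + Φ u = 0` with `Φ = (n + 1/2)² + 1 / (4 sin² θ)`, which is smallest at `π / 2`. Therefore the
energy `Φ u² + u'²` is smallest, and the energy divided by `Φ` is largest, at `π / 2`. At a node the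
energy is `u'² = 2 sin θ_s / w_s`, and at `π / 2` it is evaluated by Wallis' product. The result is
`w_s ≤ u_s ≤ w_s (1 + O(1 / n) + O(1 / (n sin θ_s)²))` (`gaussWeight_le_asympWeight`,
`asympWeight_le`), which is the componentwise convergence away from the poles.

For the convergence in norm, uniformly in `j ≤ q`, the sphere is cut at distance `K / n` from the
poles. In the interior the error is a small multiple of the squared norm of the column, which is
one. Near the poles there are `O(K)` nodes, because by Sturm comparison every interval of length
`π / (n + 1/2)` contains one of the `n` nodes (`card_legendreAngle_near_poles_le`); each of them
contributes at most `(j + 1/2) u_s = O(K / n)`, since `|d^j| ≤ 1` (`abs_wignerSmallD_le_one`). The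
latter bound is the unitarity of the rotation matrices, in the form that the substitution
`(x, y) ↦ (s x + c y, c x - s y)` of homogeneous polynomials is an involution.
-/

namespace DJT

open Polynomial

/-! ### Integration of polynomials over `[-1, 1]` -/

theorem intervalIntegrable_eval (p : ℝ[X]) (a b : ℝ) :
    IntervalIntegrable (fun x => p.eval x) MeasureTheory.volume a b :=
  p.continuous.intervalIntegrable a b

theorem integral_eval_pos {p : ℝ[X]} (hp : p ≠ 0) (h : ∀ x ∈ Set.Icc (-1 : ℝ) 1, 0 ≤ p.eval x) :
    0 < ∫ x in (-1 : ℝ)..1, p.eval x := by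
  have hex : ∃ c ∈ Set.Icc (-1 : ℝ) 1, ¬ p.IsRoot c := by
    by_contra! hall
    have hfin : (Set.Icc (-1 : ℝ) 1).Finite :=
      (p.finite_setOfPred_isRoot hp).subset fun c hc => hall c hc
    exact (Set.Icc_infinite (by norm_num)) hfin
  obtain ⟨c, hc, hc0⟩ := hex
  exact intervalIntegral.integral_pos (by norm_num) p.continuous.continuousOn
    (fun x hx => h x (Set.Ioc_subset_Icc_self hx)) ⟨c, hc, lt_of_le_of_ne (h c hc) (Ne.symm hc0)⟩

theorem integral_mul_derivative (p w : ℝ[X]) :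
    ∫ x in (-1 : ℝ)..1, (p * derivative w).eval x =
      (p * w).eval 1 - (p * w).eval (-1) - ∫ x in (-1 : ℝ)..1, (derivative p * w).eval x := by
  have := intervalIntegral.integral_mul_deriv_eq_deriv_mul (a := (-1 : ℝ)) (b := 1)
    (u := fun x => p.eval x) (v := fun x => w.eval x)
    (fun x _ => p.hasDerivAt x) (fun x _ => w.hasDerivAt x)
    (intervalIntegrable_eval _ _ _) (intervalIntegrable_eval _ _ _)
  simpa [eval_mul] using this

/-- Repeated integration by parts without boundary terms. -/
theorem integral_mul_iterate_derivative (n : ℕ) (p w : ℝ[X])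
    (h : ∀ i k, i + k < n → ∀ c : ℝ, c ^ 2 = 1 →
      (derivative^[i] p).eval c * (derivative^[k] w).eval c = 0) :
    ∫ x in (-1 : ℝ)..1, (p * derivative^[n] w).eval x =
      (-1) ^ n * ∫ x in (-1 : ℝ)..1, (derivative^[n] p * w).eval x := by
  induction n generalizing p with
  | zero => simp
  | succ n ih =>
    rw [Function.iterate_succ_apply', integral_mul_derivative, eval_mul, eval_mul,
      show p = derivative^[0] p from rfl, h 0 n (by omega) 1 (by norm_num),
      h 0 n (by omega) (-1) (by norm_num)]
    simp only [Function.iterate_zero, id]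
    rw [ih (derivative p) fun i k hik c hc => ?_]
    · rw [← Function.iterate_succ_apply]
      ring
    · rw [← Function.iterate_succ_apply]
      exact h (i + 1) k (by omega) c hc

theorem eval_iterate_derivative_eq_zero {p : ℝ[X]} {c : ℝ} {r i : ℕ} (h : (X - C c) ^ r ∣ p)
    (hi : i < r) : (derivative^[i] p).eval c = 0 := by
  have h1 := pow_sub_dvd_iterate_derivative_of_pow_dvd i h
  obtain ⟨g, hg⟩ := (dvd_pow_self (X - C c) (by omega : r - i ≠ 0)).trans h1
  simp [hg]

/-- If the orders of vanishing of `p` and `w` at each endpoint add up to at least `n`, then no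
boundary terms appear in `n` integrations by parts. -/
theorem integral_mul_iterate_derivative_of_dvd {n : ℕ} {p w : ℝ[X]} {r r' A B : ℕ}
    (hp : (X - C 1) ^ r ∣ p) (hp' : (X - C (-1)) ^ r' ∣ p) (hw : (X - C 1) ^ A ∣ w)
    (hw' : (X - C (-1)) ^ B ∣ w) (h : n ≤ r + A) (h' : n ≤ r' + B) :
    ∫ x in (-1 : ℝ)..1, (p * derivative^[n] w).eval x =
      (-1) ^ n * ∫ x in (-1 : ℝ)..1, (derivative^[n] p * w).eval x := by
  refine integral_mul_iterate_derivative n p w fun i k hik c hc => ?_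
  rcases eq_or_eq_neg_of_sq_eq_sq c 1 (by rw [hc]; norm_num) with rfl | rfl
  · rcases lt_or_ge i r with hi | hi
    · rw [eval_iterate_derivative_eq_zero hp hi, zero_mul]
    · rw [eval_iterate_derivative_eq_zero hw (by omega : k < A), mul_zero]
  · rcases lt_or_ge i r' with hi | hi
    · rw [eval_iterate_derivative_eq_zero hp' hi, zero_mul]
    · rw [eval_iterate_derivative_eq_zero hw' (by omega : k < B), mul_zero]

/-! ### Legendre polynomials -/

theorem natDegree_sq_sub_one_pow (n : ℕ) : ((X ^ 2 - 1 : ℝ[X]) ^ n).natDegree = 2 * n := by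
  rw [natDegree_pow, show (1 : ℝ[X]) = C 1 by simp, natDegree_X_pow_sub_C, mul_comm]

theorem monic_sq_sub_one_pow (n : ℕ) : ((X ^ 2 - 1 : ℝ[X]) ^ n).Monic := by
  apply Monic.pow
  rw [show (1 : ℝ[X]) = C 1 by simp]
  exact monic_X_pow_sub_C 1 (by norm_num)

theorem sq_sub_one_pow_eq (n : ℕ) :
    (X ^ 2 - 1 : ℝ[X]) ^ n = (X - C 1) ^ n * (X - C (-1)) ^ n := by
  rw [← mul_pow]; congr 1; simp; ring

theorem legendre_const_pos (n : ℕ) : (0 : ℝ) < 1 / (2 ^ n * (n.factorial : ℝ)) := by positivity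

theorem coeff_legendre (n k : ℕ) : (legendre n).coeff k =
    1 / (2 ^ n * (n.factorial : ℝ)) *
      ((k + n).descFactorial n * ((X ^ 2 - 1 : ℝ[X]) ^ n).coeff (k + n)) := by
  rw [legendre, coeff_C_mul, coeff_iterate_derivative, nsmul_eq_mul]

theorem natDegree_legendre (n : ℕ) : (legendre n).natDegree = n := by
  apply le_antisymm
  · rw [legendre, natDegree_C_mul (legendre_const_pos n).ne']
    refine (natDegree_iterate_derivative _ _).trans ?_
    rw [natDegree_sq_sub_one_pow]; omega
  · apply le_natDegree_of_ne_zero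
    rw [coeff_legendre]
    have : ((X ^ 2 - 1 : ℝ[X]) ^ n).coeff (n + n) = 1 := by
      have := (monic_sq_sub_one_pow n).coeff_natDegree
      rwa [natDegree_sq_sub_one_pow, two_mul] at this
    rw [this]
    have h2 : (n + n).descFactorial n ≠ 0 := by
      rw [Ne, Nat.descFactorial_eq_zero_iff_lt]; omega
    have := (legendre_const_pos n).ne'
    positivity

theorem legendre_ne_zero (n : ℕ) : legendre n ≠ 0 := by
  intro h
  have h0 := natDegree_legendre n
  rcases Nat.eq_zero_or_pos n with rfl | hn
  · simp [legendre] at h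
  · rw [h] at h0; simp at h0; omega

/-- `P_n` is orthogonal to the polynomials of lower degree, by Rodrigues' formula. -/
theorem integral_legendre_mul {n : ℕ} {p : ℝ[X]} (hp : p.natDegree < n) :
    ∫ x in (-1 : ℝ)..1, (legendre n * p).eval x = 0 := by
  have h1 : legendre n * p = C (1 / (2 ^ n * (n.factorial : ℝ))) *
      (p * derivative^[n] ((X ^ 2 - 1) ^ n)) := by rw [legendre]; ring
  have h2 := integral_mul_iterate_derivative_of_dvd (n := n) (p := p) (w := (X ^ 2 - 1) ^ n)
    (r := 0) (r' := 0) (A := n) (B := n) (by simp) (by simp)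
    (by rw [sq_sub_one_pow_eq]; exact dvd_mul_right _ _)
    (by rw [sq_sub_one_pow_eq]; exact dvd_mul_left _ _) (by omega) (by omega)
  rw [h1]
  simp_rw [eval_C_mul]
  rw [intervalIntegral.integral_const_mul, h2, iterate_derivative_eq_zero hp]
  simp

theorem card_roots_iterate_derivative (p : ℝ[X]) (k : ℕ) :
    p.roots.card ≤ (derivative^[k] p).roots.card + k := by
  induction k with
  | zero => simp
  | succ k ih =>
    rw [Function.iterate_succ_apply']
    have := card_roots_le_derivative (derivative^[k] p)
    omega

/-- All the roots of a Legendre polynomial are real, by Rolle's theorem. -/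
theorem card_roots_legendre (n : ℕ) : (legendre n).roots.card = n := by
  apply le_antisymm
  · exact (card_roots' _).trans (natDegree_legendre n).le
  · have h1 := card_roots_iterate_derivative ((X ^ 2 - 1 : ℝ[X]) ^ n) n
    have h2 : ((X ^ 2 - 1 : ℝ[X]) ^ n).roots.card = 2 * n := by
      rw [sq_sub_one_pow_eq, roots_mul, roots_pow, roots_pow, roots_X_sub_C, roots_X_sub_C]
      · simp; ring
      · exact mul_ne_zero (pow_ne_zero _ (X_sub_C_ne_zero _)) (pow_ne_zero _ (X_sub_C_ne_zero _))
    rw [legendre, roots_C_mul _ (legendre_const_pos n).ne']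
    omega

/-- If `P_n = f g` with `g` of lower degree, then `f` changes sign on `[-1, 1]`: otherwise
`∫ P_n g = ∫ f g²` would not vanish. -/
theorem legendre_ne_mul {n : ℕ} {f g : ℝ[X]} (hfg : legendre n = f * g) (hg : g.natDegree < n)
    (hf : ∀ x ∈ Set.Icc (-1 : ℝ) 1, 0 ≤ f.eval x) : False := by
  have h0 := integral_legendre_mul hg
  have hne : legendre n * g ≠ 0 := by
    apply mul_ne_zero (legendre_ne_zero n)
    rintro rfl
    exact legendre_ne_zero n (by simpa using hfg)
  refine (integral_eval_pos hne fun x hx => ?_).ne' h0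
  rw [hfg, eval_mul, eval_mul, mul_assoc]
  exact mul_nonneg (hf x hx) (mul_self_nonneg _)

theorem legendre_eq_mul_of_root {n : ℕ} {x : ℝ} (hx : (legendre n).eval x = 0) :
    ∃ g : ℝ[X], legendre n = (X - C x) * g ∧ g.natDegree + 1 = n := by
  obtain ⟨g, hg⟩ := dvd_iff_isRoot.mpr hx
  refine ⟨g, hg, ?_⟩
  have hg0 : g ≠ 0 := by rintro rfl; exact legendre_ne_zero n (by simpa using hg)
  have := natDegree_legendre n
  rw [hg, natDegree_mul (X_sub_C_ne_zero _) hg0, natDegree_X_sub_C] at this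
  omega

theorem root_legendre_mem {n : ℕ} {x : ℝ} (hx : (legendre n).eval x = 0) :
    x ∈ Set.Ioo (-1 : ℝ) 1 := by
  obtain ⟨g, hg, hd⟩ := legendre_eq_mul_of_root hx
  by_contra hcon
  rw [Set.mem_Ioo, not_and_or, not_lt, not_lt] at hcon
  rcases hcon with h | h
  · exact legendre_ne_mul hg (by omega) fun y hy => by simp; linarith [hy.1]
  · refine legendre_ne_mul (f := C x - X) (g := -g) (by rw [hg]; ring)
      (by rw [natDegree_neg]; omega) fun y hy => by simp; linarith [hy.2]

/-- A double root would allow a factorization of `P_n` with the nonnegative factor `(X - x)²`. -/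
theorem nodup_roots_legendre (n : ℕ) : (legendre n).roots.Nodup := by
  classical
  rw [Multiset.nodup_iff_count_le_one]
  intro x
  by_contra hcon
  rw [not_le, count_roots] at hcon
  obtain ⟨g, hg⟩ := (le_rootMultiplicity_iff (legendre_ne_zero n)).mp
    (show 2 ≤ rootMultiplicity x (legendre n) from hcon)
  have hg0 : g ≠ 0 := by rintro rfl; exact legendre_ne_zero n (by simpa using hg)
  have hd := natDegree_legendre n
  rw [hg, natDegree_mul (pow_ne_zero _ (X_sub_C_ne_zero _)) hg0, natDegree_pow,
    natDegree_X_sub_C] at hd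
  exact legendre_ne_mul hg (by omega) fun y _ => by simp; positivity

theorem length_sort_roots (n : ℕ) :
    ((legendre n).roots.sort (· ≥ ·)).length = n := by
  rw [Multiset.length_sort, card_roots_legendre]

theorem legendreNode_eq (n : ℕ) (s : Fin n) : legendreNode n s =
    ((legendre n).roots.sort (· ≥ ·))[(s : ℕ)]'(by rw [length_sort_roots]; exact s.2) := by
  rw [legendreNode, List.getD_eq_getElem]

theorem eval_legendreNode (n : ℕ) (s : Fin n) : (legendre n).eval (legendreNode n s) = 0 := by
  have h : legendreNode n s ∈ (legendre n).roots := by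
    rw [← Multiset.mem_sort (r := (· ≥ ·)), legendreNode_eq]
    exact List.getElem_mem _
  exact (mem_roots'.mp h).2

theorem legendreNode_injective (n : ℕ) : Function.Injective (legendreNode n) := by
  intro s t h
  rw [legendreNode_eq, legendreNode_eq] at h
  have hn : ((legendre n).roots.sort (· ≥ ·)).Nodup := by
    rw [← Multiset.coe_nodup, Multiset.sort_eq]; exact nodup_roots_legendre n
  exact Fin.ext ((hn.getElem_inj_iff).mp h)

theorem legendreNode_mem (n : ℕ) (s : Fin n) : legendreNode n s ∈ Set.Ioo (-1 : ℝ) 1 :=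
  root_legendre_mem (eval_legendreNode n s)

theorem exists_legendreNode_eq {n : ℕ} {x : ℝ} (hx : (legendre n).eval x = 0) :
    ∃ s, legendreNode n s = x := by
  have h : x ∈ (legendre n).roots.sort (· ≥ ·) := by
    rw [Multiset.mem_sort]; exact (mem_roots (legendre_ne_zero n)).mpr hx
  obtain ⟨i, hi, rfl⟩ := List.getElem_of_mem h
  exact ⟨⟨i, by rwa [length_sort_roots] at hi⟩, legendreNode_eq _ _⟩

/-! ### Gauss quadrature -/

theorem eq_zero_of_eval_legendreNode {n : ℕ} {p : ℝ[X]} (hp : p.natDegree < n)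
    (h : ∀ s, p.eval (legendreNode n s) = 0) : p = 0 :=
  eq_of_natDegree_lt_card_of_eval_eq p 0 (legendreNode_injective n) (by simpa using h)
    (by simpa using hp)

theorem integral_legendre_mul_legendre {k l : ℕ} (h : k ≠ l) :
    ∫ x in (-1 : ℝ)..1, (legendre k * legendre l).eval x = 0 := by
  rcases h.lt_or_gt with h | h
  · rw [mul_comm]; exact integral_legendre_mul (by rwa [natDegree_legendre])
  · exact integral_legendre_mul (by rwa [natDegree_legendre])

theorem integral_legendre_sq_ne_zero (k : ℕ) :
    ∫ x in (-1 : ℝ)..1, (legendre k * legendre k).eval x ≠ 0 :=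
  (integral_eval_pos (mul_ne_zero (legendre_ne_zero k) (legendre_ne_zero k))
    fun x _ => by rw [eval_mul]; exact mul_self_nonneg _).ne'

theorem integral_eval_sum {ι : Type*} (s : Finset ι) (f : ι → ℝ[X]) :
    ∫ x in (-1 : ℝ)..1, (∑ i ∈ s, f i).eval x = ∑ i ∈ s, ∫ x in (-1 : ℝ)..1, (f i).eval x := by
  simp_rw [eval_finsetSum]
  exact intervalIntegral.integral_finsetSum fun i _ => intervalIntegrable_eval _ _ _

/-- The linear system which defines the Gaussian weights is non-singular. -/
theorem det_legendre_ne_zero (n : ℕ) :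
    (Matrix.of fun k s : Fin n => (legendre k).eval (legendreNode n s)).det ≠ 0 := by
  intro hdet
  obtain ⟨v, hv0, hv⟩ := Matrix.exists_vecMul_eq_zero_iff.mpr hdet
  apply hv0
  rcases Nat.eq_zero_or_pos n with rfl | hn
  · exact Subsingleton.elim _ _
  -- a vanishing combination of the rows is a polynomial of degree less than `n` with `n` roots
  have hp : ∑ k : Fin n, C (v k) * legendre k = 0 := by
    apply eq_zero_of_eval_legendreNode (n := n)
    · refine lt_of_le_of_lt (natDegree_sum_le_of_forall_le (n := n - 1) _ _ fun k _ => ?_)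
        (by omega)
      refine (natDegree_C_mul_le _ _).trans ?_
      rw [natDegree_legendre]; omega
    · intro s
      have := congrFun hv s
      simpa [Matrix.vecMul, dotProduct, eval_finsetSum] using this
  funext k
  have h1 : ∫ x in (-1 : ℝ)..1, (∑ l : Fin n, C (v l) * (legendre l * legendre k)).eval x = 0 := by
    have : ∑ l : Fin n, C (v l) * (legendre l * legendre k) =
        (∑ l : Fin n, C (v l) * legendre l) * legendre k := by
      rw [Finset.sum_mul]; exact Finset.sum_congr rfl fun _ _ => by ring
    rw [this, hp]; simp
  rw [integral_eval_sum, Finset.sum_eq_single k] at h1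
  · simp_rw [eval_C_mul] at h1
    rw [intervalIntegral.integral_const_mul] at h1
    exact (mul_eq_zero.mp h1).resolve_right (integral_legendre_sq_ne_zero k)
  · intro l _ hl
    simp_rw [eval_C_mul]
    rw [intervalIntegral.integral_const_mul, integral_legendre_mul_legendre
      (fun h => hl (Fin.ext h)), mul_zero]
  · simp

theorem legendre_zero : legendre 0 = 1 := by simp [legendre]

theorem sum_gaussWeight_mul_legendre {n k : ℕ} (hk : k < n) :
    ∑ s, gaussWeight n s * (legendre k).eval (legendreNode n s) =
      ∫ x in (-1 : ℝ)..1, (legendre k).eval x := by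
  have hdet : IsUnit (Matrix.of fun k s : Fin n => (legendre k).eval (legendreNode n s)).det :=
    (det_legendre_ne_zero n).isUnit
  have h1 : (Matrix.of fun k s : Fin n => (legendre k).eval (legendreNode n s)) *ᵥ gaussWeight n =
      fun k : Fin n => if (k : ℕ) = 0 then
        ∫ x in (-1 : ℝ)..1, (legendre 0).eval x * (legendre 0).eval x else 0 := by
    rw [gaussWeight, Matrix.mulVec_mulVec, Matrix.mul_nonsing_inv _ hdet, Matrix.one_mulVec]
  have h2 := congrFun h1 ⟨k, hk⟩
  simp only [Matrix.mulVec, dotProduct, Matrix.of_apply] at h2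
  simp_rw [mul_comm (gaussWeight n _)]
  rw [h2]
  split_ifs with h
  · subst h; simp [legendre_zero]
  · have h3 := integral_legendre_mul_legendre h
    rw [legendre_zero] at h3
    simpa using h3.symm

/-- The quadrature is exact in degree less than `n`, because the Legendre polynomials span these
polynomials. -/
theorem sum_gaussWeight_of_natDegree_lt {n : ℕ} (p : ℝ[X]) (hp : p.natDegree < n) :
    ∑ s, gaussWeight n s * p.eval (legendreNode n s) = ∫ x in (-1 : ℝ)..1, p.eval x := by
  induction hm : p.natDegree using Nat.strong_induction_on generalizing p with
  | _ m ih =>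
    have hlc : (legendre m).leadingCoeff ≠ 0 := leadingCoeff_ne_zero.mpr (legendre_ne_zero m)
    -- subtract the multiple of `P_m` with the same leading term
    set c := p.leadingCoeff / (legendre m).leadingCoeff with hc
    set r := p - C c * legendre m with hr
    have hpr : p = r + C c * legendre m := by rw [hr]; ring
    have hrq : ∑ s, gaussWeight n s * r.eval (legendreNode n s) =
        ∫ x in (-1 : ℝ)..1, r.eval x := by
      rcases eq_or_ne r 0 with h0 | h0
      · simp [h0]
      have hcoef : r.coeff m = 0 := by
        rw [hr, coeff_sub, coeff_C_mul, hc]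
        have : (legendre m).coeff m = (legendre m).leadingCoeff := by
          rw [leadingCoeff, natDegree_legendre]
        rw [this, div_mul_cancel₀ _ hlc, leadingCoeff, hm, sub_self]
      have hle : r.natDegree ≤ m := by
        rw [hr]
        refine (natDegree_sub_le _ _).trans (max_le hm.le ?_)
        exact (natDegree_C_mul_le _ _).trans (natDegree_legendre m).le
      have hlt : r.natDegree < m := by
        refine lt_of_le_of_ne hle fun h => h0 ?_
        rw [← leadingCoeff_eq_zero, leadingCoeff, h, hcoef]
      exact ih _ hlt r (by omega) rfl
    have hl := sum_gaussWeight_mul_legendre (n := n) (k := m) (by omega)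
    have e1 : ∫ x in (-1 : ℝ)..1, p.eval x = (∫ x in (-1 : ℝ)..1, r.eval x) +
        c * ∫ x in (-1 : ℝ)..1, (legendre m).eval x := by
      rw [← intervalIntegral.integral_const_mul, ← intervalIntegral.integral_add
        (intervalIntegrable_eval _ _ _) ((intervalIntegrable_eval _ _ _).const_mul c)]
      simp_rw [← eval_C_mul, ← eval_add, ← hpr]
    rw [e1, ← hrq, ← hl, Finset.mul_sum, ← Finset.sum_add_distrib]
    refine Finset.sum_congr rfl fun s _ => ?_
    conv_lhs => rw [hpr, eval_add, eval_C_mul]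
    ring

/-- Gauss quadrature with `n` nodes is exact up to degree `2 n - 1`. -/
theorem sum_gaussWeight_eval {n : ℕ} (p : ℝ[X]) (hp : p.natDegree < 2 * n) :
    ∑ s, gaussWeight n s * p.eval (legendreNode n s) = ∫ x in (-1 : ℝ)..1, p.eval x := by
  have hdiv : p = p % legendre n + legendre n * (p / legendre n) :=
    (EuclideanDomain.mod_add_div p (legendre n)).symm
  have hn : n ≠ 0 := by omega
  have h1 : (p % legendre n).natDegree < n := by
    have := natDegree_mod_lt p (q := legendre n) (by rwa [natDegree_legendre])
    rwa [natDegree_legendre] at this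
  have h2 : (p / legendre n).natDegree < n := by
    rcases eq_or_ne (p / legendre n) 0 with h0 | h0
    · rw [h0, natDegree_zero]; omega
    have e : (legendre n * (p / legendre n)).natDegree = n + (p / legendre n).natDegree := by
      rw [natDegree_mul (legendre_ne_zero n) h0, natDegree_legendre]
    have e' : legendre n * (p / legendre n) = p - p % legendre n := by linear_combination -hdiv
    have := natDegree_sub_le p (p % legendre n)
    rw [← e', e] at this
    rcases le_max_iff.mp this with h | h <;> omega
  have e1 : ∫ x in (-1 : ℝ)..1, p.eval x = ∫ x in (-1 : ℝ)..1, (p % legendre n).eval x := by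
    conv_lhs => rw [hdiv]
    simp_rw [eval_add]
    rw [intervalIntegral.integral_add (intervalIntegrable_eval _ _ _)
      (intervalIntegrable_eval _ _ _), integral_legendre_mul h2, add_zero]
  rw [e1, ← sum_gaussWeight_of_natDegree_lt _ h1]
  refine Finset.sum_congr rfl fun s _ => ?_
  conv_lhs => rw [hdiv, eval_add, eval_mul, eval_legendreNode, zero_mul, add_zero]

/-- Apply the quadrature to the square of `P_n / (X - x_s)`, which vanishes at all nodes but
`x_s`. -/
theorem gaussWeight_pos (n : ℕ) (s : Fin n) : 0 < gaussWeight n s := by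
  obtain ⟨g, hg, hd⟩ := legendre_eq_mul_of_root (eval_legendreNode n s)
  have hg0 : g ≠ 0 := by rintro rfl; exact legendre_ne_zero n (by simpa using hg)
  have h1 := sum_gaussWeight_eval (n := n) (g * g) (by rw [natDegree_mul hg0 hg0]; omega)
  have hzero : ∀ t, t ≠ s → g.eval (legendreNode n t) = 0 := by
    intro t ht
    have := eval_legendreNode n t
    rw [hg, eval_mul, eval_sub, eval_X, eval_C] at this
    exact (mul_eq_zero.mp this).resolve_left
      (sub_ne_zero.mpr fun h => ht (legendreNode_injective n h))
  rw [Finset.sum_eq_single s (fun t _ ht => by rw [eval_mul, hzero t ht]; ring) (by simp),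
    eval_mul] at h1
  have hpos : 0 < ∫ x in (-1 : ℝ)..1, (g * g).eval x :=
    integral_eval_pos (mul_ne_zero hg0 hg0) fun x _ => by rw [eval_mul]; exact mul_self_nonneg _
  rw [← h1] at hpos
  exact (pos_iff_pos_of_mul_pos hpos).mpr (lt_of_le_of_ne (mul_self_nonneg _) fun h => by
    rw [← h, mul_zero] at hpos; exact lt_irrefl _ hpos)

theorem eval_one_legendre (n : ℕ) : (legendre n).eval 1 = 1 := by
  rw [legendre, eval_C_mul, sq_sub_one_pow_eq, iterate_derivative_mul, eval_finsetSum,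
    Finset.sum_eq_single 0]
  · simp only [Nat.choose_zero_right, Nat.sub_zero, Function.iterate_zero, id, one_smul]
    rw [iterate_derivative_X_sub_pow_self]
    simp
    have : (n.factorial : ℝ) ≠ 0 := by positivity
    rw [show (1 : ℝ) + 1 = 2 by norm_num]
    field_simp
  · intro k hk hk0
    rw [Finset.mem_range] at hk
    rw [iterate_derivative_X_sub_pow]
    simp [show n - (n - k) ≠ 0 by omega]
  · simp

theorem sq_eval_neg_one_legendre (n : ℕ) : (legendre n).eval (-1) ^ 2 = 1 := by
  rw [legendre, eval_C_mul, sq_sub_one_pow_eq, iterate_derivative_mul, eval_finsetSum,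
    Finset.sum_eq_single n]
  · simp only [Nat.choose_self, Nat.sub_self, Function.iterate_zero, id, one_smul]
    rw [iterate_derivative_X_sub_pow_self]
    have : (n.factorial : ℝ) ≠ 0 := by positivity
    simp only [eval_mul, eval_pow, eval_sub, eval_X, eval_C, eval_natCast]
    rw [show (-1 : ℝ) - 1 = (-1) * 2 by norm_num, mul_pow (-1 : ℝ) 2 n]
    have h2 : ((-1 : ℝ) ^ n) ^ 2 = 1 := by rw [← pow_mul, mul_comm, pow_mul]; norm_num
    field_simp
    linear_combination h2
  · intro k hk hk0
    rw [Finset.mem_range] at hk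
    rw [iterate_derivative_X_sub_pow, iterate_derivative_X_sub_pow]
    simp [show n - k ≠ 0 by omega]
  · simp

/-- The Gaussian weights in terms of the derivative of the Legendre polynomial: apply the
quadrature to `P_n' · P_n / (X - x_s)` and integrate by parts. -/
theorem gaussWeight_mul (n : ℕ) (s : Fin n) :
    gaussWeight n s * ((1 - legendreNode n s ^ 2) *
      (derivative (legendre n)).eval (legendreNode n s) ^ 2) = 2 := by
  obtain ⟨g, hg, hd⟩ := legendre_eq_mul_of_root (eval_legendreNode n s)
  have hg0 : g ≠ 0 := by rintro rfl; exact legendre_ne_zero n (by simpa using hg)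
  set x := legendreNode n s with hx
  have hgx : (derivative (legendre n)).eval x = g.eval x := by
    conv_lhs => rw [hg]
    simp
  have h1 := sum_gaussWeight_eval (n := n) (g * derivative (legendre n)) (by
    refine lt_of_le_of_lt natDegree_mul_le ?_
    have := natDegree_derivative_le (legendre n)
    rw [natDegree_legendre] at this
    omega)
  have hzero : ∀ t, t ≠ s → g.eval (legendreNode n t) = 0 := by
    intro t ht
    have := eval_legendreNode n t
    rw [hg, eval_mul, eval_sub, eval_X, eval_C] at this
    exact (mul_eq_zero.mp this).resolve_left
      (sub_ne_zero.mpr fun h => ht (legendreNode_injective n h))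
  rw [Finset.sum_eq_single s (fun t _ ht => by rw [eval_mul, hzero t ht]; ring) (by simp),
    eval_mul, ← hx, ← hgx, integral_mul_derivative] at h1
  have h3 : ∫ x in (-1 : ℝ)..1, (derivative g * legendre n).eval x = 0 := by
    rw [mul_comm]
    exact integral_legendre_mul (lt_of_le_of_lt (natDegree_derivative_le g) (by omega))
  rw [h3, sub_zero, eval_mul, eval_mul] at h1
  have hm := legendreNode_mem n s
  rw [← hx] at hm
  have k1 := eval_one_legendre n
  have k2 := sq_eval_neg_one_legendre n
  have k1' := k1
  have k2' : (legendre n).eval (-1) = (-1 - x) * g.eval (-1) := by rw [hg]; simp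
  rw [hg] at k1'
  simp only [eval_mul, eval_sub, eval_X, eval_C] at k1'
  have hp : (0 : ℝ) < 1 - x := by linarith [hm.2]
  have hq : (0 : ℝ) < 1 + x := by linarith [hm.1]
  have e1 : g.eval 1 * (legendre n).eval 1 * (1 - x) = 1 := by rw [k1]; linarith
  have e2 : g.eval (-1) * (legendre n).eval (-1) * (-1 - x) = 1 := by
    linear_combination k2 - (legendre n).eval (-1) * k2'
  have e3 : gaussWeight n s * ((1 - x ^ 2) * (derivative (legendre n)).eval x ^ 2) =
    (gaussWeight n s * ((derivative (legendre n)).eval x * (derivative (legendre n)).eval x))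
      * ((1 - x) * (1 + x)) := by ring
  rw [e3, h1]
  linear_combination (1 + x) * e1 + (1 - x) * e2

/-! ### Jacobi polynomials and Rodrigues' formula -/

/-- The weight `(1 - X)^A (1 + X)^B`, whose `n`-th derivative is, up to a constant, the product of
the Jacobi weight `(1 - X)^(A - n) (1 + X)^(B - n)` and the Jacobi polynomial
`P_n^(A - n, B - n)`. -/
noncomputable def jacobiWeight (A B : ℕ) : ℝ[X] := (1 - X) ^ A * (1 + X) ^ B

/-- The Jacobi polynomial `P_n^(A - n, B - n)`, in which the parameters are integers which are at
least `-n`. -/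
noncomputable def jacobiPoly (n A B : ℕ) : ℝ[X] :=
  ∑ s ∈ Finset.range (n + 1), C ((A.choose (n - s) * B.choose s : ℝ) / 2 ^ n) *
    ((X - C 1) ^ s * (X - C (-1)) ^ (n - s))

theorem eval_jacobiPoly (n A B : ℕ) (x : ℝ) :
    (jacobiPoly n A B).eval x = jacobi n ((A : ℝ) - n) ((B : ℝ) - n) x := by
  rw [jacobiPoly, jacobi, eval_finsetSum]
  refine Finset.sum_congr rfl fun s hs => ?_
  rw [Finset.mem_range] at hs
  rw [show (n : ℝ) + (A - n) = A by ring, show (n : ℝ) + (B - n) = B by ring,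
    Ring.choose_natCast, Ring.choose_natCast]
  simp only [eval_mul, eval_C, eval_pow, eval_sub, eval_X]
  rw [show (2 : ℝ) ^ n = 2 ^ s * 2 ^ (n - s) by rw [← pow_add]; congr 1; omega, div_pow, div_pow,
    sub_neg_eq_add]
  field_simp

theorem one_add_X_pow_mul_iterate_derivative (B k : ℕ) :
    (1 + X : ℝ[X]) ^ k * derivative^[k] ((1 + X) ^ B) =
      (B.descFactorial k : ℝ[X]) * (1 + X) ^ B := by
  have h : (1 + X : ℝ[X]) = X + C 1 := by simp [add_comm]
  rw [h, iterate_derivative_X_add_pow, nsmul_eq_mul]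
  rcases le_or_gt k B with hk | hk
  · rw [mul_left_comm, ← pow_add, Nat.add_sub_cancel' hk]
  · rw [Nat.descFactorial_of_lt hk]; simp

theorem iterate_derivative_one_sub_X_pow (A k : ℕ) :
    derivative^[k] ((1 - X : ℝ[X]) ^ A) =
      (-1) ^ k * (A.descFactorial k : ℝ[X]) * (1 - X) ^ (A - k) := by
  have h : (1 - X : ℝ[X]) ^ A = (X ^ A : ℝ[X]).comp (1 - X) := by simp
  rw [h, iterate_derivative_comp_one_sub_X, iterate_derivative_X_pow_eq_natCast_mul]
  simp [mul_assoc]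

theorem one_sub_X_pow_mul_iterate_derivative (A k : ℕ) :
    (1 - X : ℝ[X]) ^ k * derivative^[k] ((1 - X) ^ A) =
      (-1) ^ k * (A.descFactorial k : ℝ[X]) * (1 - X) ^ A := by
  rw [iterate_derivative_one_sub_X_pow]
  rcases le_or_gt k A with hk | hk
  · rw [mul_left_comm, ← pow_add, Nat.add_sub_cancel' hk]
  · rw [Nat.descFactorial_of_lt hk]; simp

/-- Rodrigues' formula, multiplied by `(1 - X²)^n` so that it also holds for negative
parameters. -/
theorem rodrigues (n A B : ℕ) :
    (1 - X) ^ n * (1 + X) ^ n * derivative^[n] (jacobiWeight A B) =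
      C ((-2) ^ n * (n.factorial : ℝ)) * (jacobiWeight A B * jacobiPoly n A B) := by
  rw [jacobiWeight, iterate_derivative_mul, jacobiPoly, Finset.mul_sum, Finset.mul_sum,
    Finset.mul_sum]
  refine Finset.sum_congr rfl fun k hk => ?_
  rw [Finset.mem_range, Nat.lt_succ_iff] at hk
  have e1 := one_sub_X_pow_mul_iterate_derivative A (n - k)
  have e2 := one_add_X_pow_mul_iterate_derivative B k
  have h1 : (1 - X : ℝ[X]) ^ n = (1 - X) ^ k * (1 - X) ^ (n - k) := by
    rw [← pow_add, Nat.add_sub_cancel' hk]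
  have h2 : (1 + X : ℝ[X]) ^ n = (1 + X) ^ k * (1 + X) ^ (n - k) := by
    rw [← pow_add, Nat.add_sub_cancel' hk]
  have hs : ((X : ℝ[X]) - C 1) ^ k = (-1) ^ k * (1 - X) ^ k := by
    rw [← mul_pow]; congr 1; simp
  have hs' : ((X : ℝ[X]) - C (-1)) = 1 + X := by simp [add_comm]
  have hc : C ((-2) ^ n * (n.factorial : ℝ)) *
      C ((A.choose (n - k) * B.choose k : ℝ) / 2 ^ n) * (-1) ^ k =
      (-1 : ℝ[X]) ^ (n - k) * ((n.choose k * A.descFactorial (n - k) * B.descFactorial k : ℕ) :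
        ℝ[X]) := by
    have hnat : n.factorial * (A.choose (n - k) * B.choose k) =
        n.choose k * A.descFactorial (n - k) * B.descFactorial k := by
      rw [Nat.descFactorial_eq_factorial_mul_choose, Nat.descFactorial_eq_factorial_mul_choose,
        ← Nat.choose_mul_factorial_mul_factorial hk]
      ring
    rw [← hnat, ← C_mul, show (-1 : ℝ[X]) = C (-1) by simp, ← C_pow, ← C_pow,
      ← C_eq_natCast, ← C_mul, ← C_mul]
    congr 1
    push_cast
    rw [show (-2 : ℝ) ^ n = (-1) ^ k * (-1) ^ (n - k) * 2 ^ n by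
      rw [← pow_add, Nat.add_sub_cancel' hk, ← mul_pow]; norm_num]
    have : ((-1 : ℝ) ^ k) * (-1) ^ k = 1 := by rw [← mul_pow]; norm_num
    field_simp
    linear_combination ((A.choose (n - k) : ℝ) * B.choose k) * this
  push_cast at hc
  rw [hs, hs', h1, h2, nsmul_eq_mul]
  linear_combination ((n.choose k : ℝ[X]) * (1 - X) ^ k * (1 + X) ^ (n - k) * (1 + X) ^ k *
      derivative^[k] ((1 + X) ^ B)) * e1 +
    ((n.choose k : ℝ[X]) * (1 - X) ^ k * (1 + X) ^ (n - k) * (-1) ^ (n - k) *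
      (A.descFactorial (n - k) : ℝ[X]) * (1 - X) ^ A) * e2 -
    ((1 - X) ^ k * (1 + X) ^ (n - k) * (1 - X) ^ A * (1 + X) ^ B) * hc

theorem natDegree_jacobiPoly_le (n A B : ℕ) : (jacobiPoly n A B).natDegree ≤ n := by
  refine natDegree_sum_le_of_forall_le _ _ fun s hs => ?_
  rw [Finset.mem_range] at hs
  refine (natDegree_C_mul_le _ _).trans (natDegree_mul_le.trans ?_)
  rw [natDegree_pow, natDegree_pow, natDegree_X_sub_C, natDegree_X_sub_C]
  omega

/-- The leading coefficient of the Jacobi polynomial, by Vandermonde's identity. -/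
theorem coeff_jacobiPoly (n A B : ℕ) :
    (jacobiPoly n A B).coeff n = ((A + B).choose n : ℝ) / 2 ^ n := by
  rw [jacobiPoly, finsetSum_coeff, Nat.add_comm A B, Nat.add_choose_eq,
    Finset.Nat.sum_antidiagonal_eq_sum_range_succ (f := fun i j => B.choose i * A.choose j)]
  push_cast
  rw [Finset.sum_div]
  refine Finset.sum_congr rfl fun s hs => ?_
  rw [Finset.mem_range] at hs
  have hm : ((X - C (1 : ℝ)) ^ s * (X - C (-1)) ^ (n - s)).Monic :=
    ((monic_X_sub_C 1).pow s).mul ((monic_X_sub_C (-1)).pow (n - s))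
  have hd : ((X - C (1 : ℝ)) ^ s * (X - C (-1)) ^ (n - s)).natDegree = n := by
    rw [Monic.natDegree_mul ((monic_X_sub_C 1).pow s) ((monic_X_sub_C (-1)).pow (n - s)),
      natDegree_pow, natDegree_pow, natDegree_X_sub_C, natDegree_X_sub_C]
    omega
  have h1 := hm.coeff_natDegree
  rw [hd] at h1
  rw [coeff_C_mul, h1]
  ring

theorem iterate_derivative_jacobiPoly (n A B : ℕ) :
    derivative^[n] (jacobiPoly n A B) =
      C ((n.factorial : ℝ) * ((A + B).choose n : ℝ) / 2 ^ n) := by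
  ext k
  rw [coeff_iterate_derivative, coeff_C]
  split_ifs with hk
  · subst hk
    rw [zero_add, coeff_jacobiPoly, Nat.descFactorial_self, nsmul_eq_mul]
    ring
  · rw [coeff_eq_zero_of_natDegree_lt, smul_zero]
    have := natDegree_jacobiPoly_le n A B
    omega

theorem X_sub_one_pow_dvd_jacobiPoly (n A B : ℕ) : (X - C 1) ^ (n - A) ∣ jacobiPoly n A B := by
  refine Finset.dvd_sum fun s _ => ?_
  rcases lt_or_ge A (n - s) with h | h
  · simp [Nat.choose_eq_zero_of_lt h]
  · exact ((pow_dvd_pow _ (by omega)).mul_right _).mul_left _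

theorem X_add_one_pow_dvd_jacobiPoly (n A B : ℕ) : (X - C (-1)) ^ (n - B) ∣ jacobiPoly n A B := by
  refine Finset.dvd_sum fun s _ => ?_
  rcases lt_or_ge B s with h | h
  · simp [Nat.choose_eq_zero_of_lt h]
  · exact ((pow_dvd_pow _ (by omega)).mul_left _).mul_left _

theorem X_sub_one_pow_dvd_jacobiWeight (A B : ℕ) : (X - C 1) ^ A ∣ jacobiWeight A B := by
  refine Dvd.dvd.mul_right ?_ _
  rw [show (1 - X : ℝ[X]) = -(X - C 1) by simp]
  exact pow_dvd_pow_of_dvd (dvd_neg.mpr dvd_rfl) A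

theorem X_add_one_pow_dvd_jacobiWeight (A B : ℕ) : (X - C (-1)) ^ B ∣ jacobiWeight A B := by
  refine Dvd.dvd.mul_left ?_ _
  rw [show (1 + X : ℝ[X]) = X - C (-1) by simp [add_comm]]

theorem natDegree_iterate_derivative_jacobiWeight_le (n A B : ℕ) :
    (derivative^[n] (jacobiWeight A B)).natDegree ≤ A + B - n := by
  refine (natDegree_iterate_derivative _ _).trans (Nat.sub_le_sub_right ?_ n)
  refine natDegree_mul_le.trans (add_le_add (natDegree_pow_le.trans ?_) (natDegree_pow_le.trans ?_))
  · have : (1 - X : ℝ[X]).natDegree ≤ 1 := by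
      refine (natDegree_sub_le _ _).trans ?_; simp
    nlinarith
  · have : (1 + X : ℝ[X]).natDegree ≤ 1 := by
      refine (natDegree_add_le _ _).trans ?_; simp
    nlinarith

/-- The Beta integral over `[-1, 1]`. -/
theorem integral_jacobiWeight (A B : ℕ) :
    ∫ x in (-1 : ℝ)..1, (jacobiWeight A B).eval x =
      2 ^ (A + B + 1) * (A.factorial * B.factorial) / (A + B + 1).factorial := by
  have h := integral_mul_iterate_derivative_of_dvd (n := A) (p := (1 - X) ^ A)
    (w := (1 + X) ^ (A + B)) (r := A) (r' := 0) (A := 0) (B := A + B)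
    (by simpa [jacobiWeight] using X_sub_one_pow_dvd_jacobiWeight A 0) (by simp) (by simp)
    (by simpa [jacobiWeight] using X_add_one_pow_dvd_jacobiWeight 0 (A + B)) (by omega) (by omega)
  rw [iterate_derivative_one_sub_X_pow, Nat.descFactorial_self, Nat.sub_self, pow_zero, mul_one,
    show (1 + X : ℝ[X]) = X + C 1 by simp [add_comm], iterate_derivative_X_add_pow,
    Nat.add_sub_cancel_left] at h
  have e1 : ∀ x : ℝ, ((1 - X : ℝ[X]) ^ A * ((A + B).descFactorial A • (X + C 1) ^ B)).eval x =
      ((A + B).descFactorial A : ℝ) * (jacobiWeight A B).eval x := by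
    intro x; simp [jacobiWeight, add_comm]; ring
  have e2 : ∀ x : ℝ, ((-1) ^ A * (A.factorial : ℝ[X]) * (X + C 1) ^ (A + B)).eval x =
      ((-1) ^ A * (A.factorial : ℝ)) * (x + 1) ^ (A + B) := by
    intro x; simp
  simp_rw [e1, e2] at h
  rw [intervalIntegral.integral_const_mul, intervalIntegral.integral_const_mul,
    intervalIntegral.integral_comp_add_right (fun y => y ^ (A + B)) 1, integral_pow] at h
  have hd : ((A + B).descFactorial A : ℝ) * (B.factorial : ℝ) = (A + B).factorial := by
    have := Nat.factorial_mul_descFactorial (show A ≤ A + B by omega)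
    rw [Nat.add_sub_cancel_left] at this
    rw [mul_comm]; exact_mod_cast this
  have hs : ((-1 : ℝ) ^ A) * (-1) ^ A = 1 := by rw [← mul_pow]; norm_num
  have hf : ((A + B + 1).factorial : ℝ) = (A + B + 1) * (A + B).factorial := by
    rw [Nat.factorial_succ]; push_cast; ring
  have hB : (B.factorial : ℝ) ≠ 0 := by positivity
  have hAB : ((A + B).factorial : ℝ) ≠ 0 := by positivity
  have hAB1 : (A + B + 1 : ℝ) ≠ 0 := by positivity
  rw [hf, eq_div_iff (mul_ne_zero hAB1 hAB), ← hd]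
  norm_num at h
  rw [← mul_assoc, ← mul_assoc, hs, one_mul] at h
  field_simp at h
  linear_combination (B.factorial : ℝ) * h

/-! ### Orthogonality of the Wigner functions under Gauss quadrature -/

/-- The normalization constant of `d^j_{mL mR}`, with `J = 2j`, `a = j + mL`, `b = j + mR`. -/
noncomputable def wignerConst (J a b : ℕ) : ℝ :=
  √((b.factorial * (J - b).factorial : ℝ) / (a.factorial * (J - a).factorial : ℝ))

theorem wignerConst_sq (J a b : ℕ) : wignerConst J a b ^ 2 =
    (b.factorial * (J - b).factorial : ℝ) / (a.factorial * (J - a).factorial : ℝ) :=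
  Real.sq_sqrt (by positivity)

theorem wignerSmallD_eq {J a b : ℕ} (ha : a ≤ J) (hb : b ≤ J) (θ : ℝ) :
    wignerSmallD J a b θ = wignerConst J a b *
      ((1 - Real.cos θ) / 2) ^ (((b : ℝ) - a) / 2) *
      ((1 + Real.cos θ) / 2) ^ (((a : ℝ) + b - J) / 2) *
      (jacobiPoly (J - b) (J - a) a).eval (Real.cos θ) := by
  rw [wignerSmallD, eval_jacobiPoly, wignerConst]
  push_cast [Nat.cast_sub ha, Nat.cast_sub hb]
  congr 2 <;> ring

theorem eval_rodrigues (n A B : ℕ) (x : ℝ) :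
    4 ^ n * ((1 - x) / 2) ^ n * ((1 + x) / 2) ^ n *
        (derivative^[n] (jacobiWeight A B)).eval x =
      (-2) ^ n * n.factorial * 2 ^ (A + B) * ((1 - x) / 2) ^ A * ((1 + x) / 2) ^ B *
        (jacobiPoly n A B).eval x := by
  have h := congrArg (eval x) (rodrigues n A B)
  simp only [eval_mul, eval_pow, eval_sub, eval_add, eval_one, eval_X, eval_C] at h
  have e : (jacobiWeight A B).eval x = 2 ^ (A + B) * ((1 - x) / 2) ^ A * ((1 + x) / 2) ^ B := by
    simp only [jacobiWeight, eval_mul, eval_pow, eval_sub, eval_add, eval_one, eval_X]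
    rw [div_pow, div_pow, pow_add]
    field_simp
  rw [e] at h
  rw [show (4 : ℝ) ^ n = 2 ^ n * 2 ^ n by rw [← mul_pow]; norm_num, div_pow, div_pow]
  field_simp
  field_simp at h
  linear_combination h

theorem half_one_sub_cos_pos {θ : ℝ} (h : Real.cos θ ∈ Set.Ioo (-1 : ℝ) 1) :
    0 < (1 - Real.cos θ) / 2 ∧ 0 < (1 + Real.cos θ) / 2 := by
  constructor <;> linarith [h.1, h.2]

/-- The product of two Wigner functions with the same magnetic numbers is a polynomial in
`cos θ`. -/
theorem wignerSmallD_mul {J J' a a' b b' : ℕ} (ha : a ≤ J) (hb : b ≤ J) (ha' : a' ≤ J')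
    (hb' : b' ≤ J') (hL : 2 * a + J' = 2 * a' + J) (hR : 2 * b + J' = 2 * b' + J) {θ : ℝ}
    (hθ : Real.cos θ ∈ Set.Ioo (-1 : ℝ) 1) :
    wignerSmallD J a b θ * wignerSmallD J' a' b' θ =
      wignerConst J a b * wignerConst J' a' b' *
        (4 ^ (J' - b') / ((-2) ^ (J' - b') * (J' - b').factorial * 2 ^ J')) *
        (jacobiPoly (J - b) (J - a) a *
          derivative^[J' - b'] (jacobiWeight (J' - a') a')).eval (Real.cos θ) := by
  obtain ⟨hv, hw⟩ := half_one_sub_cos_pos hθ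
  rw [wignerSmallD_eq ha hb, wignerSmallD_eq ha' hb', eval_mul]
  have hro := eval_rodrigues (J' - b') (J' - a') a' (Real.cos θ)
  rw [Nat.sub_add_cancel ha'] at hro
  set v := (1 - Real.cos θ) / 2
  set w := (1 + Real.cos θ) / 2
  have hL' : 2 * (a : ℝ) + J' = 2 * a' + J := by exact_mod_cast hL
  have hR' : 2 * (b : ℝ) + J' = 2 * b' + J := by exact_mod_cast hR
  have ev : v ^ (((b : ℝ) - a) / 2) * v ^ (((b' : ℝ) - a') / 2) =
      v ^ (J' - a') / v ^ (J' - b') := by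
    rw [← Real.rpow_add hv, ← Real.rpow_natCast, ← Real.rpow_natCast, ← Real.rpow_sub hv]
    congr 1
    push_cast [Nat.cast_sub ha', Nat.cast_sub hb']
    linarith
  have ew : w ^ (((a : ℝ) + b - J) / 2) * w ^ (((a' : ℝ) + b' - J') / 2) =
      w ^ a' / w ^ (J' - b') := by
    rw [← Real.rpow_add hw, ← Real.rpow_natCast, ← Real.rpow_natCast, ← Real.rpow_sub hw]
    congr 1
    push_cast [Nat.cast_sub ha', Nat.cast_sub hb']
    linarith
  set P := (jacobiPoly (J - b) (J - a) a).eval (Real.cos θ)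
  set P' := (jacobiPoly (J' - b') (J' - a') a').eval (Real.cos θ)
  set W := (derivative^[J' - b'] (jacobiWeight (J' - a') a')).eval (Real.cos θ)
  have hne : ((-2 : ℝ) ^ (J' - b') * (J' - b').factorial * 2 ^ J') ≠ 0 := by
    have : ((-2 : ℝ)) ^ (J' - b') ≠ 0 := pow_ne_zero _ (by norm_num)
    positivity
  have key : v ^ (J' - a') / v ^ (J' - b') * (w ^ a' / w ^ (J' - b')) * P' =
      4 ^ (J' - b') / ((-2) ^ (J' - b') * (J' - b').factorial * 2 ^ J') * W := by
    rw [div_mul_div_comm, div_mul_eq_mul_div, div_mul_eq_mul_div,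
      div_eq_div_iff (by positivity) hne]
    linear_combination -hro
  rw [← ev, ← ew] at key
  linear_combination (wignerConst J a b * wignerConst J' a' b' * P) * key

/-- The Jacobi polynomial vanishes at the endpoints to the order by which the parameters are
negative, so that the integrations by parts produce no boundary terms. They differentiate the Jacobi
polynomial `j' - mR` times, which is at least its degree. -/
theorem integral_jacobiPoly_mul {J J' a a' b b' : ℕ} (ha : a ≤ J) (hb : b ≤ J) (ha' : a' ≤ J')
    (hb' : b' ≤ J') (hL : 2 * a + J' = 2 * a' + J) (hR : 2 * b + J' = 2 * b' + J)
    (hJ : J ≤ J') :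
    ∫ x in (-1 : ℝ)..1, (jacobiPoly (J - b) (J - a) a *
          derivative^[J' - b'] (jacobiWeight (J' - a') a')).eval x =
      if J = J' then (-1) ^ (J - b) * ((J - b).factorial * (J.choose (J - b) : ℝ) / 2 ^ (J - b)) *
        (2 ^ (J + 1) * ((J - a).factorial * a.factorial) / (J + 1).factorial) else 0 := by
  rw [integral_mul_iterate_derivative_of_dvd (X_sub_one_pow_dvd_jacobiPoly _ _ _)
    (X_add_one_pow_dvd_jacobiPoly _ _ _) (X_sub_one_pow_dvd_jacobiWeight _ _)
    (X_add_one_pow_dvd_jacobiWeight _ _) (by omega) (by omega)]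
  split_ifs with h
  · subst h
    obtain rfl : a = a' := by omega
    obtain rfl : b = b' := by omega
    rw [iterate_derivative_jacobiPoly, Nat.sub_add_cancel ha]
    simp_rw [eval_C_mul]
    rw [intervalIntegral.integral_const_mul, integral_jacobiWeight, Nat.sub_add_cancel ha]
    ring
  · rw [iterate_derivative_eq_zero]
    · simp
    · have := natDegree_jacobiPoly_le (J - b) (J - a) a
      omega

theorem cos_legendreAngle (n : ℕ) (s : Fin n) :
    Real.cos (legendreAngle n s) = legendreNode n s :=
  Real.cos_arccos (legendreNode_mem n s).1.le (legendreNode_mem n s).2.le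

theorem sum_gaussWeight_wignerSmallD_of_le {N J J' a a' b b' : ℕ} (ha : a ≤ J) (hb : b ≤ J)
    (ha' : a' ≤ J') (hb' : b' ≤ J') (hL : 2 * a + J' = 2 * a' + J)
    (hR : 2 * b + J' = 2 * b' + J) (hN : J + J' < 4 * N) (hJ : J ≤ J') :
    ∑ s, gaussWeight N s *
        (wignerSmallD J a b (legendreAngle N s) * wignerSmallD J' a' b' (legendreAngle N s)) =
      if J = J' then 2 / (J + 1 : ℝ) else 0 := by
  have hq := sum_gaussWeight_eval (n := N) (jacobiPoly (J - b) (J - a) a *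
          derivative^[J' - b'] (jacobiWeight (J' - a') a')) (by
    refine lt_of_le_of_lt (natDegree_mul_le.trans (add_le_add (natDegree_jacobiPoly_le _ _ _)
      (natDegree_iterate_derivative_jacobiWeight_le _ _ _))) ?_
    omega)
  rw [integral_jacobiPoly_mul ha hb ha' hb' hL hR hJ] at hq
  have e : ∀ s : Fin N, gaussWeight N s *
      (wignerSmallD J a b (legendreAngle N s) * wignerSmallD J' a' b' (legendreAngle N s)) =
      wignerConst J a b * wignerConst J' a' b' *
        (4 ^ (J' - b') / ((-2) ^ (J' - b') * (J' - b').factorial * 2 ^ J')) *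
        (gaussWeight N s * (jacobiPoly (J - b) (J - a) a *
          derivative^[J' - b'] (jacobiWeight (J' - a') a')).eval (legendreNode N s)) := by
    intro s
    rw [wignerSmallD_mul ha hb ha' hb' hL hR
      (by rw [cos_legendreAngle]; exact legendreNode_mem N s), cos_legendreAngle]
    ring
  rw [Finset.sum_congr rfl fun s _ => e s, ← Finset.mul_sum, hq]
  split_ifs with h
  · subst h
    obtain rfl : a = a' := by omega
    obtain rfl : b = b' := by omega
    have h1 := wignerConst_sq J a b
    have h2 : (J.choose (J - b) : ℝ) * ((J - b).factorial * b.factorial) = J.factorial := by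
      have := Nat.choose_mul_factorial_mul_factorial (Nat.sub_le J b)
      rw [Nat.sub_sub_self hb] at this
      rw [← mul_assoc]
      exact_mod_cast this
    have h3 : ((J + 1).factorial : ℝ) = (J + 1) * J.factorial := by
      rw [Nat.factorial_succ]; push_cast; ring
    have h4 : (-2 : ℝ) ^ (J - b) = (-1) ^ (J - b) * 2 ^ (J - b) := by rw [← mul_pow]; norm_num
    have h5 : (4 : ℝ) ^ (J - b) = 2 ^ (J - b) * 2 ^ (J - b) := by rw [← mul_pow]; norm_num
    have h6 : (-1 : ℝ) ^ (J - b) ≠ 0 := pow_ne_zero _ (by norm_num)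
    rw [← sq, h1, h3, ← h2, h4, h5, pow_succ]
    have h7 : (J.choose (J - b) : ℝ) ≠ 0 := by
      have := Nat.choose_pos (Nat.sub_le J b)
      positivity
    field_simp
  · simp

/-- With `N` nodes, the Wigner functions with the same magnetic numbers and `j + j' < 2 N` are
orthogonal with respect to the Gauss measure, with squared norm `1 / (j + 1/2)`. -/
theorem sum_gaussWeight_wignerSmallD {N J J' a a' b b' : ℕ} (ha : a ≤ J) (hb : b ≤ J)
    (ha' : a' ≤ J') (hb' : b' ≤ J') (hL : 2 * a + J' = 2 * a' + J)
    (hR : 2 * b + J' = 2 * b' + J) (hN : J + J' < 4 * N) :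
    ∑ s, gaussWeight N s *
        (wignerSmallD J a b (legendreAngle N s) * wignerSmallD J' a' b' (legendreAngle N s)) =
      if J = J' then 2 / (J + 1 : ℝ) else 0 := by
  rcases le_total J J' with hJ | hJ
  · exact sum_gaussWeight_wignerSmallD_of_le ha hb ha' hb' hL hR hN hJ
  · simp_rw [mul_comm (wignerSmallD J a b _)]
    rw [sum_gaussWeight_wignerSmallD_of_le ha' hb' ha hb hL.symm hR.symm (by omega) hJ]
    by_cases h : J = J'
    · subst h; rfl
    · rw [if_neg h, if_neg (Ne.symm h)]

/-! ### The columns of `V` are orthonormal -/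

variable {Q : ℕ}

theorem Label.a_le (l : Label Q) : l.a ≤ l.twoJ := Nat.lt_succ_iff.mp l.2.1.2

theorem Label.b_le (l : Label Q) : l.b ≤ l.twoJ := Nat.lt_succ_iff.mp l.2.2.2

theorem Label.twoJ_le (l : Label Q) : l.twoJ ≤ Q := Nat.lt_succ_iff.mp l.1.2

theorem Label.ext_iff' {l l' : Label Q} :
    l = l' ↔ l.twoJ = l'.twoJ ∧ l.a = l'.a ∧ l.b = l'.b := by
  constructor
  · rintro rfl; exact ⟨rfl, rfl, rfl⟩
  · obtain ⟨⟨J, hJ⟩, ⟨a, ha⟩, ⟨b, hb⟩⟩ := l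
    obtain ⟨⟨J', hJ'⟩, ⟨a', ha'⟩, ⟨b', hb'⟩⟩ := l'
    simp only [Label.twoJ, Label.a, Label.b]
    rintro ⟨rfl, rfl, rfl⟩
    rfl

theorem nPhi_pos (Q : ℕ) : 0 < nPhi Q := Nat.succ_pos _

theorem sum_pow_succ_eq_zero {N : ℕ} {ζ : ℂ} (h1 : ζ ≠ 1) (hN : ζ ^ N = 1) :
    ∑ b : Fin N, ζ ^ ((b : ℕ) + 1) = 0 := by
  rw [Fin.sum_univ_eq_sum_range (fun b => ζ ^ (b + 1)) N]
  simp_rw [pow_succ]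
  rw [← Finset.sum_mul, geom_sum_eq h1, hN]
  simp

/-- Orthogonality of the exponentials on the equidistant grid: differences `p / 2` of magnetic
quantum numbers satisfy `|p| ≤ 2 Q < N_φ`. -/
theorem sum_exp_grid (Q : ℕ) (p : ℤ) (hp : |p| ≤ 2 * Q) :
    ∑ b : Fin (nPhi Q), Complex.exp (Complex.I * ((p / 2 : ℝ) : ℂ) *
      ((4 * Real.pi / nPhi Q * ((b : ℕ) + 1) : ℝ) : ℂ)) = if p = 0 then (nPhi Q : ℂ) else 0 := by
  split_ifs with h0
  · subst h0; simp
  have hN : (nPhi Q : ℂ) ≠ 0 := Nat.cast_ne_zero.mpr (nPhi_pos Q).ne'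
  have e : ∀ b : Fin (nPhi Q), Complex.exp (Complex.I * ((p / 2 : ℝ) : ℂ) *
      ((4 * Real.pi / nPhi Q * ((b : ℕ) + 1) : ℝ) : ℂ)) =
      Complex.exp (2 * Real.pi * Complex.I * (p / nPhi Q)) ^ ((b : ℕ) + 1) := by
    intro b
    rw [← Complex.exp_nat_mul]
    congr 1
    push_cast
    field_simp
    ring
  rw [Finset.sum_congr rfl fun b _ => e b]
  apply sum_pow_succ_eq_zero
  · intro h
    rw [Complex.exp_eq_one_iff] at h
    obtain ⟨n, hn⟩ := h
    have hpi : (2 * Real.pi * Complex.I : ℂ) ≠ 0 := Complex.two_pi_I_ne_zero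
    have h2 : (p : ℂ) / nPhi Q = n := by
      apply mul_left_cancel₀ hpi
      rw [hn]; ring
    rw [div_eq_iff hN] at h2
    have h3 : p = n * nPhi Q := by exact_mod_cast h2
    have hn0 : n ≠ 0 := by rintro rfl; simp at h3; exact h0 h3
    have : 1 ≤ |n| := Int.one_le_abs hn0
    rw [h3, abs_mul, nPhi, Nat.abs_cast] at hp
    push_cast at hp
    nlinarith
  · rw [← Complex.exp_nat_mul, Complex.exp_eq_one_iff]
    exact ⟨p, by field_simp⟩

theorem star_wignerD_mul (l l' : Label Q) (θ φ ψ : ℝ) :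
    star (wignerD l θ φ ψ) * wignerD l' θ φ ψ =
      Complex.exp (Complex.I * ((l'.mL - l.mL : ℝ) : ℂ) * φ) *
        ((wignerSmallD l.twoJ l.a l.b θ * wignerSmallD l'.twoJ l'.a l'.b θ : ℝ) : ℂ) *
        Complex.exp (Complex.I * ((l'.mR - l.mR : ℝ) : ℂ) * ψ) := by
  have h1 : ∀ m t : ℝ, (starRingEnd ℂ) (Complex.exp (Complex.I * m * t)) =
      Complex.exp (-(Complex.I * m * t)) := by
    intro m t
    rw [← Complex.exp_conj]
    congr 1
    simp
  have h2 : ∀ m m' t : ℝ, Complex.exp (Complex.I * ((m' - m : ℝ) : ℂ) * t) =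
      Complex.exp (-(Complex.I * m * t)) * Complex.exp (Complex.I * m' * t) := by
    intro m m' t
    rw [← Complex.exp_add]
    congr 1
    push_cast; ring
  simp only [wignerD, Complex.star_def, map_mul, h1, Complex.conj_ofReal]
  rw [h2, h2]
  push_cast
  ring

theorem two_mul_mL_sub (l l' : Label Q) : l'.mL - l.mL =
    ((2 * l'.a + l.twoJ - 2 * l.a - l'.twoJ : ℤ) : ℝ) / 2 := by
  simp only [Label.mL, Label.j]; push_cast; ring

theorem two_mul_mR_sub (l l' : Label Q) : l'.mR - l.mR =
    ((2 * l'.b + l.twoJ - 2 * l.b - l'.twoJ : ℤ) : ℝ) / 2 := by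
  simp only [Label.mR, Label.j]; push_cast; ring

/-- The columns of `V` are orthonormal. -/
theorem conjTranspose_V_mul_V (Q : ℕ) : (V Q)ᴴ * V Q = (1 : Matrix (Label Q) (Label Q) ℂ) := by
  ext l l'
  have hV : ∀ k : Grid Q, (V Q)ᴴ l k * V Q k l' =
      (((√(l.j + 1 / 2) * √(l'.j + 1 / 2) / (nPhi Q * nPhi Q) *
        (gaussWeight (nTheta Q) k.1 *
        (wignerSmallD l.twoJ l.a l.b (legendreAngle (nTheta Q) k.1) *
          wignerSmallD l'.twoJ l'.a l'.b (legendreAngle (nTheta Q) k.1))) : ℝ)) : ℂ) *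
      (Complex.exp (Complex.I * ((l'.mL - l.mL : ℝ) : ℂ) *
          ((4 * Real.pi / nPhi Q * ((k.2.1 : ℕ) + 1) : ℝ) : ℂ)) *
        Complex.exp (Complex.I * ((l'.mR - l.mR : ℝ) : ℂ) *
          ((4 * Real.pi / nPhi Q * ((k.2.2 : ℕ) + 1) : ℝ) : ℂ))) := by
    intro k
    have hw : √(gaussWeight (nTheta Q) k.1 / (nPhi Q * nPhi Q)) *
        √(gaussWeight (nTheta Q) k.1 / (nPhi Q * nPhi Q)) =
        gaussWeight (nTheta Q) k.1 / (nPhi Q * nPhi Q) :=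
      Real.mul_self_sqrt (div_nonneg (gaussWeight_pos _ _).le (by positivity))
    have hw' : ((√(gaussWeight (nTheta Q) k.1 / (nPhi Q * nPhi Q)) : ℝ) : ℂ) *
        ((√(gaussWeight (nTheta Q) k.1 / (nPhi Q * nPhi Q)) : ℝ) : ℂ) =
        ((gaussWeight (nTheta Q) k.1 / (nPhi Q * nPhi Q) : ℝ) : ℂ) := by
      rw [← Complex.ofReal_mul, hw]
    have h := star_wignerD_mul l l' (gridTheta k) (gridPhi k) (gridPsi k)
    rw [conjTranspose_apply, V, of_apply, of_apply, star_mul', Complex.star_def,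
      Complex.conj_ofReal, ← Complex.star_def, mul_mul_mul_comm, h]
    simp only [gridTheta, gridPhi, gridPsi]
    rw [Complex.ofReal_mul, Complex.ofReal_mul, mul_mul_mul_comm (√(l.j + 1 / 2) : ℂ), hw']
    push_cast
    ring
  rw [mul_apply, Finset.sum_congr rfl fun k _ => hV k, Fintype.sum_prod_type]
  simp only [Fintype.sum_prod_type]
  simp_rw [← Finset.mul_sum]
  have hbnd : ∀ l l' : Label Q, |(2 * l'.a + l.twoJ - 2 * l.a - l'.twoJ : ℤ)| ≤ 2 * Q ∧
      |(2 * l'.b + l.twoJ - 2 * l.b - l'.twoJ : ℤ)| ≤ 2 * Q := by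
    intro l l'
    have := l.a_le; have := l'.a_le; have := l.b_le; have := l'.b_le
    have := l.twoJ_le; have := l'.twoJ_le
    constructor <;> (rw [abs_le]; omega)
  rw [← Finset.sum_mul]
  rw [← Finset.sum_mul]
  rw [two_mul_mL_sub, two_mul_mR_sub, sum_exp_grid Q _ (hbnd l l').1,
    sum_exp_grid Q _ (hbnd l l').2]
  have hN : (nPhi Q : ℂ) ≠ 0 := Nat.cast_ne_zero.mpr (nPhi_pos Q).ne'
  have hNr : (nPhi Q : ℝ) ≠ 0 := Nat.cast_ne_zero.mpr (nPhi_pos Q).ne'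
  by_cases hL : (2 * l'.a + l.twoJ - 2 * l.a - l'.twoJ : ℤ) = 0
  · by_cases hR : (2 * l'.b + l.twoJ - 2 * l.b - l'.twoJ : ℤ) = 0
    · rw [if_pos hL, if_pos hR, ← Complex.ofReal_sum, ← Finset.mul_sum,
        sum_gaussWeight_wignerSmallD l.a_le l.b_le l'.a_le l'.b_le (by omega) (by omega)
        (by have := l.twoJ_le; have := l'.twoJ_le; rw [nTheta]; omega)]
      by_cases hJ : l.twoJ = l'.twoJ
      · obtain rfl : l = l' := Label.ext_iff'.mpr ⟨hJ, by omega, by omega⟩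
        have hj : √(l.j + 1 / 2) * √(l.j + 1 / 2) = l.j + 1 / 2 :=
          Real.mul_self_sqrt (by rw [Label.j]; positivity)
        rw [if_pos rfl, hj, one_apply_eq, Label.j]
        have hJ1 : (l.twoJ + 1 : ℂ) ≠ 0 := by
          have : ((l.twoJ + 1 : ℕ) : ℂ) ≠ 0 := Nat.cast_ne_zero.mpr (Nat.succ_ne_zero _)
          push_cast at this; exact this
        push_cast
        field_simp
      · rw [if_neg hJ, one_apply_ne (fun h => hJ (by rw [h]))]
        simp
    · rw [if_neg hR, one_apply_ne (by rintro rfl; apply hR; ring)]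
      simp
  · rw [if_neg hL, one_apply_ne (by rintro rfl; apply hL; ring)]
    simp

/-! ### Eigenvectors of the truncated momenta -/

theorem j_mul_sub_lower (l : Label Q) :
    l.j * (l.j + 1) - l.mL * (l.mL - 1) = l.a * ((l.twoJ : ℝ) - l.a + 1) := by
  simp only [Label.mL, Label.j]; ring

theorem j_mul_sub_raise (l : Label Q) :
    l.j * (l.j + 1) - l.mL * (l.mL + 1) = ((l.twoJ : ℝ) - l.a) * (l.a + 1) := by
  simp only [Label.mL, Label.j]; ring

theorem hatLplus_mul_hatLminus (Q : ℕ) : hatLplus Q * hatLminus Q =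
    diagonal fun l => ((l.j * (l.j + 1) - l.mL * (l.mL - 1) : ℝ) : ℂ) := by
  ext l' l
  rw [mul_apply]
  have hale := l.a_le
  rcases eq_or_ne l' l with rfl | hne
  · rw [diagonal_apply_eq]
    rcases Nat.eq_zero_or_pos l'.a with h0 | hpos
    · rw [j_mul_sub_lower, h0, Finset.sum_eq_zero]
      · simp
      · intro m _
        simp only [hatLminus, of_apply]
        rw [if_neg (by omega), mul_zero]
    -- the only intermediate state is the lowered one
    · let m : Label Q :=
        ⟨l'.1, ⟨l'.a - 1, by have := l'.2.1.2; simp only [Label.a]; omega⟩, l'.2.2⟩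
      have hmJ : m.twoJ = l'.twoJ := rfl
      have hma : m.a = l'.a - 1 := rfl
      have hmb : m.b = l'.b := rfl
      rw [Finset.sum_eq_single m]
      · simp only [hatLplus, hatLminus, of_apply]
        rw [if_pos ⟨rfl, by omega, rfl⟩, if_pos ⟨rfl, by omega, rfl⟩, ← Complex.ofReal_mul,
          j_mul_sub_lower, j_mul_sub_raise, hmJ, hma, Nat.cast_sub hpos]
        congr 1
        rw [show ((l'.twoJ : ℝ) - (l'.a - (1 : ℕ))) * (l'.a - (1 : ℕ) + 1) =
          l'.a * ((l'.twoJ : ℝ) - l'.a + 1) by push_cast; ring]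
        apply Real.mul_self_sqrt
        have : (l'.a : ℝ) ≤ l'.twoJ := by exact_mod_cast hale
        exact mul_nonneg (Nat.cast_nonneg _) (by linarith)
      · intro x _ hx
        simp only [hatLminus, of_apply]
        rw [if_neg, mul_zero]
        rintro ⟨h1, h2, h3⟩
        exact hx (Label.ext_iff'.mpr ⟨h1, by omega, h3⟩)
      · simp
  · rw [diagonal_apply_ne _ hne]
    refine Finset.sum_eq_zero fun m _ => ?_
    simp only [hatLplus, hatLminus, of_apply]
    split_ifs with h1 h2
    · exact absurd (Label.ext_iff'.mpr ⟨by omega, by omega, by omega⟩) hne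
    all_goals simp

theorem hatLminus_mul_hatLplus (Q : ℕ) : hatLminus Q * hatLplus Q =
    diagonal fun l => ((l.j * (l.j + 1) - l.mL * (l.mL + 1) : ℝ) : ℂ) := by
  ext l' l
  rw [mul_apply]
  have hale := l.a_le
  rcases eq_or_ne l' l with rfl | hne
  · rw [diagonal_apply_eq]
    rcases hale.eq_or_lt with h0 | hpos
    · rw [j_mul_sub_raise, h0, Finset.sum_eq_zero]
      · simp
      · intro m _
        have := m.a_le
        simp only [hatLplus, of_apply]
        rw [if_neg (by omega), mul_zero]
    -- the only intermediate state is the raised one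
    · let m : Label Q := ⟨l'.1, ⟨l'.a + 1, Nat.succ_lt_succ hpos⟩, l'.2.2⟩
      have hmJ : m.twoJ = l'.twoJ := rfl
      have hma : m.a = l'.a + 1 := rfl
      rw [Finset.sum_eq_single m]
      · simp only [hatLplus, hatLminus, of_apply]
        rw [if_pos ⟨rfl, by omega, rfl⟩, if_pos ⟨rfl, by omega, rfl⟩, ← Complex.ofReal_mul,
          j_mul_sub_lower, j_mul_sub_raise, hmJ, hma]
        congr 1
        rw [show (((l'.a + 1 : ℕ) : ℝ)) * ((l'.twoJ : ℝ) - ((l'.a + 1 : ℕ) : ℝ) + 1) =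
          ((l'.twoJ : ℝ) - l'.a) * (l'.a + 1) by push_cast; ring]
        apply Real.mul_self_sqrt
        have : (l'.a : ℝ) ≤ l'.twoJ := by exact_mod_cast hale
        exact mul_nonneg (by linarith) (by positivity)
      · intro x _ hx
        simp only [hatLplus, of_apply]
        rw [if_neg, mul_zero]
        rintro ⟨h1, h2, h3⟩
        exact hx (Label.ext_iff'.mpr ⟨h1, by omega, h3⟩)
      · simp
  · rw [diagonal_apply_ne _ hne]
    refine Finset.sum_eq_zero fun m _ => ?_
    simp only [hatLplus, hatLminus, of_apply]
    split_ifs with h1 h2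
    · exact absurd (Label.ext_iff'.mpr ⟨by omega, by omega, by omega⟩) hne
    all_goals simp

/-- The Casimir operator of the truncated momenta. -/
theorem sum_hatL_mul_self (Q : ℕ) : ∑ c, hatL Q c * hatL Q c =
    diagonal fun l => ((l.j * (l.j + 1) : ℝ) : ℂ) := by
  have h0 : hatL Q 0 = (1 / 2 : ℂ) • (hatLplus Q + hatLminus Q) := rfl
  have h1 : hatL Q 1 = (1 / (2 * Complex.I) : ℂ) • (hatLplus Q - hatLminus Q) := rfl
  have h2 : hatL Q 2 = diagonal fun l => (l.mL : ℂ) := rfl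
  have hI : (1 / (2 * Complex.I) : ℂ) * (1 / (2 * Complex.I)) = -(1 / 4) := by
    rw [div_mul_div_comm, mul_mul_mul_comm, Complex.I_mul_I]; norm_num
  have e : hatL Q 0 * hatL Q 0 + hatL Q 1 * hatL Q 1 =
      (1 / 2 : ℂ) • (hatLplus Q * hatLminus Q + hatLminus Q * hatLplus Q) := by
    rw [h0, h1, smul_mul_smul_comm, smul_mul_smul_comm, hI]
    simp only [mul_add, add_mul, mul_sub, sub_mul]
    module
  rw [Fin.sum_univ_three, e, h2, hatLplus_mul_hatLminus, hatLminus_mul_hatLplus,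
    diagonal_mul_diagonal, diagonal_add, ← diagonal_smul, diagonal_add]
  congr 1
  funext l
  simp only [Pi.smul_apply, smul_eq_mul]
  push_cast
  ring

theorem sandwich_mul (D D' : Matrix (Label Q) (Label Q) ℂ) :
    V Q * D * (V Q)ᴴ * (V Q * D' * (V Q)ᴴ) = V Q * (D * D') * (V Q)ᴴ := by
  calc V Q * D * (V Q)ᴴ * (V Q * D' * (V Q)ᴴ)
      = V Q * D * ((V Q)ᴴ * V Q) * D' * (V Q)ᴴ := by simp only [Matrix.mul_assoc]
    _ = V Q * (D * D') * (V Q)ᴴ := by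
      rw [conjTranspose_V_mul_V, Matrix.mul_one, Matrix.mul_assoc (V Q)]

theorem Lsq_eq (Q : ℕ) :
    Lsq Q = V Q * (diagonal fun l => ((l.j * (l.j + 1) : ℝ) : ℂ) :
      Matrix (Label Q) (Label Q) ℂ) * (V Q)ᴴ := by
  rw [← sum_hatL_mul_self, Lsq, Matrix.mul_sum, Matrix.sum_mul]
  exact Finset.sum_congr rfl fun c _ => sandwich_mul _ _

theorem sandwich_mulVec (D : Matrix (Label Q) (Label Q) ℂ) (u : Label Q → ℂ) :
    (V Q * D * (V Q)ᴴ) *ᵥ (V Q *ᵥ u) = V Q *ᵥ (D *ᵥ u) := by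
  rw [mulVec_mulVec, Matrix.mul_assoc, conjTranspose_V_mul_V, Matrix.mul_one, ← mulVec_mulVec]

theorem V_mulVec_injective (Q : ℕ) : Function.Injective (V Q).mulVec := by
  intro u u' h
  have := congrArg (fun x => (V Q)ᴴ *ᵥ x) h
  simpa [mulVec_mulVec, conjTranspose_V_mul_V] using this

theorem col_eq_mulVec (l : Label Q) : (fun k => V Q k l) = V Q *ᵥ Pi.single l 1 := by
  rw [mulVec_single_one]; rfl

theorem isJointEigen_col (l : Label Q) : IsJointEigen l (fun k => V Q k l) := by
  rw [col_eq_mulVec]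
  have h : ∀ d : Label Q → ℂ, (V Q * diagonal d * (V Q)ᴴ) *ᵥ (V Q *ᵥ Pi.single l 1) =
      d l • (V Q *ᵥ Pi.single l 1) := by
    intro d
    rw [sandwich_mulVec, ← mulVec_smul]
    congr 1
    ext l'
    rw [mulVec_diagonal]
    rcases eq_or_ne l' l with rfl | h
    · simp
    · simp [h]
  refine ⟨?_, ?_, ?_⟩
  · rw [Lsq_eq, h]
  · exact h _
  · exact h _

theorem linearIndependent_cols (Q : ℕ) :
    LinearIndependent ℂ (fun (l : Label Q) (k : Grid Q) => V Q k l) := by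
  have := Matrix.mulVec_injective_iff.mp (V_mulVec_injective Q)
  exact this

theorem Label.j_nonneg (l : Label Q) : 0 ≤ l.j := by rw [Label.j]; positivity

/-- Since `j (j + 1) ≠ 0`, an eigenvector lies in the range of `V`, on which `V` diagonalizes the
three operators with distinct joint eigenvalues. -/
theorem IsJointEigen.eq_smul {l : Label Q} (hl : l.twoJ ≠ 0) {v : Grid Q → ℂ}
    (h : IsJointEigen l v) : ∃ c : ℂ, v = c • fun k => V Q k l := by
  obtain ⟨h1, h2, h3⟩ := h
  have hj : 0 < l.j := by
    have : 0 < l.twoJ := Nat.pos_of_ne_zero hl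
    rw [Label.j]; positivity
  have hlam : ((l.j * (l.j + 1) : ℝ) : ℂ) ≠ 0 := by
    rw [Complex.ofReal_ne_zero]; positivity
  -- `v` is a multiple of its image under the Casimir operator
  obtain ⟨u, rfl⟩ : ∃ u, v = V Q *ᵥ u := by
    refine ⟨((l.j * (l.j + 1) : ℝ) : ℂ)⁻¹ • ((diagonal fun l : Label Q =>
      ((l.j * (l.j + 1) : ℝ) : ℂ)) *ᵥ ((V Q)ᴴ *ᵥ v)), ?_⟩
    rw [mulVec_smul, mulVec_mulVec, mulVec_mulVec, ← Lsq_eq, h1, smul_smul, inv_mul_cancel₀ hlam,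
      one_smul]
  rw [Lsq_eq, sandwich_mulVec, ← mulVec_smul] at h1
  have h2' : (V Q * (diagonal fun l => (l.mL : ℂ) : Matrix (Label Q) (Label Q) ℂ) * (V Q)ᴴ) *ᵥ
    (V Q *ᵥ u) = (l.mL : ℂ) • V Q *ᵥ u := h2
  have h3' : (V Q * (diagonal fun l => (-l.mR : ℂ) : Matrix (Label Q) (Label Q) ℂ) * (V Q)ᴴ) *ᵥ
    (V Q *ᵥ u) = (-l.mR : ℂ) • V Q *ᵥ u := h3
  rw [sandwich_mulVec, ← mulVec_smul] at h2' h3'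
  have k1 := V_mulVec_injective Q h1
  have k2 := V_mulVec_injective Q h2'
  have k3 := V_mulVec_injective Q h3'
  refine ⟨u l, ?_⟩
  rw [col_eq_mulVec, ← mulVec_smul]
  congr 1
  ext l'
  rcases eq_or_ne l' l with rfl | hne
  · simp
  rw [Pi.smul_apply, Pi.single_eq_of_ne hne, smul_zero]
  by_contra hu
  apply hne
  have e1 := congrFun k1 l'
  have e2 := congrFun k2 l'
  have e3 := congrFun k3 l'
  rw [mulVec_diagonal, Pi.smul_apply, smul_eq_mul] at e1 e2 e3
  have f1 : l'.j * (l'.j + 1) = l.j * (l.j + 1) := by exact_mod_cast mul_right_cancel₀ hu e1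
  have f2 : l'.mL = l.mL := by exact_mod_cast mul_right_cancel₀ hu e2
  have f3 : l'.mR = l.mR := by
    have := mul_right_cancel₀ hu e3
    rw [neg_inj] at this
    exact_mod_cast this
  have fj : l'.j = l.j := by
    have := l'.j_nonneg
    have : (l'.j - l.j) * (l'.j + l.j + 1) = 0 := by linear_combination f1
    rcases mul_eq_zero.mp this with h | h <;> linarith
  have fJ : l'.twoJ = l.twoJ := by
    have : (l'.twoJ : ℝ) = l.twoJ := by simp only [Label.j] at fj; linarith
    exact_mod_cast this
  refine Label.ext_iff'.mpr ⟨fJ, ?_, ?_⟩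
  · have : (l'.a : ℝ) = l.a := by simp only [Label.mL] at f2; linarith
    exact_mod_cast this
  · have : (l'.b : ℝ) = l.b := by simp only [Label.mR] at f3; linarith
    exact_mod_cast this

/-! ### The differential equation of the Wigner functions -/

theorem one_sub_sq_mul_derivative_jacobiWeight (A B : ℕ) :
    (1 - X ^ 2) * derivative (jacobiWeight A B) +
      (C ((A : ℝ) - B) + C ((A : ℝ) + B) * X) * jacobiWeight A B = 0 := by
  have e1 := one_sub_X_pow_mul_iterate_derivative A 1
  have e2 := one_add_X_pow_mul_iterate_derivative B 1
  simp only [pow_one, Function.iterate_one, Nat.descFactorial_one] at e1 e2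
  rw [jacobiWeight, derivative_mul]
  simp only [C_sub, C_add, C_eq_natCast]
  linear_combination ((1 + X) * (1 + X) ^ B) * e1 + ((1 - X) * (1 - X) ^ A) * e2

/-- The differential equation of the derivatives in Rodrigues' formula. -/
theorem jacobi_ode (n A B : ℕ) :
    (1 - X ^ 2) * derivative (derivative (derivative^[n] (jacobiWeight A B))) +
      (C ((A : ℝ) - B) + C ((A : ℝ) + B - 2 * (n + 1)) * X) *
        derivative (derivative^[n] (jacobiWeight A B)) +
      C (((n : ℝ) + 1) * (A + B - n)) * derivative^[n] (jacobiWeight A B) = 0 := by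
  induction n with
  | zero =>
    have h := congrArg derivative (one_sub_sq_mul_derivative_jacobiWeight A B)
    simp only [derivative_add, derivative_mul, derivative_sub, derivative_one, derivative_X_pow,
      derivative_C, derivative_X, derivative_zero] at h
    simp only [Function.iterate_zero, id]
    simp only [C_sub, C_add, C_eq_natCast, C_mul, C_1, C_ofNat] at h ⊢
    simp at h ⊢
    linear_combination h
  | succ n ih =>
    have h := congrArg derivative ih
    simp only [derivative_add, derivative_mul, derivative_sub, derivative_one, derivative_X_pow,
      derivative_C, derivative_X, derivative_zero] at h
    rw [Function.iterate_succ_apply']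
    simp only [C_sub, C_add, C_eq_natCast, C_mul, C_1, C_ofNat] at h ⊢
    simp at h ⊢
    linear_combination h

theorem eval_jacobi_ode (n A B : ℕ) (x : ℝ) :
    (1 - x ^ 2) * (derivative (derivative (derivative^[n] (jacobiWeight A B)))).eval x +
      (((A : ℝ) - B) + ((A : ℝ) + B - 2 * (n + 1)) * x) *
        (derivative (derivative^[n] (jacobiWeight A B))).eval x +
      (((n : ℝ) + 1) * (A + B - n)) * (derivative^[n] (jacobiWeight A B)).eval x = 0 := by
  have h := congrArg (eval x) (jacobi_ode n A B)
  simpa only [eval_add, eval_mul, eval_sub, eval_one, eval_pow, eval_X, eval_C, eval_zero] using h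

theorem cos_mem_Ioo {θ : ℝ} (h0 : 0 < θ) (hπ : θ < Real.pi) : Real.cos θ ∈ Set.Ioo (-1 : ℝ) 1 := by
  have hs := Real.sin_pos_of_pos_of_lt_pi h0 hπ
  have := Real.sin_sq_add_cos_sq θ
  constructor <;> nlinarith

/-- The function `sin(θ/2)^(2p) cos(θ/2)^(2r) F(cos θ)`. -/
noncomputable def trigMonomialMul (p r : ℝ) (F : ℝ[X]) (θ : ℝ) : ℝ :=
  ((1 - Real.cos θ) / 2) ^ p * ((1 + Real.cos θ) / 2) ^ r * F.eval (Real.cos θ)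

theorem hasDerivAt_trigMonomialMul (p r : ℝ) (F : ℝ[X]) {θ : ℝ} (h0 : 0 < θ) (hπ : θ < Real.pi) :
    HasDerivAt (trigMonomialMul p r F)
      ((p * (1 + Real.cos θ) - r * (1 - Real.cos θ)) / Real.sin θ * trigMonomialMul p r F θ -
        Real.sin θ * trigMonomialMul p r (derivative F) θ) θ := by
  have hs := Real.sin_pos_of_pos_of_lt_pi h0 hπ
  obtain ⟨hv, hw⟩ := half_one_sub_cos_pos (cos_mem_Ioo h0 hπ)
  have hsq := Real.sin_sq_add_cos_sq θ
  have h1 : HasDerivAt (fun t => (1 - Real.cos t) / 2) (Real.sin θ / 2) θ := by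
    simpa using ((Real.hasDerivAt_cos θ).const_sub 1).div_const 2
  have h2 : HasDerivAt (fun t => (1 + Real.cos t) / 2) (-Real.sin θ / 2) θ :=
    ((Real.hasDerivAt_cos θ).const_add 1).div_const 2
  have h3 : HasDerivAt (fun t => F.eval (Real.cos t))
      ((derivative F).eval (Real.cos θ) * (-Real.sin θ)) θ :=
    (F.hasDerivAt _).comp θ (Real.hasDerivAt_cos θ)
  have h := ((h1.rpow_const (p := p) (Or.inl hv.ne')).mul
    (h2.rpow_const (p := r) (Or.inl hw.ne'))).mul h3
  refine h.congr_deriv ?_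
  rw [Real.rpow_sub_one hv.ne', Real.rpow_sub_one hw.ne', trigMonomialMul, trigMonomialMul]
  have hv' : (1 - Real.cos θ) ≠ 0 := by linarith
  have hw' : (1 + Real.cos θ) ≠ 0 := by linarith
  simp only [Pi.mul_apply]
  generalize ((1 - Real.cos θ) / 2) ^ p = E1
  generalize ((1 + Real.cos θ) / 2) ^ r = E2
  have hsin : Real.sin θ ^ 2 = (1 - Real.cos θ) * (1 + Real.cos θ) := by linarith
  have e1 : Real.sin θ / (1 - Real.cos θ) = (1 + Real.cos θ) / Real.sin θ := by
    rw [div_eq_div_iff hv' hs.ne']; linarith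
  have e2 : Real.sin θ / (1 + Real.cos θ) = (1 - Real.cos θ) / Real.sin θ := by
    rw [div_eq_div_iff hw' hs.ne']; linarith
  have l1 : Real.sin θ / 2 * p * (E1 / ((1 - Real.cos θ) / 2)) =
      p * E1 * (Real.sin θ / (1 - Real.cos θ)) := by field_simp
  have l2 : -Real.sin θ / 2 * r * (E2 / ((1 + Real.cos θ) / 2)) =
      -(r * E2 * (Real.sin θ / (1 + Real.cos θ))) := by field_simp
  rw [l1, l2, e1, e2]
  ring

/-- The Wigner functions in terms of the derivatives in Rodrigues' formula, which are
polynomials for all values of the magnetic numbers. -/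
theorem wignerSmallD_eq_trigMonomialMul {J a b : ℕ} (ha : a ≤ J) (hb : b ≤ J) {θ : ℝ}
    (h0 : 0 < θ) (hπ : θ < Real.pi) :
    wignerSmallD J a b θ =
      wignerConst J a b * (4 ^ (J - b) / ((-2) ^ (J - b) * (J - b).factorial * 2 ^ J)) *
        trigMonomialMul (((a : ℝ) - b) / 2) (((J : ℝ) - a - b) / 2)
          (derivative^[J - b] (jacobiWeight (J - a) a)) θ := by
  obtain ⟨hv, hw⟩ := half_one_sub_cos_pos (cos_mem_Ioo h0 hπ)
  rw [wignerSmallD_eq ha hb, trigMonomialMul]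
  have hro := eval_rodrigues (J - b) (J - a) a (Real.cos θ)
  rw [Nat.sub_add_cancel ha] at hro
  set v := (1 - Real.cos θ) / 2
  set w := (1 + Real.cos θ) / 2
  set P := (jacobiPoly (J - b) (J - a) a).eval (Real.cos θ)
  set W := (derivative^[J - b] (jacobiWeight (J - a) a)).eval (Real.cos θ)
  have ev : v ^ (((b : ℝ) - a) / 2) = v ^ (((a : ℝ) - b) / 2) * (v ^ (J - a) / v ^ (J - b)) := by
    rw [← Real.rpow_natCast, ← Real.rpow_natCast, ← Real.rpow_sub hv, ← Real.rpow_add hv]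
    congr 1
    push_cast [Nat.cast_sub ha, Nat.cast_sub hb]
    ring
  have ew : w ^ (((a : ℝ) + b - J) / 2) =
      w ^ (((J : ℝ) - a - b) / 2) * (w ^ a / w ^ (J - b)) := by
    rw [← Real.rpow_natCast, ← Real.rpow_natCast, ← Real.rpow_sub hw, ← Real.rpow_add hw]
    congr 1
    push_cast [Nat.cast_sub ha, Nat.cast_sub hb]
    ring
  have hne : ((-2 : ℝ) ^ (J - b) * (J - b).factorial * 2 ^ J) ≠ 0 := by
    have : ((-2 : ℝ)) ^ (J - b) ≠ 0 := pow_ne_zero _ (by norm_num)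
    positivity
  have key : v ^ (J - a) / v ^ (J - b) * (w ^ a / w ^ (J - b)) * P =
      4 ^ (J - b) / ((-2) ^ (J - b) * (J - b).factorial * 2 ^ J) * W := by
    rw [div_mul_div_comm, div_mul_eq_mul_div, div_mul_eq_mul_div,
      div_eq_div_iff (by positivity) hne]
    linear_combination -hro
  rw [ev, ew]
  linear_combination (wignerConst J a b * v ^ (((a : ℝ) - b) / 2) *
    w ^ (((J : ℝ) - a - b) / 2)) * key

/-- First and second derivatives of the Wigner functions, related by Wigner's differential
equation. -/
theorem exists_hasDerivAt_wignerSmallD (l : Label Q) :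
    ∃ d' d'' : ℝ → ℝ, ∀ θ, 0 < θ → θ < Real.pi →
      HasDerivAt (wignerSmallD l.twoJ l.a l.b) (d' θ) θ ∧ HasDerivAt d' (d'' θ) θ ∧
      -(Real.cos θ / Real.sin θ) * d' θ - d'' θ +
        (l.mL ^ 2 + l.mR ^ 2 - 2 * l.mL * l.mR * Real.cos θ) / Real.sin θ ^ 2 *
          wignerSmallD l.twoJ l.a l.b θ = l.j * (l.j + 1) * wignerSmallD l.twoJ l.a l.b θ := by
  set F := derivative^[l.twoJ - l.b] (jacobiWeight (l.twoJ - l.a) l.a) with hF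
  set p := ((l.a : ℝ) - l.b) / 2 with hp
  set r := ((l.twoJ : ℝ) - l.a - l.b) / 2 with hr
  set κ := wignerConst l.twoJ l.a l.b *
    (4 ^ (l.twoJ - l.b) / ((-2) ^ (l.twoJ - l.b) * (l.twoJ - l.b).factorial * 2 ^ l.twoJ)) with hκ
  have hd : ∀ θ, 0 < θ → θ < Real.pi →
      wignerSmallD l.twoJ l.a l.b θ = κ * trigMonomialMul p r F θ := fun θ h0 hπ =>
    wignerSmallD_eq_trigMonomialMul l.a_le l.b_le h0 hπ
  set h : ℝ → ℝ := fun θ => (p * (1 + Real.cos θ) - r * (1 - Real.cos θ)) / Real.sin θ with hh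
  set h' : ℝ → ℝ := fun θ => ((p * -Real.sin θ - r * Real.sin θ) * Real.sin θ -
    (p * (1 + Real.cos θ) - r * (1 - Real.cos θ)) * Real.cos θ) / Real.sin θ ^ 2 with hh'
  set g := trigMonomialMul p r F with hg
  set g1 := trigMonomialMul p r (derivative F) with hg1
  set g2 := trigMonomialMul p r (derivative (derivative F)) with hg2
  refine ⟨fun θ => κ * (h θ * g θ - Real.sin θ * g1 θ),
    fun θ => κ * (h' θ * g θ + h θ * (h θ * g θ - Real.sin θ * g1 θ) -
      (Real.cos θ * g1 θ + Real.sin θ * (h θ * g1 θ - Real.sin θ * g2 θ))),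
    fun θ h0 hπ => ⟨?_, ?_, ?_⟩⟩
  · refine ((hasDerivAt_trigMonomialMul p r F h0 hπ).const_mul κ).congr_of_eventuallyEq ?_
    filter_upwards [Ioo_mem_nhds h0 hπ] with t ht using hd t ht.1 ht.2
  · have hs := Real.sin_pos_of_pos_of_lt_pi h0 hπ
    have hder : HasDerivAt h (h' θ) θ := by
      have k1 : HasDerivAt (fun t => p * (1 + Real.cos t) - r * (1 - Real.cos t))
          (p * -Real.sin θ - r * Real.sin θ) θ := by
        have := (((Real.hasDerivAt_cos θ).const_add 1).const_mul p).sub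
          (((Real.hasDerivAt_cos θ).const_sub 1).const_mul r)
        exact this.congr_deriv (by ring)
      exact k1.div (Real.hasDerivAt_sin θ) hs.ne'
    exact ((hder.mul (hasDerivAt_trigMonomialMul p r F h0 hπ)).sub
      ((Real.hasDerivAt_sin θ).mul
        (hasDerivAt_trigMonomialMul p r (derivative F) h0 hπ))).const_mul κ
  · have hs := Real.sin_pos_of_pos_of_lt_pi h0 hπ
    rw [hd θ h0 hπ]
    have hode := eval_jacobi_ode (l.twoJ - l.b) (l.twoJ - l.a) l.a (Real.cos θ)
    rw [← hF] at hode
    push_cast [Nat.cast_sub l.a_le, Nat.cast_sub l.b_le] at hode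
    have hsq : Real.sin θ ^ 2 = 1 - Real.cos θ ^ 2 := by linarith [Real.sin_sq_add_cos_sq θ]
    have hode' : Real.sin θ ^ 2 * g2 θ + (((l.twoJ : ℝ) - 2 * l.a) +
        (2 * (l.b : ℝ) - l.twoJ - 2) * Real.cos θ) * g1 θ +
        ((l.twoJ : ℝ) - l.b + 1) * l.b * g θ = 0 := by
      rw [hsq, hg, hg1, hg2, trigMonomialMul, trigMonomialMul, trigMonomialMul]
      linear_combination (((1 - Real.cos θ) / 2) ^ p * ((1 + Real.cos θ) / 2) ^ r) * hode
    have hsh : Real.sin θ * h θ = l.mL - l.mR * Real.cos θ := by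
      rw [hh]
      simp only
      rw [mul_div_cancel₀ _ hs.ne', hp, hr, Label.mL, Label.mR, Label.j]
      ring
    have hsh' : Real.sin θ ^ 2 * h' θ = l.mR * Real.sin θ ^ 2 -
        (l.mL - l.mR * Real.cos θ) * Real.cos θ := by
      rw [hh']
      simp only
      rw [mul_div_cancel₀ _ (pow_ne_zero 2 hs.ne'), hp, hr, Label.mL, Label.mR, Label.j]
      ring
    have ha : (l.a : ℝ) = l.mL + l.j := by rw [Label.mL]; ring
    have hb : (l.b : ℝ) = l.mR + l.j := by rw [Label.mR]; ring
    have hJ : (l.twoJ : ℝ) = 2 * l.j := by rw [Label.j]; ring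
    rw [ha, hb, hJ] at hode'
    have hh1 : h θ = (l.mL - l.mR * Real.cos θ) / Real.sin θ := by
      rw [eq_div_iff hs.ne']; linarith
    have hh2 : h' θ = (l.mR * Real.sin θ ^ 2 -
        (l.mL - l.mR * Real.cos θ) * Real.cos θ) / Real.sin θ ^ 2 := by
      rw [eq_div_iff (pow_ne_zero 2 hs.ne')]; linarith
    simp only [hh1, hh2]
    field_simp
    linear_combination (-κ * Real.sin θ ^ 2) * hode' + (κ * g θ * (-l.mR ^ 2)) * hsq

theorem deriv_mul_exp_mul (m : ℝ) (A B : ℂ) :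
    (deriv fun t : ℝ => A * Complex.exp (Complex.I * m * t) * B) =
      fun t : ℝ => (Complex.I * m * A) * Complex.exp (Complex.I * m * t) * B := by
  funext t
  have h1 : HasDerivAt (fun t : ℝ => Complex.I * m * (t : ℂ)) (Complex.I * m) t := by
    simpa using (Complex.ofRealCLM.hasDerivAt (x := t)).const_mul (Complex.I * (m : ℂ))
  rw [((h1.cexp.const_mul A).mul_const B).deriv]
  ring

theorem contL3_wignerD (l : Label Q) (θ φ ψ : ℝ) :
    contL3 (wignerD l) θ φ ψ = (l.mL : ℂ) * wignerD l θ φ ψ := by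
  have h := congrFun (deriv_mul_exp_mul l.mL 1 ((wignerSmallD l.twoJ l.a l.b θ : ℂ) *
    Complex.exp (Complex.I * l.mR * ψ))) φ
  have e : (fun t => wignerD l θ t ψ) = fun t : ℝ => 1 * Complex.exp (Complex.I * l.mL * t) *
      ((wignerSmallD l.twoJ l.a l.b θ : ℂ) * Complex.exp (Complex.I * l.mR * ψ)) := by
    funext t; rw [wignerD]; ring
  rw [contL3, e, h, wignerD]
  linear_combination (-(l.mL : ℂ) * Complex.exp (Complex.I * l.mL * φ) *
    ((wignerSmallD l.twoJ l.a l.b θ : ℂ) * Complex.exp (Complex.I * l.mR * ψ))) * Complex.I_mul_I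

theorem contR3_wignerD (l : Label Q) (θ φ ψ : ℝ) :
    contR3 (wignerD l) θ φ ψ = (-l.mR : ℂ) * wignerD l θ φ ψ := by
  have h := congrFun (deriv_mul_exp_mul l.mR (Complex.exp (Complex.I * l.mL * φ) *
    (wignerSmallD l.twoJ l.a l.b θ : ℂ)) 1) ψ
  have e : (fun t => wignerD l θ φ t) = fun t : ℝ => (Complex.exp (Complex.I * l.mL * φ) *
      (wignerSmallD l.twoJ l.a l.b θ : ℂ)) * Complex.exp (Complex.I * l.mR * t) * 1 := by
    funext t; rw [wignerD]; ring
  rw [contR3, e, h, wignerD]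
  linear_combination ((l.mR : ℂ) * Complex.exp (Complex.I * l.mL * φ) *
    ((wignerSmallD l.twoJ l.a l.b θ : ℂ) * Complex.exp (Complex.I * l.mR * ψ))) * Complex.I_mul_I

theorem contLsq_wignerD (l : Label Q) {θ : ℝ} (φ ψ : ℝ) (h0 : 0 < θ) (hπ : θ < Real.pi) :
    contLsq (wignerD l) θ φ ψ = ((l.j * (l.j + 1) : ℝ) : ℂ) * wignerD l θ φ ψ := by
  obtain ⟨d', d'', hd⟩ := exists_hasDerivAt_wignerSmallD l
  set E := Complex.exp (Complex.I * l.mL * φ) with hE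
  set E' := Complex.exp (Complex.I * l.mR * ψ) with hE'
  set d := wignerSmallD l.twoJ l.a l.b with hdd
  have t1 : ∀ t, 0 < t → t < Real.pi →
      deriv (fun t => wignerD l t φ ψ) t = E * (d' t : ℂ) * E' := fun t k0 kπ =>
    (((hd t k0 kπ).1.ofReal_comp.const_mul E).mul_const E').deriv
  have t2 : deriv (deriv fun t => wignerD l t φ ψ) θ = E * (d'' θ : ℂ) * E' := by
    have heq : (deriv fun t => wignerD l t φ ψ) =ᶠ[nhds θ] fun t => E * (d' t : ℂ) * E' := by
      filter_upwards [Ioo_mem_nhds h0 hπ] with t ht using t1 t ht.1 ht.2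
    rw [heq.deriv_eq]
    exact (((hd θ h0 hπ).2.1.ofReal_comp.const_mul E).mul_const E').deriv
  have eφ : ∀ u : ℝ, (fun t => wignerD l θ t u) = fun t : ℝ =>
      1 * Complex.exp (Complex.I * l.mL * t) *
      ((d θ : ℂ) * Complex.exp (Complex.I * l.mR * u)) := by
    intro u; funext t; rw [wignerD]; ring
  have eψ : ∀ c : ℂ, (fun t : ℝ => c * Complex.exp (Complex.I * l.mL * φ) *
      ((d θ : ℂ) * Complex.exp (Complex.I * l.mR * t))) = fun t : ℝ =>
      (c * Complex.exp (Complex.I * l.mL * φ) * (d θ : ℂ)) *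
        Complex.exp (Complex.I * l.mR * t) * 1 := by
    intro c; funext t; ring
  have eψ' : (fun t => wignerD l θ φ t) = fun t : ℝ =>
      (1 * Complex.exp (Complex.I * l.mL * φ) * (d θ : ℂ)) *
        Complex.exp (Complex.I * l.mR * t) * 1 := by
    funext t; rw [wignerD]; ring
  have p2 : deriv (deriv fun t => wignerD l θ t ψ) φ = -(l.mL : ℂ) ^ 2 * (E * d θ * E') := by
    rw [eφ, deriv_mul_exp_mul, deriv_mul_exp_mul]
    linear_combination ((l.mL : ℂ) ^ 2 * (E * d θ * E')) * Complex.I_mul_I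
  have s2 : deriv (deriv fun t => wignerD l θ φ t) ψ = -(l.mR : ℂ) ^ 2 * (E * d θ * E') := by
    rw [eψ', deriv_mul_exp_mul, deriv_mul_exp_mul]
    linear_combination ((l.mR : ℂ) ^ 2 * (E * d θ * E')) * Complex.I_mul_I
  have ps : deriv (fun u => deriv (fun t => wignerD l θ t u) φ) ψ =
      -((l.mL : ℂ) * l.mR) * (E * d θ * E') := by
    simp_rw [eφ, deriv_mul_exp_mul]
    rw [eψ, deriv_mul_exp_mul]
    linear_combination ((l.mL : ℂ) * l.mR * (E * d θ * E')) * Complex.I_mul_I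
  have hode := congrArg (fun x : ℝ => (x : ℂ)) (hd θ h0 hπ).2.2
  rw [contLsq, t1 θ h0 hπ, t2, p2, s2, ps]
  have hw : wignerD l θ φ ψ = E * d θ * E' := rfl
  rw [hw]
  push_cast at hode ⊢
  linear_combination (E * E') * hode

/-! ### The Wigner functions are bounded by one -/

/-- The polynomial `(c + s X)^B (c X - s)^(J - B)`; for `c = cos (θ/2)`, `s = sin (θ/2)` its
coefficients are the unnormalized matrix elements of a rotation (composed with a reflection) in
the representation on homogeneous polynomials of degree `J`. -/
noncomputable def rotPoly (J B : ℕ) (c s : ℝ) : ℝ[X] :=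
  (C c + C s * X) ^ B * (C c * X - C s) ^ (J - B)

theorem natDegree_rotPoly_le {J B : ℕ} (hB : B ≤ J) (c s : ℝ) :
    (rotPoly J B c s).natDegree ≤ J := by
  have h1 : (C c + C s * X : ℝ[X]).natDegree ≤ 1 := by compute_degree
  have h2 : (C c * X - C s : ℝ[X]).natDegree ≤ 1 := by compute_degree
  refine natDegree_mul_le.trans ((add_le_add (natDegree_pow_le_of_le B h1)
    (natDegree_pow_le_of_le (J - B) h2)).trans ?_)
  omega

theorem coeff_linear_pow (u v : ℝ) (m k : ℕ) :
    ((C u * X + C v) ^ m : ℝ[X]).coeff k = u ^ k * v ^ (m - k) * m.choose k := by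
  have h : (C u * X + C v : ℝ[X]) ^ m = ((X + C v) ^ m).comp (C u * X) := by simp
  rw [h, comp_C_mul_X_coeff, coeff_X_add_C_pow]
  ring

theorem coeff_rotPoly (J B n : ℕ) (c s : ℝ) : (rotPoly J B c s).coeff n =
    ∑ k ∈ Finset.range (n + 1), (s ^ k * c ^ (B - k) * B.choose k) *
      (c ^ (n - k) * (-s) ^ (J - B - (n - k)) * (J - B).choose (n - k)) := by
  have e1 : (C c + C s * X : ℝ[X]) = C s * X + C c := add_comm _ _
  have e2 : (C c * X - C s : ℝ[X]) = C c * X + C (-s) := by simp [sub_eq_add_neg]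
  rw [rotPoly, e1, e2, coeff_mul]
  simp_rw [coeff_linear_pow]
  rw [Finset.Nat.sum_antidiagonal_eq_sum_range_succ (f := fun i j =>
    (s ^ i * c ^ (B - i) * (B.choose i : ℝ)) * (c ^ j * (-s) ^ (J - B - j) * ((J - B).choose j)))]

theorem choose_mul_choose_mul_choose {J B n k : ℕ} (hB : B ≤ J) (hn : n ≤ J) (hkB : k ≤ B)
    (hkn : k ≤ n) : J.choose B * (B.choose k * (J - B).choose (n - k)) =
      J.choose n * (n.choose k * (J - n).choose (B - k)) := by
  have key : ∀ {B n : ℕ}, B ≤ J → k ≤ B → k ≤ n → J.choose B * (B.choose k *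
      (J - B).choose (n - k)) = J.choose k * ((J - k).choose (B - k + (n - k)) *
        (B - k + (n - k)).choose (B - k)) := by
    intro B n hB hkB hkn
    rw [← mul_assoc, Nat.choose_mul hkB, Nat.choose_mul (Nat.le_add_right _ _),
      Nat.add_sub_cancel_left, show J - k - (B - k) = J - B by omega, mul_assoc]
  rw [key hB hkB hkn, key hn hkn hkB, Nat.add_comm (n - k) (B - k), Nat.choose_symm_add]

/-- The symmetry of the matrix elements. Its source is that the generating function
`∑ B, (J.choose B) z^B rotPoly J B = (s z X + c (z + X) - s)^J` is symmetric in `z` and `X`. -/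
theorem choose_mul_coeff_rotPoly {J B n : ℕ} (hB : B ≤ J) (hn : n ≤ J) (c s : ℝ) :
    (J.choose B : ℝ) * (rotPoly J B c s).coeff n = J.choose n * (rotPoly J n c s).coeff B := by
  have key : ∀ B n : ℕ, (rotPoly J B c s).coeff n =
      ∑ k ∈ Finset.range (min n B + 1), (s ^ k * c ^ (B - k) * B.choose k) *
      (c ^ (n - k) * (-s) ^ (J - B - (n - k)) * (J - B).choose (n - k)) := by
    intro B n
    rw [coeff_rotPoly]
    symm
    refine Finset.sum_subset (Finset.range_mono (by omega)) fun k hk hk' => ?_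
    rw [Finset.mem_range] at hk hk'
    rw [Nat.choose_eq_zero_of_lt (by omega : B < k)]
    simp
  rw [key, key, Finset.mul_sum, Finset.mul_sum, min_comm]
  refine Finset.sum_congr rfl fun k hk => ?_
  rw [Finset.mem_range] at hk
  have h := choose_mul_choose_mul_choose (J := J) (B := B) (n := n) (k := k) hB hn (by omega)
    (by omega)
  have h' : (J.choose B : ℝ) * (B.choose k * (J - B).choose (n - k)) =
      J.choose n * (n.choose k * (J - n).choose (B - k)) := by exact_mod_cast h
  rw [show J - n - (B - k) = J - B - (n - k) by omega]
  linear_combination (s ^ k * c ^ (B - k) * c ^ (n - k) * (-s) ^ (J - B - (n - k))) * h'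

/-- The substitution underlying `rotPoly` is an involution. -/
theorem sum_coeff_rotPoly_mul {J B : ℕ} (hB : B ≤ J) {c s : ℝ} (hcs : c ^ 2 + s ^ 2 = 1)
    (hc : c ≠ 0) :
    ∑ n ∈ Finset.range (J + 1), C ((rotPoly J B c s).coeff n) * rotPoly J n c s = X ^ B := by
  -- compare values where the second linear form `c y - s` does not vanish
  have hinf : Set.Infinite {y : ℝ | y ≠ s / c} := by
    have : {y : ℝ | y ≠ s / c} = {s / c}ᶜ := rfl
    rw [this]
    exact (Set.finite_singleton _).infinite_compl
  refine Polynomial.eq_of_infinite_eval_eq _ _ (hinf.mono fun y hy => ?_)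
  have hV : c * y - s ≠ 0 := by
    intro h
    apply hy
    rw [eq_div_iff hc]; linarith
  change eval y _ = eval y _
  rw [eval_finsetSum, eval_pow, eval_X]
  have e : ∀ n ∈ Finset.range (J + 1), eval y (C ((rotPoly J B c s).coeff n) * rotPoly J n c s) =
      (c * y - s) ^ J * ((rotPoly J B c s).coeff n * ((c + s * y) / (c * y - s)) ^ n) := by
    intro n hn
    rw [Finset.mem_range] at hn
    rw [eval_mul, eval_C]
    nth_rewrite 2 [rotPoly]
    simp only [eval_mul, eval_pow, eval_add, eval_sub, eval_C, eval_X]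
    rw [div_pow, show (c * y - s) ^ J = (c * y - s) ^ (J - n) * (c * y - s) ^ n by
      rw [← pow_add]; congr 1; omega]
    field_simp
  rw [Finset.sum_congr rfl e, ← Finset.mul_sum, ← eval_eq_sum_range' (Nat.lt_succ_of_le
    (natDegree_rotPoly_le hB c s))]
  simp only [rotPoly, eval_mul, eval_pow, eval_add, eval_sub, eval_C, eval_X]
  rw [show (c * y - s) ^ J = (c * y - s) ^ B * (c * y - s) ^ (J - B) by
    rw [← pow_add]; congr 1; omega, mul_mul_mul_comm, ← mul_pow, ← mul_pow]
  have h1 : (c * y - s) * (c + s * ((c + s * y) / (c * y - s))) = y := by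
    field_simp
    linear_combination y * hcs
  have h2 : (c * y - s) * (c * ((c + s * y) / (c * y - s)) - s) = 1 := by
    field_simp
    linear_combination hcs
  rw [h1, h2, one_pow, mul_one]

/-- By the symmetry, the diagonal entries of the square of the involution, which are equal to one,
are weighted sums of the squares of its entries. -/
theorem choose_mul_sq_coeff_rotPoly_le {J B n : ℕ} (hB : B ≤ J) (hn : n ≤ J) {c s : ℝ}
    (hcs : c ^ 2 + s ^ 2 = 1) (hc : c ≠ 0) :
    (J.choose B : ℝ) * (rotPoly J B c s).coeff n ^ 2 ≤ J.choose n := by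
  have h := congrArg (fun p => coeff p B) (sum_coeff_rotPoly_mul hB hcs hc)
  simp only [finsetSum_coeff, coeff_C_mul, coeff_X_pow, if_true] at h
  have hpos : ∀ m ≤ J, (0 : ℝ) < J.choose m := fun m hm => by exact_mod_cast Nat.choose_pos hm
  have hterm : ∀ m ∈ Finset.range (J + 1), (rotPoly J B c s).coeff m * (rotPoly J m c s).coeff B =
      (J.choose B : ℝ) * (rotPoly J B c s).coeff m ^ 2 / J.choose m := by
    intro m hm
    have hm' : m ≤ J := by rw [Finset.mem_range] at hm; omega
    rw [eq_div_iff (hpos m hm').ne']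
    linear_combination -(rotPoly J B c s).coeff m * choose_mul_coeff_rotPoly hB hm' c s
  rw [Finset.sum_congr rfl hterm] at h
  have hle := Finset.single_le_sum (f := fun m =>
    (J.choose B : ℝ) * (rotPoly J B c s).coeff m ^ 2 / J.choose m) (s := Finset.range (J + 1))
    (fun m _ => by positivity) (Finset.mem_range.mpr (Nat.lt_succ_of_le hn))
  rw [h] at hle
  simpa using (div_le_iff₀ (hpos n hn)).mp hle

/-- The coefficients of `rotPoly` are the Jacobi polynomials, up to a factor. Powers of `s` and `c`
are kept on both sides to avoid negative exponents. -/
theorem coeff_rotPoly_eq {J B n : ℕ} (hB : B ≤ J) {c s : ℝ} (hcs : c ^ 2 + s ^ 2 = 1) :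
    s ^ n * c ^ n * (rotPoly J B c s).coeff n =
      (-1) ^ (J - B + n) *
        (s ^ (J - B) * c ^ B * (jacobiPoly n (J - B) B).eval (c ^ 2 - s ^ 2)) := by
  rw [coeff_rotPoly, jacobiPoly, eval_finsetSum, Finset.mul_sum, Finset.mul_sum, Finset.mul_sum]
  refine Finset.sum_congr rfl fun k hk => ?_
  rw [Finset.mem_range] at hk
  simp only [eval_mul, eval_C, eval_pow, eval_sub, eval_X]
  rw [show c ^ 2 - s ^ 2 - 1 = (-1) * 2 * (s * s) by linear_combination hcs,
    show c ^ 2 - s ^ 2 - -1 = 2 * (c * c) by linear_combination -hcs]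
  rcases lt_or_ge B k with h1 | h1
  · simp [Nat.choose_eq_zero_of_lt h1]
  rcases lt_or_ge (J - B) (n - k) with h2 | h2
  · simp [Nat.choose_eq_zero_of_lt h2]
  obtain ⟨p, rfl⟩ := Nat.exists_eq_add_of_le h1
  obtain ⟨m, rfl⟩ := Nat.exists_eq_add_of_le (Nat.lt_succ_iff.mp hk)
  rw [Nat.add_sub_cancel_left] at h2 ⊢
  obtain ⟨r, hr⟩ := Nat.exists_eq_add_of_le h2
  rw [hr, Nat.add_sub_cancel_left, Nat.add_sub_cancel_left]
  have hm1 : ((-1 : ℝ) ^ m) * (-1) ^ m = 1 := by rw [← mul_pow]; norm_num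
  have hk1 : ((-1 : ℝ) ^ k) * (-1) ^ k = 1 := by rw [← mul_pow]; norm_num
  have e1 : (-1 : ℝ) ^ (m + r + (k + m)) * (-1) ^ k = (-1) ^ r := by
    rw [pow_add, pow_add, pow_add]
    linear_combination ((-1) ^ r * (-1) ^ k * (-1) ^ k) * hm1 + (-1) ^ r * hk1
  rw [neg_pow s, mul_pow, mul_pow, mul_pow, mul_pow, mul_pow, ← e1]
  simp only [pow_add]
  field_simp

theorem abs_wignerSmallD_le_one {J a b : ℕ} (ha : a ≤ J) (hb : b ≤ J) {θ : ℝ} (h0 : 0 < θ)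
    (hπ : θ < Real.pi) : |wignerSmallD J a b θ| ≤ 1 := by
  have hs : 0 < Real.sin (θ / 2) := Real.sin_pos_of_pos_of_lt_pi (by linarith) (by linarith)
  have hc : 0 < Real.cos (θ / 2) := Real.cos_pos_of_mem_Ioo ⟨by linarith, by linarith⟩
  have hcs : Real.cos (θ / 2) ^ 2 + Real.sin (θ / 2) ^ 2 = 1 := Real.cos_sq_add_sin_sq _
  have hcos : Real.cos θ = Real.cos (θ / 2) ^ 2 - Real.sin (θ / 2) ^ 2 := by
    rw [← Real.cos_two_mul']; congr 1; ring
  have hn : J - b ≤ J := Nat.sub_le _ _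
  have hle := choose_mul_sq_coeff_rotPoly_le ha hn hcs hc.ne'
  have heq := coeff_rotPoly_eq (n := J - b) ha hcs
  rw [← hcos] at heq
  set c := Real.cos (θ / 2)
  set s := Real.sin (θ / 2)
  have hv : (1 - Real.cos θ) / 2 = s ^ 2 := by rw [hcos]; linear_combination (1 / 2) * -hcs
  have hw : (1 + Real.cos θ) / 2 = c ^ 2 := by rw [hcos]; linear_combination (1 / 2) * -hcs
  rw [wignerSmallD_eq ha hb, hv, hw]
  set P := (jacobiPoly (J - b) (J - a) a).eval (Real.cos θ)
  set K := (rotPoly J a c s).coeff (J - b)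
  have ev : (s ^ 2) ^ (((b : ℝ) - a) / 2) = s ^ (J - a) / s ^ (J - b) := by
    rw [← Real.rpow_natCast, ← Real.rpow_natCast, ← Real.rpow_natCast, ← Real.rpow_sub hs,
      ← Real.rpow_mul hs.le]
    congr 1
    push_cast [Nat.cast_sub ha, Nat.cast_sub hb]
    ring
  have ew : (c ^ 2) ^ (((a : ℝ) + b - J) / 2) = c ^ a / c ^ (J - b) := by
    rw [← Real.rpow_natCast, ← Real.rpow_natCast, ← Real.rpow_natCast, ← Real.rpow_sub hc,
      ← Real.rpow_mul hc.le]
    congr 1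
    push_cast [Nat.cast_sub ha, Nat.cast_sub hb]
    ring
  rw [ev, ew]
  have hK : K ^ 2 = (s ^ (J - a) / s ^ (J - b) * (c ^ a / c ^ (J - b)) * P) ^ 2 := by
    have hsg : ((-1 : ℝ) ^ (J - a + (J - b))) ^ 2 = 1 := by
      rw [← pow_mul, mul_comm, pow_mul]; norm_num
    have : K = (-1) ^ (J - a + (J - b)) *
        (s ^ (J - a) / s ^ (J - b) * (c ^ a / c ^ (J - b)) * P) := by
      have h1 : s ^ (J - b) ≠ 0 := (pow_pos hs _).ne'
      have h2 : c ^ (J - b) ≠ 0 := (pow_pos hc _).ne'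
      apply mul_left_cancel₀ (mul_ne_zero h1 h2)
      rw [heq]
      field_simp
    rw [this, mul_pow, hsg, one_mul]
  rw [← sq_le_one_iff_abs_le_one]
  have hconst : wignerConst J a b ^ 2 * J.choose (J - b) = J.choose a := by
    have h1 := Nat.choose_mul_factorial_mul_factorial ha
    have h2 := Nat.choose_mul_factorial_mul_factorial hb
    have h1' : (J.choose a : ℝ) * a.factorial * (J - a).factorial = J.factorial := by
      exact_mod_cast h1
    have h2' : (J.choose b : ℝ) * b.factorial * (J - b).factorial = J.factorial := by
      exact_mod_cast h2
    rw [wignerConst_sq, Nat.choose_symm hb, div_mul_eq_mul_div, div_eq_iff (by positivity)]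
    linear_combination h2' - h1'
  have hpos : (0 : ℝ) < J.choose (J - b) := by exact_mod_cast Nat.choose_pos hn
  have e : (wignerConst J a b * (s ^ (J - a) / s ^ (J - b)) * (c ^ a / c ^ (J - b)) * P) ^ 2 =
      wignerConst J a b ^ 2 * K ^ 2 := by rw [hK]; ring
  rw [e]
  rw [← hconst] at hle
  exact le_of_mul_le_mul_right (by linarith) hpos

/-! ### The Legendre differential equation in Liouville normal form -/

theorem jacobiWeight_self (n : ℕ) : jacobiWeight n n = C ((-1) ^ n) * (X ^ 2 - 1) ^ n := by
  rw [jacobiWeight, ← mul_pow, C_pow, ← mul_pow]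
  congr 1
  simp
  ring

theorem legendre_eq_iterate_derivative_jacobiWeight (n : ℕ) : legendre n =
    C (1 / (2 ^ n * (n.factorial : ℝ)) * (-1) ^ n) * derivative^[n] (jacobiWeight n n) := by
  have h : ((-1 : ℝ) ^ n) * (-1) ^ n = 1 := by rw [← mul_pow]; norm_num
  rw [jacobiWeight_self, iterate_derivative_C_mul, ← mul_assoc, ← C_mul,
    mul_assoc _ _ ((-1 : ℝ) ^ n), h, mul_one, legendre]

theorem legendre_ode (n : ℕ) (x : ℝ) :
    (1 - x ^ 2) * (derivative (derivative (legendre n))).eval x -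
      2 * x * (derivative (legendre n)).eval x + n * (n + 1) * (legendre n).eval x = 0 := by
  have h := eval_jacobi_ode n n n x
  rw [legendre_eq_iterate_derivative_jacobiWeight]
  simp only [derivative_C_mul, eval_C_mul]
  linear_combination (1 / (2 ^ n * (n.factorial : ℝ)) * (-1) ^ n) * h

/-- The Liouville normal form `√(sin θ) P_n(cos θ)` of the Legendre polynomial. -/
noncomputable def legendreU (n : ℕ) (θ : ℝ) : ℝ := √(Real.sin θ) * (legendre n).eval (Real.cos θ)

/-- The derivative of `legendreU` on `(0, π)`. -/
noncomputable def legendreU' (n : ℕ) (θ : ℝ) : ℝ :=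
  Real.cos θ / (2 * √(Real.sin θ)) * (legendre n).eval (Real.cos θ) -
    √(Real.sin θ) * Real.sin θ * (derivative (legendre n)).eval (Real.cos θ)

/-- The coefficient in the equation `u'' + Φ u = 0` satisfied by `legendreU`. -/
noncomputable def legendrePhi (n : ℕ) (θ : ℝ) : ℝ :=
  ((n : ℝ) + 1 / 2) ^ 2 + 1 / (4 * Real.sin θ ^ 2)

theorem hasDerivAt_legendreU (n : ℕ) {θ : ℝ} (hθ : θ ∈ Set.Ioo 0 Real.pi) :
    HasDerivAt (legendreU n) (legendreU' n θ) θ := by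
  have hs := Real.sin_pos_of_pos_of_lt_pi hθ.1 hθ.2
  have h1 := (Real.hasDerivAt_sin θ).sqrt hs.ne'
  have h2 : HasDerivAt (fun t => (legendre n).eval (Real.cos t))
      ((derivative (legendre n)).eval (Real.cos θ) * (-Real.sin θ)) θ :=
    ((legendre n).hasDerivAt _).comp θ (Real.hasDerivAt_cos θ)
  refine (h1.mul h2).congr_deriv ?_
  rw [legendreU']
  ring

theorem hasDerivAt_legendreU' (n : ℕ) {θ : ℝ} (hθ : θ ∈ Set.Ioo 0 Real.pi) :
    HasDerivAt (legendreU' n) (-(legendrePhi n θ * legendreU n θ)) θ := by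
  have hs := Real.sin_pos_of_pos_of_lt_pi hθ.1 hθ.2
  have hr : 0 < √(Real.sin θ) := Real.sqrt_pos.mpr hs
  have hrs : √(Real.sin θ) ^ 2 = Real.sin θ := Real.sq_sqrt hs.le
  have h1 := (Real.hasDerivAt_sin θ).sqrt hs.ne'
  have h2 : HasDerivAt (fun t => (legendre n).eval (Real.cos t))
      ((derivative (legendre n)).eval (Real.cos θ) * (-Real.sin θ)) θ :=
    ((legendre n).hasDerivAt _).comp θ (Real.hasDerivAt_cos θ)
  have h3 : HasDerivAt (fun t => (derivative (legendre n)).eval (Real.cos t))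
      ((derivative (derivative (legendre n))).eval (Real.cos θ) * (-Real.sin θ)) θ :=
    ((derivative (legendre n)).hasDerivAt _).comp θ (Real.hasDerivAt_cos θ)
  have h4 := (((Real.hasDerivAt_cos θ).div (h1.const_mul 2) (by positivity)).mul h2).sub
    ((h1.mul (Real.hasDerivAt_sin θ)).mul h3)
  refine h4.congr_deriv ?_
  have hode := legendre_ode n (Real.cos θ)
  have hsq : Real.cos θ ^ 2 = 1 - Real.sin θ ^ 2 := by linarith [Real.sin_sq_add_cos_sq θ]
  rw [hsq] at hode
  rw [legendrePhi, legendreU]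
  simp only [Pi.mul_apply, Pi.div_apply]
  set P := (legendre n).eval (Real.cos θ)
  set P' := (derivative (legendre n)).eval (Real.cos θ)
  set P'' := (derivative (derivative (legendre n))).eval (Real.cos θ)
  set r := √(Real.sin θ)
  set c := Real.cos θ
  rw [← hrs] at hode hsq ⊢
  field_simp
  linear_combination (16 * r ^ 4) * hode - 4 * P * hsq

theorem legendrePhi_pos (n : ℕ) (θ : ℝ) : 0 < legendrePhi n θ := by
  rw [legendrePhi]; positivity

theorem hasDerivAt_legendrePhi (n : ℕ) {θ : ℝ} (hθ : θ ∈ Set.Ioo 0 Real.pi) :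
    HasDerivAt (legendrePhi n) (-Real.cos θ / (2 * Real.sin θ ^ 3)) θ := by
  have hs := Real.sin_pos_of_pos_of_lt_pi hθ.1 hθ.2
  have h1 := (((Real.hasDerivAt_sin θ).pow 2).const_mul 4).inv (by simp; positivity)
  have h2 : HasDerivAt (fun t => ((n : ℝ) + 1 / 2) ^ 2 + (4 * Real.sin t ^ 2)⁻¹) _ θ :=
    h1.const_add (((n : ℝ) + 1 / 2) ^ 2)
  have e : legendrePhi n = fun t => ((n : ℝ) + 1 / 2) ^ 2 + (4 * Real.sin t ^ 2)⁻¹ := by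
    funext t; rw [legendrePhi, one_div (4 * _)]
  rw [e]
  refine h2.congr_deriv ?_
  simp
  field_simp
  ring

/-! ### Monotone energies and bounds for the Gaussian weights -/

/-- The energy `Φ u² + u'²`, which is smallest at `θ = π / 2`. -/
noncomputable def legendreEnergy (n : ℕ) (θ : ℝ) : ℝ :=
  legendrePhi n θ * legendreU n θ ^ 2 + legendreU' n θ ^ 2

theorem hasDerivAt_legendreEnergy (n : ℕ) {θ : ℝ} (hθ : θ ∈ Set.Ioo 0 Real.pi) :
    HasDerivAt (legendreEnergy n)
      (-Real.cos θ / (2 * Real.sin θ ^ 3) * legendreU n θ ^ 2) θ := by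
  have h := ((hasDerivAt_legendrePhi n hθ).mul ((hasDerivAt_legendreU n hθ).pow 2)).add
    ((hasDerivAt_legendreU' n hθ).pow 2)
  refine h.congr_deriv ?_
  simp
  ring

theorem hasDerivAt_legendreEnergy_div (n : ℕ) {θ : ℝ} (hθ : θ ∈ Set.Ioo 0 Real.pi) :
    HasDerivAt (fun t => legendreEnergy n t / legendrePhi n t)
      (Real.cos θ / (2 * Real.sin θ ^ 3) * legendreU' n θ ^ 2 / legendrePhi n θ ^ 2) θ := by
  have hs := Real.sin_pos_of_pos_of_lt_pi hθ.1 hθ.2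
  have h := (hasDerivAt_legendreEnergy n hθ).div (hasDerivAt_legendrePhi n hθ)
    (legendrePhi_pos n θ).ne'
  refine h.congr_deriv ?_
  congr 1
  rw [legendreEnergy]
  ring

/-- A function on `(0, π)` whose derivative has the sign of `-cos` is smallest at `π / 2`. -/
theorem le_of_hasDerivAt_cos_mul {f g : ℝ → ℝ}
    (hf : ∀ θ ∈ Set.Ioo 0 Real.pi, HasDerivAt f (-Real.cos θ * g θ) θ)
    (hg : ∀ θ ∈ Set.Ioo 0 Real.pi, 0 ≤ g θ) {θ : ℝ} (hθ : θ ∈ Set.Ioo 0 Real.pi) :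
    f (Real.pi / 2) ≤ f θ := by
  have hpi := Real.pi_pos
  rcases le_total θ (Real.pi / 2) with h | h
  · have hsub : Set.Icc θ (Real.pi / 2) ⊆ Set.Ioo 0 Real.pi := fun t ht =>
      ⟨by linarith [hθ.1, ht.1], by linarith [ht.2]⟩
    refine antitoneOn_of_deriv_nonpos (convex_Icc θ (Real.pi / 2))
      (fun t ht => (hf t (hsub ht)).continuousAt.continuousWithinAt)
      (fun t ht => (hf t (hsub (interior_subset ht))).differentiableAt.differentiableWithinAt)
      (fun t ht => ?_) (Set.left_mem_Icc.mpr h) (Set.right_mem_Icc.mpr h) h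
    have ht' := interior_subset ht
    rw [(hf t (hsub ht')).deriv]
    have hc : 0 ≤ Real.cos t := Real.cos_nonneg_of_mem_Icc ⟨by linarith [(hsub ht').1], ht'.2⟩
    have := mul_nonneg hc (hg t (hsub ht'))
    linarith
  · have hsub : Set.Icc (Real.pi / 2) θ ⊆ Set.Ioo 0 Real.pi := fun t ht =>
      ⟨by linarith [ht.1], by linarith [hθ.2, ht.2]⟩
    refine monotoneOn_of_deriv_nonneg (convex_Icc (Real.pi / 2) θ)
      (fun t ht => (hf t (hsub ht)).continuousAt.continuousWithinAt)
      (fun t ht => (hf t (hsub (interior_subset ht))).differentiableAt.differentiableWithinAt)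
      (fun t ht => ?_) (Set.left_mem_Icc.mpr h) (Set.right_mem_Icc.mpr h) h
    have ht' := interior_subset ht
    rw [(hf t (hsub ht')).deriv]
    have hc : Real.cos t ≤ 0 := Real.cos_nonpos_of_pi_div_two_le_of_le ht'.1
      (by linarith [(hsub ht').2])
    have := mul_nonneg (neg_nonneg.mpr hc) (hg t (hsub ht'))
    linarith

/-- The derivative of the energy is `Φ' u²`. -/
theorem legendreEnergy_pi_div_two_le (n : ℕ) {θ : ℝ} (hθ : θ ∈ Set.Ioo 0 Real.pi) :
    legendreEnergy n (Real.pi / 2) ≤ legendreEnergy n θ :=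
  le_of_hasDerivAt_cos_mul (g := fun t => 1 / (2 * Real.sin t ^ 3) * legendreU n t ^ 2)
    (fun t ht => (hasDerivAt_legendreEnergy n ht).congr_deriv (by ring))
    (fun t ht => by
      have := Real.sin_pos_of_pos_of_lt_pi ht.1 ht.2
      positivity) hθ

/-- The derivative of the energy divided by `Φ` is `-Φ' u'² / Φ²`. -/
theorem legendreEnergy_div_le (n : ℕ) {θ : ℝ} (hθ : θ ∈ Set.Ioo 0 Real.pi) :
    legendreEnergy n θ / legendrePhi n θ ≤
      legendreEnergy n (Real.pi / 2) / legendrePhi n (Real.pi / 2) := by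
  have h := le_of_hasDerivAt_cos_mul (f := fun t => -(legendreEnergy n t / legendrePhi n t))
    (g := fun t => 1 / (2 * Real.sin t ^ 3) * legendreU' n t ^ 2 / legendrePhi n t ^ 2)
    (fun t ht => (hasDerivAt_legendreEnergy_div n ht).neg.congr_deriv (by ring))
    (fun t ht => by
      have := Real.sin_pos_of_pos_of_lt_pi ht.1 ht.2
      positivity) hθ
  exact neg_le_neg_iff.mp h

theorem coeff_sq_sub_one_pow (n k : ℕ) : ((X ^ 2 - 1 : ℝ[X]) ^ n).coeff k =
    if 2 ∣ k then (-1) ^ (n - k / 2) * (n.choose (k / 2) : ℝ) else 0 := by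
  have h : (X ^ 2 - 1 : ℝ[X]) ^ n = expand ℝ 2 ((X + C (-1)) ^ n) := by
    simp [sub_eq_add_neg]
  rw [h, coeff_expand (by norm_num), coeff_X_add_C_pow]

theorem legendreEnergy_pi_div_two_eq (n : ℕ) : legendreEnergy n (Real.pi / 2) =
    ((n : ℝ) ^ 2 + n + 1 / 2) * (legendre n).coeff 0 ^ 2 + (legendre n).coeff 1 ^ 2 := by
  have h1 : (derivative (legendre n)).eval 0 = (legendre n).coeff 1 := by
    rw [← coeff_zero_eq_eval_zero, coeff_derivative]; simp
  rw [legendreEnergy, legendrePhi, legendreU, legendreU', Real.sin_pi_div_two, Real.cos_pi_div_two,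
    h1, ← coeff_zero_eq_eval_zero]
  simp
  left
  ring

theorem coeff_zero_legendre (n : ℕ) :
    (legendre n).coeff 0 = ((X ^ 2 - 1 : ℝ[X]) ^ n).coeff n / 2 ^ n := by
  rw [coeff_legendre, zero_add, Nat.descFactorial_self]
  have : (n.factorial : ℝ) ≠ 0 := by positivity
  field_simp

theorem coeff_one_legendre (n : ℕ) :
    (legendre n).coeff 1 = (n + 1) * ((X ^ 2 - 1 : ℝ[X]) ^ n).coeff (n + 1) / 2 ^ n := by
  have h : (n + 1).descFactorial n = (n + 1) * n.factorial := by
    have := Nat.factorial_mul_descFactorial (Nat.le_succ n)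
    rw [Nat.succ_eq_add_one, Nat.add_sub_cancel_left, Nat.factorial_one, one_mul] at this
    rw [this, Nat.factorial_succ]
  rw [coeff_legendre, add_comm 1 n, h]
  have : (n.factorial : ℝ) ≠ 0 := by positivity
  push_cast
  field_simp

/-- The Wallis product in terms of central binomial coefficients. -/
theorem wallis_mul_choose_sq (m : ℕ) :
    Real.Wallis.W m * (2 * m + 1) * ((2 * m).choose m / 4 ^ m : ℝ) ^ 2 = 1 := by
  have h : ((2 * m).choose m : ℝ) * m.factorial * m.factorial = (2 * m).factorial := by
    have := Nat.choose_mul_factorial_mul_factorial (show m ≤ 2 * m by omega)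
    rw [show 2 * m - m = m by omega] at this
    exact_mod_cast this
  have hc : ((2 * m).choose m : ℝ) ≠ 0 := by
    have := Nat.choose_pos (show m ≤ 2 * m by omega)
    positivity
  have h4 : (2 : ℝ) ^ (4 * m) = (4 ^ m) ^ 2 := by
    rw [← pow_mul, mul_comm m 2, pow_mul, pow_mul]; norm_num
  rw [Real.Wallis.W_eq_factorial_ratio, ← h, h4]
  have hm : (m.factorial : ℝ) ≠ 0 := by positivity
  field_simp

theorem legendreEnergy_even (m : ℕ) : legendreEnergy (2 * m) (Real.pi / 2) *
    (Real.Wallis.W m * (2 * m + 1)) = (2 * m : ℝ) ^ 2 + 2 * m + 1 / 2 := by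
  have hsg : (((-1 : ℝ)) ^ (2 * m - m)) ^ 2 = 1 := by rw [← pow_mul, mul_comm, pow_mul]; norm_num
  have h1 : (legendre (2 * m)).coeff 1 = 0 := by
    rw [coeff_one_legendre, coeff_sq_sub_one_pow, if_neg (by omega)]; simp
  have h0 : (legendre (2 * m)).coeff 0 ^ 2 = ((2 * m).choose m / 4 ^ m : ℝ) ^ 2 := by
    rw [coeff_zero_legendre, coeff_sq_sub_one_pow, if_pos (dvd_mul_right _ _),
      Nat.mul_div_cancel_left _ (by norm_num), pow_mul, show (2 : ℝ) ^ 2 = 4 by norm_num,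
      mul_div_assoc, mul_pow, hsg, one_mul]
  rw [legendreEnergy_pi_div_two_eq, h1, h0]
  push_cast
  linear_combination ((2 * m : ℝ) ^ 2 + 2 * m + 1 / 2) * wallis_mul_choose_sq m

theorem legendreEnergy_odd (m : ℕ) : legendreEnergy (2 * m + 1) (Real.pi / 2) *
    (Real.Wallis.W (m + 1) * (2 * m + 3)) = (2 * m + 2 : ℝ) ^ 2 := by
  have hsg : (((-1 : ℝ)) ^ (2 * m + 1 - (m + 1))) ^ 2 = 1 := by
    rw [← pow_mul, mul_comm, pow_mul]; norm_num
  have h0 : (legendre (2 * m + 1)).coeff 0 = 0 := by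
    rw [coeff_zero_legendre, coeff_sq_sub_one_pow, if_neg (by omega)]; simp
  have hch : ((2 * (m + 1)).choose (m + 1) : ℝ) = 2 * (2 * m + 1).choose (m + 1) := by
    have h : (2 * (m + 1)).choose (m + 1) = 2 * (2 * m + 1).choose (m + 1) := by
      rw [show 2 * (m + 1) = (2 * m + 1) + 1 by ring, Nat.choose_succ_succ',
        ← Nat.choose_symm_half m]
      ring
    exact_mod_cast h
  have h1 : (legendre (2 * m + 1)).coeff 1 ^ 2 =
      (2 * m + 2) ^ 2 * ((2 * (m + 1)).choose (m + 1) / 4 ^ (m + 1) : ℝ) ^ 2 := by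
    rw [coeff_one_legendre, coeff_sq_sub_one_pow, if_pos (by omega),
      show (2 * m + 1 + 1) / 2 = m + 1 by omega, hch, div_pow, mul_pow, mul_pow, hsg]
    rw [show ((4 : ℝ)) ^ (m + 1) = 2 * 2 ^ (2 * m + 1) by
      rw [show (4 : ℝ) = 2 ^ 2 by norm_num, ← pow_mul]; ring]
    push_cast
    field_simp
    ring
  have hw := wallis_mul_choose_sq (m + 1)
  rw [legendreEnergy_pi_div_two_eq, h1, h0]
  push_cast at hw ⊢
  linear_combination ((2 * m + 2 : ℝ) ^ 2) * hw

/-- The energy at `π / 2` is asymptotically `2 n / π`, by the bounds for Wallis' product. -/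
theorem legendreEnergy_pi_div_two_bounds (n : ℕ) :
    2 / Real.pi * n ≤ legendreEnergy n (Real.pi / 2) ∧
      legendreEnergy n (Real.pi / 2) ≤ 2 / Real.pi * (n + 3) := by
  have hpi := Real.pi_pos
  -- `F * (W * b) = a` is the form of the energy for both parities of `n`
  have aux : ∀ {F W a b N : ℝ}, F * (W * b) = a → 0 < W → 0 < b → 0 ≤ N → W ≤ Real.pi / 2 →
      b / (b + 1) * (Real.pi / 2) ≤ W → N * b ≤ a → a * (b + 1) ≤ (N + 3) * b ^ 2 →
      2 / Real.pi * N ≤ F ∧ F ≤ 2 / Real.pi * (N + 3) := by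
    intro F W a b N hF hW hb hN hW1 hW2 ha1 ha2
    have hFeq : F = a / (W * b) := by rw [eq_div_iff (by positivity)]; exact hF
    constructor
    · rw [hFeq, le_div_iff₀ (by positivity)]
      calc 2 / Real.pi * N * (W * b) ≤ 2 / Real.pi * N * (Real.pi / 2 * b) := by gcongr
        _ = N * b := by field_simp
        _ ≤ a := ha1
    · rw [hFeq, div_le_iff₀ (by positivity)]
      have h1 : a ≤ (N + 3) * b ^ 2 / (b + 1) := by rw [le_div_iff₀ (by positivity)]; exact ha2
      refine h1.trans ?_
      calc (N + 3) * b ^ 2 / (b + 1)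
          = 2 / Real.pi * (N + 3) * (b / (b + 1) * (Real.pi / 2) * b) := by field_simp
        _ ≤ 2 / Real.pi * (N + 3) * (W * b) := by gcongr
  rcases Nat.even_or_odd' n with ⟨m, rfl | rfl⟩
  · have hm : (0 : ℝ) ≤ m := Nat.cast_nonneg m
    have hlow := Real.Wallis.le_W m
    refine aux (N := ((2 * m : ℕ) : ℝ)) (legendreEnergy_even m) (Real.Wallis.W_pos m)
      (by positivity) (by positivity) (Real.Wallis.W_le m) ?_ ?_ ?_
    · convert hlow using 3; ring
    · push_cast; nlinarith
    · push_cast; nlinarith [mul_nonneg hm hm, mul_nonneg hm (mul_nonneg hm hm)]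
  · have hm : (0 : ℝ) ≤ m := Nat.cast_nonneg m
    have hlow := Real.Wallis.le_W (m + 1)
    refine aux (N := ((2 * m + 1 : ℕ) : ℝ)) (legendreEnergy_odd m) (Real.Wallis.W_pos (m + 1))
      (by positivity) (by positivity) (Real.Wallis.W_le (m + 1)) ?_ ?_ ?_
    · convert hlow using 3 <;> push_cast <;> ring
    · push_cast; nlinarith
    · push_cast; nlinarith [mul_nonneg hm hm, mul_nonneg hm (mul_nonneg hm hm)]

theorem legendreAngle_mem (n : ℕ) (s : Fin n) : legendreAngle n s ∈ Set.Ioo 0 Real.pi := by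
  have h := legendreNode_mem n s
  rw [legendreAngle]
  exact ⟨Real.arccos_pos.mpr h.2, lt_of_le_of_ne (Real.arccos_le_pi _) fun he => by
    have := Real.arccos_eq_pi.mp he
    linarith [h.1]⟩

theorem sin_legendreAngle_pos (n : ℕ) (s : Fin n) : 0 < Real.sin (legendreAngle n s) :=
  Real.sin_pos_of_pos_of_lt_pi (legendreAngle_mem n s).1 (legendreAngle_mem n s).2

theorem legendreU_legendreAngle (n : ℕ) (s : Fin n) : legendreU n (legendreAngle n s) = 0 := by
  rw [legendreU, cos_legendreAngle, eval_legendreNode, mul_zero]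

/-- At a node the energy is `u'² = sin³ θ P_n'(cos θ)²`, which determines the Gaussian weight. -/
theorem gaussWeight_mul_energy (n : ℕ) (s : Fin n) :
    gaussWeight n s * legendreEnergy n (legendreAngle n s) =
      2 * Real.sin (legendreAngle n s) := by
  have h := gaussWeight_mul n s
  have hs := sin_legendreAngle_pos n s
  have hrs : √(Real.sin (legendreAngle n s)) ^ 2 = Real.sin (legendreAngle n s) :=
    Real.sq_sqrt hs.le
  have hsq := Real.sin_sq_add_cos_sq (legendreAngle n s)
  rw [legendreEnergy, legendreU_legendreAngle, legendreU']
  rw [← cos_legendreAngle] at h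
  have h0 : (legendre n).eval (Real.cos (legendreAngle n s)) = 0 := by
    rw [cos_legendreAngle]; exact eval_legendreNode n s
  rw [h0]
  set x := Real.cos (legendreAngle n s)
  set y := Real.sin (legendreAngle n s)
  set P' := (derivative (legendre n)).eval x
  have e : 1 - x ^ 2 = y ^ 2 := by linarith
  rw [e] at h
  linear_combination y * h + (gaussWeight n s * y ^ 2 * P' ^ 2) * hrs

/-- The asymptotic Gaussian weight `π sin θ_s / n`: the cell size of the measure `sin θ dθ`. -/
noncomputable def asympWeight (n : ℕ) (s : Fin n) : ℝ :=
  Real.sin (legendreAngle n s) * (Real.pi / n)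

theorem gaussWeight_le_asympWeight (n : ℕ) (s : Fin n) : gaussWeight n s ≤ asympWeight n s := by
  have hn : (0 : ℝ) < n := Nat.cast_pos.mpr (Nat.pos_of_ne_zero (by rintro rfl; exact s.elim0))
  have hpi := Real.pi_pos
  have hw := gaussWeight_pos n s
  have h1 := (legendreEnergy_pi_div_two_bounds n).1.trans
    (legendreEnergy_pi_div_two_le n (legendreAngle_mem n s))
  have h2 := gaussWeight_mul_energy n s
  have h3 := mul_le_mul_of_nonneg_left h1 hw.le
  rw [h2] at h3
  rw [asympWeight, mul_div_assoc', le_div_iff₀ hn]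
  have e : gaussWeight n s * (2 / Real.pi * n) = gaussWeight n s * n * 2 / Real.pi := by ring
  rw [e, div_le_iff₀ hpi] at h3
  linarith

/-- The Gaussian weights are asymptotically `π sin θ_s / n`, with an error controlled by
`1 / n + 1 / (n sin θ_s)²`. -/
theorem asympWeight_le (n : ℕ) (s : Fin n) : asympWeight n s ≤ gaussWeight n s *
    ((1 + 3 / n) * (1 + 1 / (4 * (n * Real.sin (legendreAngle n s)) ^ 2))) := by
  have hn : (0 : ℝ) < n := Nat.cast_pos.mpr (Nat.pos_of_ne_zero (by rintro rfl; exact s.elim0))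
  have hpi := Real.pi_pos
  have hw := gaussWeight_pos n s
  have hs := sin_legendreAngle_pos n s
  have hE := legendreEnergy_div_le n (legendreAngle_mem n s)
  have hE2 := (legendreEnergy_pi_div_two_bounds n).2
  have h2 := gaussWeight_mul_energy n s
  rw [div_le_iff₀ (legendrePhi_pos _ _), div_mul_eq_mul_div,
    le_div_iff₀ (legendrePhi_pos _ _)] at hE
  set E := legendreEnergy n (legendreAngle n s)
  set E0 := legendreEnergy n (Real.pi / 2)
  set y := Real.sin (legendreAngle n s)
  have hE0 : 0 ≤ E0 := le_trans (by positivity) (legendreEnergy_pi_div_two_bounds n).1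
  have hPhi0 : legendrePhi n (Real.pi / 2) = ((n : ℝ) + 1 / 2) ^ 2 + 1 / 4 := by
    rw [legendrePhi, Real.sin_pi_div_two]; norm_num
  have hPhi : legendrePhi n (legendreAngle n s) ≤
      (((n : ℝ) + 1 / 2) ^ 2 + 1 / 4) * (1 + 1 / (4 * (n * y) ^ 2)) := by
    rw [legendrePhi]
    have e : 1 / (4 * y ^ 2) = (n : ℝ) ^ 2 * (1 / (4 * (n * y) ^ 2)) := by field_simp
    have hz : 0 ≤ 1 / (4 * ((n : ℝ) * y) ^ 2) := by positivity
    change ((n : ℝ) + 1 / 2) ^ 2 + 1 / (4 * y ^ 2) ≤ _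
    rw [e]
    nlinarith
  have hE' : E ≤ E0 * (1 + 1 / (4 * (n * y) ^ 2)) := by
    have hp0 : 0 < legendrePhi n (Real.pi / 2) := legendrePhi_pos _ _
    refine le_of_mul_le_mul_right (hE.trans ?_) hp0
    rw [hPhi0]
    calc E0 * legendrePhi n (legendreAngle n s)
        ≤ E0 * ((((n : ℝ) + 1 / 2) ^ 2 + 1 / 4) * (1 + 1 / (4 * (n * y) ^ 2))) := by gcongr
      _ = _ := by ring
  have hE'' : E ≤ 2 / Real.pi * (n + 3) * (1 + 1 / (4 * (n * y) ^ 2)) :=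
    hE'.trans (by gcongr)
  have e : asympWeight n s = gaussWeight n s * E * (Real.pi / (2 * n)) := by
    rw [asympWeight, h2]; field_simp; rfl
  rw [e]
  calc gaussWeight n s * E * (Real.pi / (2 * n))
      ≤ gaussWeight n s * (2 / Real.pi * (n + 3) * (1 + 1 / (4 * (n * y) ^ 2))) *
          (Real.pi / (2 * n)) := by gcongr
    _ = _ := by field_simp

/-! ### The number of nodes near the poles -/

/-- Sturm comparison: a solution of `f'' = -Φ f` with `Φ > ν²` has no positive arch of length
`π / ν`. -/
theorem not_pos_of_sturm {f f' Φ : ℝ → ℝ} {ν α : ℝ} (hν : 0 < ν)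
    (hf : ∀ t ∈ Set.Icc α (α + Real.pi / ν), HasDerivAt f (f' t) t)
    (hf' : ∀ t ∈ Set.Icc α (α + Real.pi / ν), HasDerivAt f' (-(Φ t * f t)) t)
    (hΦ : ∀ t ∈ Set.Icc α (α + Real.pi / ν), ν ^ 2 < Φ t)
    (hpos : ∀ t ∈ Set.Ioo α (α + Real.pi / ν), 0 < f t) : False := by
  have hpi := Real.pi_pos
  have hlt : α < α + Real.pi / ν := by
    have : 0 < Real.pi / ν := by positivity
    linarith
  have hcont : ContinuousOn f (Set.Icc α (α + Real.pi / ν)) := fun t ht =>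
    (hf t ht).continuousAt.continuousWithinAt
  have hnn : ∀ t ∈ Set.Icc α (α + Real.pi / ν), 0 ≤ f t := by
    intro t ht
    rw [← closure_Ioo hlt.ne] at ht hcont
    exact le_on_closure (fun x hx => (hpos x hx).le) continuousOn_const hcont ht
  have hsin : ∀ t, HasDerivAt (fun t => Real.sin (ν * (t - α))) (Real.cos (ν * (t - α)) * ν) t := by
    intro t
    have h := (((hasDerivAt_id t).sub_const α).const_mul ν).sin
    simpa using h
  have hcos : ∀ t, HasDerivAt (fun t => Real.cos (ν * (t - α)))
      (-Real.sin (ν * (t - α)) * ν) t := by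
    intro t
    have h := (((hasDerivAt_id t).sub_const α).const_mul ν).cos
    simpa using h
  -- the Wronskian of `f` and the comparison solution `sin (ν (t - α))`
  set w : ℝ → ℝ := fun t => f' t * Real.sin (ν * (t - α)) - f t * (ν * Real.cos (ν * (t - α)))
    with hw
  have hderiv : ∀ t ∈ Set.Icc α (α + Real.pi / ν),
      HasDerivAt w (-((Φ t - ν ^ 2) * f t * Real.sin (ν * (t - α)))) t := by
    intro t ht
    have h := ((hf' t ht).mul (hsin t)).sub ((hf t ht).mul ((hcos t).const_mul ν))
    refine h.congr_deriv ?_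
    ring
  have hanti : StrictAntiOn w (Set.Icc α (α + Real.pi / ν)) := by
    refine strictAntiOn_of_deriv_neg (convex_Icc _ _)
      (fun t ht => (hderiv t ht).continuousAt.continuousWithinAt) fun t ht => ?_
    rw [interior_Icc] at ht
    rw [(hderiv t (Set.Ioo_subset_Icc_self ht)).deriv, neg_lt_zero]
    have h1 : 0 < ν * (t - α) := mul_pos hν (by linarith [ht.1])
    have h2 : ν * (t - α) < Real.pi := by
      have : t - α < Real.pi / ν := by linarith [ht.2]
      rwa [lt_div_iff₀ hν, mul_comm] at this
    exact mul_pos (mul_pos (by linarith [hΦ t (Set.Ioo_subset_Icc_self ht)]) (hpos t ht))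
      (Real.sin_pos_of_pos_of_lt_pi h1 h2)
  have h := hanti (Set.left_mem_Icc.mpr hlt.le) (Set.right_mem_Icc.mpr hlt.le) hlt
  have e1 : ν * (α + Real.pi / ν - α) = Real.pi := by field_simp; ring
  simp only [hw, e1, sub_self, mul_zero, Real.sin_zero, Real.cos_zero, Real.sin_pi,
    Real.cos_pi] at h
  have ha := mul_nonneg (hnn α (Set.left_mem_Icc.mpr hlt.le)) hν.le
  have hb := mul_nonneg (hnn _ (Set.right_mem_Icc.mpr hlt.le)) hν.le
  linarith

/-- Every open interval of length `π / (n + 1/2)` in `(0, π)` contains a node. -/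
theorem exists_legendreAngle_mem {n : ℕ} {α : ℝ} (hα : 0 < α)
    (hα' : α + Real.pi / (n + 1 / 2) < Real.pi) :
    ∃ s, legendreAngle n s ∈ Set.Ioo α (α + Real.pi / (n + 1 / 2)) := by
  have hpi := Real.pi_pos
  have hν : (0 : ℝ) < n + 1 / 2 := by positivity
  have hlt : 0 < Real.pi / ((n : ℝ) + 1 / 2) := by positivity
  have hsub : ∀ t ∈ Set.Icc α (α + Real.pi / ((n : ℝ) + 1 / 2)), t ∈ Set.Ioo 0 Real.pi :=
    fun t ht => ⟨by linarith [ht.1], by linarith [ht.2]⟩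
  have hΦ : ∀ t ∈ Set.Icc α (α + Real.pi / ((n : ℝ) + 1 / 2)),
      ((n : ℝ) + 1 / 2) ^ 2 < legendrePhi n t := by
    intro t ht
    have := Real.sin_pos_of_pos_of_lt_pi (hsub t ht).1 (hsub t ht).2
    rw [legendrePhi, lt_add_iff_pos_right]
    positivity
  obtain ⟨t, ht, ht0⟩ : ∃ t ∈ Set.Ioo α (α + Real.pi / ((n : ℝ) + 1 / 2)), legendreU n t = 0 := by
    by_contra! hne
    have hcont : ContinuousOn (legendreU n) (Set.Ioo α (α + Real.pi / ((n : ℝ) + 1 / 2))) :=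
      fun t ht => (hasDerivAt_legendreU n
        (hsub t (Set.Ioo_subset_Icc_self ht))).continuousAt.continuousWithinAt
    have hsign : (∀ t ∈ Set.Ioo α (α + Real.pi / ((n : ℝ) + 1 / 2)), 0 < legendreU n t) ∨
        (∀ t ∈ Set.Ioo α (α + Real.pi / ((n : ℝ) + 1 / 2)), 0 < -legendreU n t) := by
      by_contra! hcon
      obtain ⟨⟨x, hx, hx0⟩, ⟨y, hy, hy0⟩⟩ := hcon
      obtain ⟨z, hz, hz0⟩ := isPreconnected_Ioo.intermediate_value hx hy hcont
        (show (0 : ℝ) ∈ Set.Icc _ _ from ⟨hx0, by linarith⟩)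
      exact hne z hz hz0
    rcases hsign with h | h
    · exact not_pos_of_sturm hν (fun t ht => hasDerivAt_legendreU n (hsub t ht))
        (fun t ht => hasDerivAt_legendreU' n (hsub t ht)) hΦ h
    · exact not_pos_of_sturm (f := fun t => -legendreU n t) (f' := fun t => -legendreU' n t) hν
        (fun t ht => (hasDerivAt_legendreU n (hsub t ht)).neg)
        (fun t ht => (hasDerivAt_legendreU' n (hsub t ht)).neg.congr_deriv (by ring)) hΦ h
  have hmem := hsub t (Set.Ioo_subset_Icc_self ht)
  have hs := Real.sin_pos_of_pos_of_lt_pi hmem.1 hmem.2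
  have hP : (legendre n).eval (Real.cos t) = 0 :=
    (mul_eq_zero.mp ht0).resolve_left (Real.sqrt_pos.mpr hs).ne'
  obtain ⟨s, hs⟩ := exists_legendreNode_eq hP
  refine ⟨s, ?_⟩
  rwa [legendreAngle, hs, Real.arccos_cos hmem.1.le hmem.2.le]

open Classical in
/-- All but few of the `n` nodes lie away from the poles, because each interval of length
`π / (n + 1/2)` contains one. -/
theorem card_legendreAngle_near_poles_le (n : ℕ) {ρ : ℝ} (hρ : 0 < ρ) :
    ((Finset.univ.filter fun s : Fin n =>
      ¬ (ρ ≤ legendreAngle n s ∧ legendreAngle n s ≤ Real.pi - ρ)).card : ℝ) ≤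
      1 + ρ * (n + 1 / 2) := by
  have hpi := Real.pi_pos
  have hν : (0 : ℝ) < n + 1 / 2 := by positivity
  set g : ℝ := Real.pi / (n + 1 / 2) with hg
  have hgpos : 0 < g := by positivity
  set k : ℕ := ⌊(Real.pi - 2 * ρ) / g⌋₊ with hk
  rcases lt_or_ge Real.pi (2 * ρ) with hbig | hsmall
  · have h1 : ((Finset.univ.filter fun s : Fin n =>
      ¬ (ρ ≤ legendreAngle n s ∧ legendreAngle n s ≤ Real.pi - ρ)).card : ℝ) ≤ n := by
      have := Finset.card_filter_le (Finset.univ : Finset (Fin n)) (fun s : Fin n =>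
        ¬ (ρ ≤ legendreAngle n s ∧ legendreAngle n s ≤ Real.pi - ρ))
      rw [Finset.card_univ, Fintype.card_fin] at this
      exact_mod_cast this
    have h2 : 1 < ρ := by linarith [Real.pi_gt_three]
    nlinarith
  have hkle : (k : ℝ) * g ≤ Real.pi - 2 * ρ := by
    have := Nat.floor_le (show 0 ≤ (Real.pi - 2 * ρ) / g from div_nonneg (by linarith) hgpos.le)
    rwa [le_div_iff₀ hgpos] at this
  -- `k` disjoint intervals fit between the cut-offs, and each contains a node
  have hex : ∀ i : Fin k, ∃ s, legendreAngle n s ∈ Set.Ioo (ρ + i * g) (ρ + i * g + g) := by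
    intro i
    have hi : ((i : ℕ) : ℝ) + 1 ≤ k := by exact_mod_cast i.2
    refine exists_legendreAngle_mem (by positivity) ?_
    change ρ + i * g + g < Real.pi
    nlinarith
  choose f hf using hex
  have hinj : Function.Injective f := by
    have key : ∀ i j : Fin k, f i = f j → ¬ i < j := by
      intro i j hij hlt
      have h1 := (hf i).2
      have h2 := (hf j).1
      rw [hij] at h1
      have : ((i : ℕ) : ℝ) + 1 ≤ (j : ℕ) := by exact_mod_cast hlt
      nlinarith
    intro i j hij
    exact le_antisymm (not_lt.mp (key j i hij.symm)) (not_lt.mp (key i j hij))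
  have hcard : k ≤ (Finset.univ.filter fun s : Fin n =>
      ρ ≤ legendreAngle n s ∧ legendreAngle n s ≤ Real.pi - ρ).card := by
    have := Finset.card_le_card_of_injOn (s := (Finset.univ : Finset (Fin k)))
      (t := Finset.univ.filter fun s : Fin n =>
        ρ ≤ legendreAngle n s ∧ legendreAngle n s ≤ Real.pi - ρ) f (fun i _ => ?_)
      hinj.injOn
    · simpa using this
    · have hi : ((i : ℕ) : ℝ) + 1 ≤ k := by exact_mod_cast i.2
      have h1 := (hf i).1
      have h2 := (hf i).2
      simp only [Finset.coe_filter, Finset.mem_univ, true_and, Set.mem_ofPred_eq]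
      have h0 : 0 ≤ ((i : ℕ) : ℝ) * g := by positivity
      constructor
      · linarith
      · nlinarith
  have hsplit := Finset.card_filter_add_card_filter_not (s := (Finset.univ : Finset (Fin n)))
    (fun s : Fin n => ρ ≤ legendreAngle n s ∧ legendreAngle n s ≤ Real.pi - ρ)
  rw [Finset.card_univ, Fintype.card_fin] at hsplit
  have hsplit' : ((Finset.univ.filter fun s : Fin n =>
      ρ ≤ legendreAngle n s ∧ legendreAngle n s ≤ Real.pi - ρ).card : ℝ) +
      (Finset.univ.filter fun s : Fin n =>
      ¬ (ρ ≤ legendreAngle n s ∧ legendreAngle n s ≤ Real.pi - ρ)).card = n := by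
    exact_mod_cast hsplit
  have hcard' : (k : ℝ) ≤ (Finset.univ.filter fun s : Fin n =>
      ρ ≤ legendreAngle n s ∧ legendreAngle n s ≤ Real.pi - ρ).card := by exact_mod_cast hcard
  have hfl := Nat.lt_floor_add_one ((Real.pi - 2 * ρ) / g)
  rw [← hk] at hfl
  have e : (Real.pi - 2 * ρ) / g = (n + 1 / 2) - 2 * ρ * (n + 1 / 2) / Real.pi := by
    rw [hg]; field_simp
  have h3 : 2 * ρ * (n + 1 / 2) / Real.pi ≤ ρ * (n + 1 / 2) := by
    rw [div_le_iff₀ hpi]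
    nlinarith [Real.pi_gt_three, mul_pos hρ hν]
  linarith

/-! ### Convergence of the columns of `V` -/

/-- The relative error bound for the asymptotic Gaussian weights at distance at least `ρ` from the
poles. -/
noncomputable def weightError (n : ℕ) (ρ : ℝ) : ℝ :=
  (1 + 3 / n) * (1 + Real.pi ^ 2 / (16 * (n * ρ) ^ 2)) - 1

theorem two_div_pi_mul_le_sin {ρ θ : ℝ} (hρ : 0 ≤ ρ) (h1 : ρ ≤ θ) (h2 : θ ≤ Real.pi - ρ) :
    2 / Real.pi * ρ ≤ Real.sin θ := by
  have hpi := Real.pi_pos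
  have hc : (0 : ℝ) ≤ 2 / Real.pi := by positivity
  rcases le_total θ (Real.pi / 2) with h | h
  · exact (mul_le_mul_of_nonneg_left h1 hc).trans (Real.mul_le_sin (hρ.trans h1) h)
  · rw [← Real.sin_pi_sub]
    exact (mul_le_mul_of_nonneg_left (by linarith) hc).trans
      (Real.mul_le_sin (by linarith) (by linarith))

theorem asympWeight_sub_le {n : ℕ} {s : Fin n} {ρ : ℝ} (hρ : 0 < ρ)
    (h1 : ρ ≤ legendreAngle n s) (h2 : legendreAngle n s ≤ Real.pi - ρ) :
    asympWeight n s - gaussWeight n s ≤ weightError n ρ * gaussWeight n s := by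
  have hn : (0 : ℝ) < n := Nat.cast_pos.mpr (Nat.pos_of_ne_zero (by rintro rfl; exact s.elim0))
  have hpi := Real.pi_pos
  have hw := gaussWeight_pos n s
  have hle := asympWeight_le n s
  have hsin := two_div_pi_mul_le_sin hρ.le h1 h2
  have hfrac : 1 / (4 * (n * Real.sin (legendreAngle n s)) ^ 2) ≤
      Real.pi ^ 2 / (16 * (n * ρ) ^ 2) := by
    calc 1 / (4 * (n * Real.sin (legendreAngle n s)) ^ 2)
        ≤ 1 / (4 * (n * (2 / Real.pi * ρ)) ^ 2) := by gcongr
      _ = Real.pi ^ 2 / (16 * (n * ρ) ^ 2) := by field_simp; norm_num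
  have : gaussWeight n s * ((1 + 3 / n) * (1 + 1 / (4 * (n * Real.sin (legendreAngle n s)) ^ 2)))
      ≤ gaussWeight n s * ((1 + 3 / n) * (1 + Real.pi ^ 2 / (16 * (n * ρ) ^ 2))) := by gcongr
  rw [weightError]
  linarith

theorem asympWeight_nonneg (n : ℕ) (s : Fin n) : 0 ≤ asympWeight n s :=
  (gaussWeight_pos n s).le.trans (gaussWeight_le_asympWeight n s)

theorem norm_wignerD (l : Label Q) (θ φ ψ : ℝ) :
    ‖wignerD l θ φ ψ‖ = |wignerSmallD l.twoJ l.a l.b θ| := by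
  have h : ∀ m t : ℝ, ‖Complex.exp (Complex.I * m * t)‖ = 1 := by
    intro m t
    rw [show Complex.I * (m : ℂ) * t = ((m * t : ℝ) : ℂ) * Complex.I by push_cast; ring]
    exact Complex.norm_exp_ofReal_mul_I _
  rw [wignerD, norm_mul, norm_mul, h, h, Complex.norm_real, Real.norm_eq_abs]
  ring

theorem sqrt_cellVolume (k : Grid Q) :
    √(cellVolume k) = √(asympWeight (nTheta Q) k.1) * (4 * Real.pi / nPhi Q) := by
  have h : cellVolume k = asympWeight (nTheta Q) k.1 * (4 * Real.pi / nPhi Q) ^ 2 := by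
    rw [cellVolume, asympWeight, gridTheta]; ring
  have hpi := Real.pi_pos
  rw [h, Real.sqrt_mul (asympWeight_nonneg _ _), Real.sqrt_sq (by positivity)]

theorem sampledD_eq (l : Label Q) (k : Grid Q) : sampledD l k =
    ((√(asympWeight (nTheta Q) k.1) * (√(l.j + 1 / 2) / nPhi Q) : ℝ) : ℂ) *
      wignerD l (gridTheta k) (gridPhi k) (gridPsi k) := by
  have hpi := Real.pi_pos
  have hN : (0 : ℝ) < nPhi Q := Nat.cast_pos.mpr (nPhi_pos Q)
  rw [sampledD, normalizedD, sqrt_cellVolume, ← mul_assoc, ← Complex.ofReal_mul]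
  congr 2
  field_simp

theorem V_apply_eq (l : Label Q) (k : Grid Q) : V Q k l =
    ((√(gaussWeight (nTheta Q) k.1) * (√(l.j + 1 / 2) / nPhi Q) : ℝ) : ℂ) *
      wignerD l (gridTheta k) (gridPhi k) (gridPsi k) := by
  have hN : (0 : ℝ) < nPhi Q := Nat.cast_pos.mpr (nPhi_pos Q)
  rw [V, of_apply, Real.sqrt_div (gaussWeight_pos _ _).le, Real.sqrt_mul_self hN.le]
  congr 2
  ring

theorem norm_sampledD (l : Label Q) (k : Grid Q) : ‖sampledD l k‖ =
    √(asympWeight (nTheta Q) k.1) * (√(l.j + 1 / 2) / nPhi Q *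
      |wignerSmallD l.twoJ l.a l.b (legendreAngle (nTheta Q) k.1)|) := by
  rw [sampledD_eq, norm_mul, norm_wignerD, Complex.norm_real, Real.norm_of_nonneg (by positivity),
    gridTheta, mul_assoc]

theorem norm_V_sub_sampledD (l : Label Q) (k : Grid Q) : ‖V Q k l - sampledD l k‖ =
    (√(asympWeight (nTheta Q) k.1) - √(gaussWeight (nTheta Q) k.1)) * (√(l.j + 1 / 2) / nPhi Q *
      |wignerSmallD l.twoJ l.a l.b (legendreAngle (nTheta Q) k.1)|) := by
  have hle := sub_nonneg.mpr (Real.sqrt_le_sqrt (gaussWeight_le_asympWeight (nTheta Q) k.1))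
  rw [norm_sub_rev, sampledD_eq, V_apply_eq, ← sub_mul, ← Complex.ofReal_sub, ← sub_mul, norm_mul,
    norm_wignerD, Complex.norm_real, Real.norm_of_nonneg (by positivity), gridTheta, mul_assoc]

/-- The componentwise error is relative, as the Wigner functions on both sides are the same. -/
theorem norm_V_sub_sampledD_le {l : Label Q} {k : Grid Q} {δ : ℝ} (hδ : 0 < δ)
    (h1 : δ ≤ gridTheta k) (h2 : gridTheta k ≤ Real.pi - δ) :
    ‖V Q k l - sampledD l k‖ ≤ weightError (nTheta Q) δ * ‖sampledD l k‖ := by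
  rw [norm_V_sub_sampledD, norm_sampledD, ← mul_assoc (weightError _ _)]
  refine mul_le_mul_of_nonneg_right ?_ (by positivity)
  have hle := asympWeight_sub_le hδ h1 h2
  have hw := gaussWeight_pos (nTheta Q) k.1
  have hwu := gaussWeight_le_asympWeight (nTheta Q) k.1
  set w := gaussWeight (nTheta Q) k.1
  set u := asympWeight (nTheta Q) k.1
  have hu : 0 < √u := Real.sqrt_pos.mpr (hw.trans_le hwu)
  have hη : 0 ≤ weightError (nTheta Q) δ := by
    by_contra hneg
    have := mul_neg_of_neg_of_pos (not_le.mp hneg) hw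
    linarith
  have huu : √u * √u = u := Real.mul_self_sqrt (hw.trans_le hwu).le
  have hww : √w * √w = w := Real.mul_self_sqrt hw.le
  have hsq : √w ≤ √u := Real.sqrt_le_sqrt hwu
  refine le_of_mul_le_mul_right ?_ hu
  have h3 : w ≤ √w * √u := by
    have := mul_le_mul_of_nonneg_left hsq (Real.sqrt_nonneg w)
    rwa [hww] at this
  have h4 := mul_le_mul_of_nonneg_left hwu hη
  nlinarith

/-- The squared distance between a column of `V` and the sampled eigenfunction, with the poles cut
off at distance `ρ`: away from the poles the Gaussian weights are close to their asymptotic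
values, and near the poles there are few nodes, of small weight. -/
theorem sum_norm_V_sub_sampledD_sq_le (l : Label Q) {ρ : ℝ} (hρ : 0 < ρ) :
    ∑ k : Grid Q, ‖V Q k l - sampledD l k‖ ^ 2 ≤
      weightError (nTheta Q) ρ + Real.pi * ρ * (1 + ρ * (nTheta Q + 1 / 2)) := by
  classical
  have hpi := Real.pi_pos
  have hNφ : (0 : ℝ) < nPhi Q := Nat.cast_pos.mpr (nPhi_pos Q)
  have hn : (0 : ℝ) < nTheta Q := Nat.cast_pos.mpr (Nat.succ_pos _)
  set d : Fin (nTheta Q) → ℝ := fun s => wignerSmallD l.twoJ l.a l.b (legendreAngle (nTheta Q) s)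
    with hd
  set w := gaussWeight (nTheta Q) with hw
  set u := asympWeight (nTheta Q) with hu
  have hj : 0 ≤ l.j + 1 / 2 := by have := l.j_nonneg; linarith
  have hjN : l.j + 1 / 2 ≤ nTheta Q := by
    have h1 := l.twoJ_le
    have h2 : l.twoJ + 1 ≤ 2 * nTheta Q := by rw [nTheta]; omega
    have h3 : (l.twoJ : ℝ) + 1 ≤ 2 * nTheta Q := by exact_mod_cast h2
    rw [Label.j]; linarith
  have e1 : ∑ k : Grid Q, ‖V Q k l - sampledD l k‖ ^ 2 =
      ∑ s, (l.j + 1 / 2) * d s ^ 2 * (√(u s) - √(w s)) ^ 2 := by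
    have : ∀ k : Grid Q, ‖V Q k l - sampledD l k‖ ^ 2 =
        (l.j + 1 / 2) * d k.1 ^ 2 * (√(u k.1) - √(w k.1)) ^ 2 / (nPhi Q) ^ 2 := by
      intro k
      rw [norm_V_sub_sampledD, mul_pow, mul_pow, div_pow, Real.sq_sqrt hj, sq_abs]
      ring
    rw [Finset.sum_congr rfl fun k _ => this k, Fintype.sum_prod_type]
    refine Finset.sum_congr rfl fun s _ => ?_
    simp only [Finset.sum_const, Finset.card_univ, Fintype.card_prod, Fintype.card_fin,
      nsmul_eq_mul]
    push_cast
    field_simp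
  have hnorm : ∑ s, (l.j + 1 / 2) * d s ^ 2 * w s = 1 := by
    have h := sum_gaussWeight_wignerSmallD (N := nTheta Q) l.a_le l.b_le l.a_le l.b_le rfl rfl
      (by have := l.twoJ_le; rw [nTheta]; omega)
    rw [if_pos rfl] at h
    have e : ∑ s, (l.j + 1 / 2) * d s ^ 2 * w s = (l.j + 1 / 2) * ∑ s, w s * (d s * d s) := by
      rw [Finset.mul_sum]
      exact Finset.sum_congr rfl fun s _ => by ring
    rw [e, h, Label.j]
    field_simp
  have hη : 0 ≤ weightError (nTheta Q) ρ := by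
    rw [weightError]
    have h1 : (0 : ℝ) ≤ 3 / nTheta Q := by positivity
    have h2 : (0 : ℝ) ≤ Real.pi ^ 2 / (16 * (nTheta Q * ρ) ^ 2) := by positivity
    nlinarith [mul_nonneg h1 h2]
  have hterm : ∀ s, (l.j + 1 / 2) * d s ^ 2 * (√(u s) - √(w s)) ^ 2 ≤
      weightError (nTheta Q) ρ * ((l.j + 1 / 2) * d s ^ 2 * w s) +
        if ¬ (ρ ≤ legendreAngle (nTheta Q) s ∧ legendreAngle (nTheta Q) s ≤ Real.pi - ρ) then
          Real.pi * ρ else 0 := by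
    intro s
    have hws := gaussWeight_pos (nTheta Q) s
    have hwu := gaussWeight_le_asympWeight (nTheta Q) s
    have huu : √(u s) * √(u s) = u s := Real.mul_self_sqrt (asympWeight_nonneg _ s)
    have hww : √(w s) * √(w s) = w s := Real.mul_self_sqrt hws.le
    have hsq : √(w s) ≤ √(u s) := Real.sqrt_le_sqrt hwu
    have hsw := Real.sqrt_nonneg (w s)
    have hsub : (√(u s) - √(w s)) ^ 2 ≤ u s - w s := by
      nlinarith [mul_nonneg hsw (sub_nonneg.mpr hsq)]
    have hmem := legendreAngle_mem (nTheta Q) s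
    by_cases hs : ¬ (ρ ≤ legendreAngle (nTheta Q) s ∧ legendreAngle (nTheta Q) s ≤ Real.pi - ρ)
    -- near the poles: `|d| ≤ 1`, `j + 1/2 ≤ N_θ` and `u_s ≤ ρ π / N_θ`
    · rw [if_pos hs]
      have hsinle : Real.sin (legendreAngle (nTheta Q) s) ≤ ρ := by
        by_cases h : ρ ≤ legendreAngle (nTheta Q) s
        · have : Real.pi - legendreAngle (nTheta Q) s ≤ ρ := by
            by_contra hcon
            exact hs ⟨h, by linarith⟩
          rw [← Real.sin_pi_sub]
          exact (Real.sin_le (by linarith [hmem.2])).trans this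
        · exact (Real.sin_le hmem.1.le).trans (not_le.mp h).le
      have hdle : d s ^ 2 ≤ 1 := by
        rw [sq_le_one_iff_abs_le_one]
        exact abs_wignerSmallD_le_one l.a_le l.b_le hmem.1 hmem.2
      have hus : u s ≤ ρ * (Real.pi / nTheta Q) := by
        rw [hu, asympWeight]; gcongr
      have hu0 : 0 ≤ u s := asympWeight_nonneg _ s
      have h1 : (√(u s) - √(w s)) ^ 2 ≤ u s := by linarith
      have h2 : (l.j + 1 / 2) * d s ^ 2 * (√(u s) - √(w s)) ^ 2 ≤
          nTheta Q * 1 * (ρ * (Real.pi / nTheta Q)) := by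
        gcongr
        exact h1.trans hus
      have h3 : (nTheta Q : ℝ) * 1 * (ρ * (Real.pi / nTheta Q)) = Real.pi * ρ := by field_simp
      have h4 : 0 ≤ weightError (nTheta Q) ρ * ((l.j + 1 / 2) * d s ^ 2 * w s) := by positivity
      linarith
    -- away from the poles the two weights are close
    · rw [if_neg hs]
      rw [not_not] at hs
      have h1 := asympWeight_sub_le hρ hs.1 hs.2
      have h2 : (l.j + 1 / 2) * d s ^ 2 * (√(u s) - √(w s)) ^ 2 ≤
          (l.j + 1 / 2) * d s ^ 2 * (weightError (nTheta Q) ρ * w s) :=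
        mul_le_mul_of_nonneg_left (hsub.trans h1) (by positivity)
      linarith
  rw [e1]
  refine (Finset.sum_le_sum fun s _ => hterm s).trans ?_
  rw [Finset.sum_add_distrib, ← Finset.mul_sum, hnorm, mul_one, ← Finset.sum_filter,
    Finset.sum_const, nsmul_eq_mul, mul_comm _ (Real.pi * ρ)]
  have := card_legendreAngle_near_poles_le (nTheta Q) hρ
  gcongr

theorem tendsto_nTheta : Filter.Tendsto (fun Q => (nTheta Q : ℝ)) Filter.atTop Filter.atTop := by
  refine tendsto_natCast_atTop_atTop.comp ?_
  refine Filter.tendsto_atTop_mono (fun Q => Nat.le_succ (Q / 2)) ?_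
  exact Nat.tendsto_div_const_atTop (by norm_num)

open Filter Topology in
theorem tendsto_const_div_nTheta (c : ℝ) : Tendsto (fun Q => c / (nTheta Q : ℝ)) atTop (𝓝 0) :=
  tendsto_nTheta.const_div_atTop c

open Filter Topology in
theorem tendsto_weightError {δ : ℝ} (hδ : 0 < δ) :
    Tendsto (fun Q => weightError (nTheta Q) δ) atTop (𝓝 0) := by
  have h1 := (tendsto_const_div_nTheta 3).const_add 1
  have h2 := (((tendsto_const_div_nTheta (Real.pi / (4 * δ))).pow 2).const_add 1)
  have h := (h1.mul h2).sub_const 1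
  norm_num at h
  refine h.congr fun Q => ?_
  rw [weightError]
  congr 3
  field_simp
  norm_num

open Filter Topology in
theorem tendsto_norm_bound (K : ℝ) :
    Tendsto (fun Q => weightError (nTheta Q) (K / nTheta Q) +
      Real.pi * (K / nTheta Q) * (1 + K / nTheta Q * (nTheta Q + 1 / 2))) atTop
      (𝓝 (Real.pi ^ 2 / (16 * K ^ 2))) := by
  have h1 := (((tendsto_const_div_nTheta 3).const_add 1).mul_const
    (1 + Real.pi ^ 2 / (16 * K ^ 2))).sub_const 1
  have h2 := ((tendsto_const_div_nTheta K).const_mul Real.pi).mul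
    (((tendsto_const_div_nTheta (K / 2)).const_add (1 + K)))
  have h := h1.add h2
  rw [show (1 + 0) * (1 + Real.pi ^ 2 / (16 * K ^ 2)) - 1 + Real.pi * 0 * (1 + K + 0) =
    Real.pi ^ 2 / (16 * K ^ 2) by ring] at h
  refine h.congr fun Q => ?_
  have hn : (0 : ℝ) < nTheta Q := Nat.cast_pos.mpr (Nat.succ_pos _)
  rw [weightError, mul_div_cancel₀ K hn.ne']
  congr 2
  field_simp
  ring

theorem eventually_sqrt_sum_norm_V_sub_sampledD_le {ε : ℝ} (hε : 0 < ε) :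
    ∀ᶠ Q : ℕ in Filter.atTop, ∀ l : Label Q,
      √(∑ k : Grid Q, ‖V Q k l - sampledD l k‖ ^ 2) ≤ ε := by
  have hpi := Real.pi_pos
  have hK : 0 < Real.pi / ε := by positivity
  -- with the poles cut off at distance `K / N_θ`, the limit of the bound is below `ε²`
  have hlim : Real.pi ^ 2 / (16 * (Real.pi / ε) ^ 2) < ε ^ 2 := by
    have : Real.pi ^ 2 / (16 * (Real.pi / ε) ^ 2) = ε ^ 2 / 16 := by field_simp
    rw [this]
    have : 0 < ε ^ 2 := by positivity
    linarith
  filter_upwards [(tendsto_norm_bound (Real.pi / ε)).eventually_lt_const hlim] with Q hQ l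
  rw [Real.sqrt_le_left hε.le]
  have hn : (0 : ℝ) < nTheta Q := Nat.cast_pos.mpr (Nat.succ_pos _)
  exact (sum_norm_V_sub_sampledD_sq_le l (div_pos hK hn)).trans hQ.le

theorem eventually_norm_V_sub_sampledD_le {δ ε : ℝ} (hδ : 0 < δ) (hε : 0 < ε) :
    ∀ᶠ Q : ℕ in Filter.atTop, ∀ (l : Label Q) (k : Grid Q), δ ≤ gridTheta k →
      gridTheta k ≤ Real.pi - δ → ‖V Q k l - sampledD l k‖ ≤ ε * ‖sampledD l k‖ := by
  filter_upwards [(tendsto_weightError hδ).eventually_lt_const hε] with Q hQ l k h1 h2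
  exact (norm_V_sub_sampledD_le hδ h1 h2).trans
    (mul_le_mul_of_nonneg_right hQ.le (norm_nonneg _))

end DJT

theorem mainTheorem7 :
    -- the columns of `V` are linearly independent joint eigenstates, and for `j > 0` every joint
    -- eigenstate with the same quantum numbers is a multiple of the column
    (∀ Q : ℕ,
      (∀ l : DJT.Label Q, DJT.IsJointEigen l (fun k => DJT.V Q k l)) ∧
      LinearIndependent ℂ (fun (l : DJT.Label Q) (k : DJT.Grid Q) => DJT.V Q k l) ∧
      (∀ l : DJT.Label Q, l.twoJ ≠ 0 → ∀ v : DJT.Grid Q → ℂ, DJT.IsJointEigen l v →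
        ∃ c : ℂ, v = c • fun k => DJT.V Q k l)) ∧
    -- the Wigner functions are the eigenfunctions of the continuum operators
    (∀ (Q : ℕ) (l : DJT.Label Q) (θ φ ψ : ℝ), 0 < θ → θ < Real.pi →
      DJT.contLsq (DJT.wignerD l) θ φ ψ =
        ((l.j * (l.j + 1) : ℝ) : ℂ) * DJT.wignerD l θ φ ψ ∧
      DJT.contL3 (DJT.wignerD l) θ φ ψ = (l.mL : ℂ) * DJT.wignerD l θ φ ψ ∧
      DJT.contR3 (DJT.wignerD l) θ φ ψ = (-l.mR : ℂ) * DJT.wignerD l θ φ ψ) ∧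
    -- convergence of the columns in norm, uniformly over the first `N_q` eigenstates
    (∀ ε : ℝ, 0 < ε → ∀ᶠ Q : ℕ in Filter.atTop, ∀ l : DJT.Label Q,
      √(∑ k : DJT.Grid Q, ‖DJT.V Q k l - DJT.sampledD l k‖ ^ 2) ≤ ε) ∧
    -- convergence of the components, in relative error, away from the poles
    (∀ δ : ℝ, 0 < δ → ∀ ε : ℝ, 0 < ε → ∀ᶠ Q : ℕ in Filter.atTop,
      ∀ (l : DJT.Label Q) (k : DJT.Grid Q),
        δ ≤ DJT.gridTheta k → DJT.gridTheta k ≤ Real.pi - δ →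
        ‖DJT.V Q k l - DJT.sampledD l k‖ ≤ ε * ‖DJT.sampledD l k‖) :=
  ⟨fun Q => ⟨DJT.isJointEigen_col, DJT.linearIndependent_cols Q, fun _ hl _ hv => hv.eq_smul hl⟩,
    fun _ l _ φ ψ h0 hπ => ⟨DJT.contLsq_wignerD l φ ψ h0 hπ, DJT.contL3_wignerD l _ φ ψ,
      DJT.contR3_wignerD l _ φ ψ⟩,
    fun _ hε => DJT.eventually_sqrt_sum_norm_V_sub_sampledD_le hε,
    fun _ hδ _ hε => DJT.eventually_norm_V_sub_sampledD_le hδ hε⟩
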